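/- **Conventions.** A $3\mathsf{SAT}$ instance on $n$ variables is a set $\mathcal I$ of clauses $(c,U)$ with $c\in\{\pm1\}^3$ and $U\in[n]^3$. An assignment $x\in\{\pm1\}^n$ satisfies $(c,U)$ if $(c_1x_{U_1},c_2x_{U_2},c_3x_{U_3})\ne(1,1,1)$. It is $(1-\eta)$-satisfying if it satisfies at least $(1-\eta)|\mathcal I|$ clauses, and $\rho$-biased if $\frac1n\left|\sum_{i=1}^n x_i\right|\ge\rho$. For $0\le m\le 8n^3$, the random instance $\mathcal H_3(m,n)$ includes each of the $8n^3$ possible clauses independently with probability $\frac{m}{8n^3}$. **Theorem.** There is a deterministic polynomial-time algorithm $\mathcal A$ that takes a $3\mathsf{SAT}$ instance $\mathcal I$ on any number $n$ of variables and outputs a rational number $\mathcal A(\mathcal I)$, such that the following two conditions hold. 1. For every $n$, every $3\mathsf{SAT}$ instance $\mathcal I$ on $n$ variables and every real $\rho\ge\mathcal A(\mathcal I)$, no $\rho$-biased assignment is $\left(1-\frac{\rho}{32}\right)$-satisfying for $\mathcal I$. 2. Let $0<\delta\le 2$ be a constant and $\Delta=n^{\delta}$, and let $(\rho_n)_n$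 be any sequence of real numbers with $\rho_n\gg\sqrt{\frac{\log n}{\Delta}}$, that is, $\rho_n\big/\sqrt{\frac{\log n}{n^{\delta}}}\to\infty$ as $n\to\infty$. If $\mathcal I\sim\mathcal H_3(m,n)$ with $m=\Delta n=n^{1+\delta}$, then $\mathcal A(\mathcal I)\le\rho_n$ with probability tending to $1$ as $n\to\infty$. In particular, with high probability over $\mathcal I\sim\mathcal H_3(n^{1+\delta},n)$, the algorithm certifies that $\mathcal I$ has no $\rho_n$-biased assignment that is $\left(1-\frac{\rho_n}{32}\right)$-satisfying. -/

import Mathlib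

open Filter Topology

/-! ## Random signed hypergraphs and `kSAT` -/

/-- A potential hyperedge (clause) on `n` variables: a sign pattern `c ∈ {±1}^k` and a tuple
`U ∈ [n]^k` (repetitions allowed). -/
abbrev Clause (k n : ℕ) : Type := (Fin k → ℤˣ) × (Fin k → Fin n)

/-- A signed `k`-uniform hypergraph on `[n]`: a set of clauses. -/
abbrev SignedHypergraph (k n : ℕ) : Type := Finset (Clause k n)

/-- The probability of the event `E` when the instance is drawn by including each of the
`2 ^ k * n ^ k` potential clauses independently with probability `m / (2 ^ k * n ^ k)`. -/
noncomputable def instanceProb (k n : ℕ) (m : ℝ) (E : SignedHypergraph k n → Prop) : ℝ :=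
  let p : ℝ := m / (2 ^ k * (n : ℝ) ^ k)
  open scoped Classical in
  ∑ I : SignedHypergraph k n with E I, p ^ I.card * (1 - p) ^ (2 ^ k * n ^ k - I.card)

/-- The `kSAT` predicate on `{±1}^k`, where `-1` is "true": it is `1 - 𝟙[z = (1, …, 1)]`. -/
def kSAT {k : ℕ} (z : Fin k → ℤˣ) : ℕ := if z = 1 then 0 else 1

/-- The number of clauses `(c, U)` of `I` satisfied by `x`, i.e. with `kSAT (c ∘ x_U) = 1`. -/
def satisfiedCount {k n : ℕ} (I : SignedHypergraph k n) (x : Fin n → ℤˣ) : ℕ :=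
  ∑ e ∈ I, kSAT (fun i => e.1 i * x (e.2 i))

/-- `x` satisfies at least a `1 - η` fraction of the clauses of `I` (multiplied out, so that every
assignment satisfies the instance without clauses). -/
def IsSatisfying {k n : ℕ} (I : SignedHypergraph k n) (η : ℝ) (x : Fin n → ℤˣ) : Prop :=
  (1 - η) * (I.card : ℝ) ≤ (satisfiedCount I x : ℝ)

/-- `x` is `ρ`-biased: `(1 / n) * |∑ i, x i| ≥ ρ`. -/
def IsBiased {n : ℕ} (ρ : ℝ) (x : Fin n → ℤˣ) : Prop :=
  ρ ≤ (1 / (n : ℝ)) * |∑ i, (((x i : ℤˣ) : ℤ) : ℝ)|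

/-! ## A random access machine with logarithmic cost

Programs are structured programs over finitely many integer arrays; every evaluation of an operation
is charged the bit length of its result (and, recursively, of its operands and addresses). -/

namespace RAM

/-- The memory: `s a i` is the content of cell `i` of array `a`. A program mentions only finitely
many arrays. -/
abbrev State : Type := ℕ → ℤ → ℤ

/-- Integer expressions; `get a i` is the content of the cell of array `a` whose address is the
value of `i`. -/
inductive Expr : Type
  | const (z : ℤ)
  | get (a : ℕ) (i : Expr)
  | add (e₁ e₂ : Expr)
  | sub (e₁ e₂ : Expr)
  | mul (e₁ e₂ : Expr)
  | div (e₁ e₂ : Expr)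

/-- The value of an expression. -/
def Expr.val (s : State) : Expr → ℤ
  | .const z => z
  | .get a i => s a (i.val s)
  | .add e₁ e₂ => e₁.val s + e₂.val s
  | .sub e₁ e₂ => e₁.val s - e₂.val s
  | .mul e₁ e₂ => e₁.val s * e₂.val s
  | .div e₁ e₂ => e₁.val s / e₂.val s

/-- The charge for an integer: one plus its bit length. -/
def bitCost (z : ℤ) : ℕ := z.natAbs.size + 1

/-- The cost of evaluating an expression: the sum of the charges for the values of all its
subexpressions. -/
def Expr.cost (s : State) : Expr → ℕ
  | .const z => bitCost z
  | .get a i => bitCost (s a (i.val s)) + i.cost s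
  | .add e₁ e₂ => bitCost (e₁.val s + e₂.val s) + e₁.cost s + e₂.cost s
  | .sub e₁ e₂ => bitCost (e₁.val s - e₂.val s) + e₁.cost s + e₂.cost s
  | .mul e₁ e₂ => bitCost (e₁.val s * e₂.val s) + e₁.cost s + e₂.cost s
  | .div e₁ e₂ => bitCost (e₁.val s / e₂.val s) + e₁.cost s + e₂.cost s

/-- Programs. `store a i e` writes the value of `e` to cell `i` of array `a`; `branch` and `loop`
test whether the value of `e` is positive. -/
inductive Prog : Type
  | skip
  | store (a : ℕ) (i e : Expr)
  | seq (c₁ c₂ : Prog)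
  | branch (e : Expr) (c₁ c₂ : Prog)
  | loop (e : Expr) (c : Prog)

/-- The memory after writing `z` to cell `i` of array `a`. -/
def State.write (s : State) (a : ℕ) (i z : ℤ) : State :=
  Function.update s a (Function.update (s a) i z)

/-- `Exec c s t s'`: the program `c`, started in the memory `s`, halts in the memory `s'` at total
cost `t`. -/
inductive Exec : Prog → State → ℕ → State → Prop
  | skip (s : State) : Exec .skip s 1 s
  | store (s : State) (a : ℕ) (i e : Expr) :
      Exec (.store a i e) s (i.cost s + e.cost s + 1) (s.write a (i.val s) (e.val s))
  | seq {c₁ c₂ : Prog} {s s' s'' : State} {t t' : ℕ} :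
      Exec c₁ s t s' → Exec c₂ s' t' s'' → Exec (.seq c₁ c₂) s (t + t' + 1) s''
  | branch_pos {e : Expr} {c₁ c₂ : Prog} {s s' : State} {t : ℕ} :
      0 < e.val s → Exec c₁ s t s' → Exec (.branch e c₁ c₂) s (e.cost s + t + 1) s'
  | branch_neg {e : Expr} {c₁ c₂ : Prog} {s s' : State} {t : ℕ} :
      ¬ 0 < e.val s → Exec c₂ s t s' → Exec (.branch e c₁ c₂) s (e.cost s + t + 1) s'
  | loop_done {e : Expr} {c : Prog} {s : State} :
      ¬ 0 < e.val s → Exec (.loop e c) s (e.cost s + 1) s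
  | loop_step {e : Expr} {c : Prog} {s s' s'' : State} {t t' : ℕ} :
      0 < e.val s → Exec c s t s' → Exec (.loop e c) s' t' s'' →
        Exec (.loop e c) s (e.cost s + t + t' + 1) s''

/-- The initial memory: array `0` holds the input list, cell `0` of array `1` holds its length, and
all other cells are `0`. -/
def initial (l : List ℤ) : State := fun a i =>
  if a = 0 then (if 0 ≤ i then l.getD i.toNat 0 else 0)
  else if a = 1 ∧ i = 0 then (l.length : ℤ) else 0

/-- The size of an input list: the total bit length of its entries, plus one per entry. -/
def inputSize (l : List ℤ) : ℕ := (l.map bitCost).sum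

/-- `f` is computed by a single program in time polynomial in the size of the encoded input. The
output is the rational number whose numerator and denominator are left in the cells `0` and `1` of
array `0`. -/
def PolyTimeComputable {α : Type} (enc : α → List ℤ) (f : α → ℚ) : Prop :=
  ∃ (c : Prog) (P : Polynomial ℕ), ∀ a : α, ∃ (t : ℕ) (s : State),
    Exec c (initial (enc a)) t s ∧ t ≤ P.eval (inputSize (enc a)) ∧
      f a = (s 0 0 : ℚ) / (s 0 1 : ℚ)

end RAM

/-! ## Instances as inputs of an algorithm -/

/-- The enumeration of the potential clauses by positional notation: the index splits into the sign
pattern, the quotient by `n ^ 3` (binary digits, `0` for `+1` and `1` for `-1`), and the tuple, the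
remainder (digits in base `n`). -/
def clauseAt (n : ℕ) (j : Fin (2 ^ 3 * n ^ 3)) : Clause 3 n :=
  (fun i => if finFunctionFinEquiv.symm j.divNat i = (0 : Fin 2) then 1 else -1,
    finFunctionFinEquiv.symm j.modNat)

/-- An instance is presented by `n`, followed by the `0`/`1` table of membership of the `8 * n ^ 3`
potential clauses. -/
def encodeInstance (a : Σ n : ℕ, SignedHypergraph 3 n) : List ℤ :=
  (a.1 : ℤ) :: List.ofFn fun j => if clauseAt a.1 j ∈ a.2 then (1 : ℤ) else 0

/-! ### Trace inequalities for real symmetric matrices. -/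

section LinearAlgebra

open Matrix Finset

variable {ι : Type*} [Fintype ι] [DecidableEq ι]

/-! Certification. For a clause put `z_i = c_i x_{U_i}` and `w = c_0 c_1 c_2 x_{U_0} x_{U_1}`, so
that `z_0 z_1 z_2 = w x_{U_2}`. The Fourier expansion of the indicator of a violated clause reads
`8·𝟙[z = 1] = 1 + (linear and quadratic terms in z) + w x_{U_2}`. Combined with `(1 - s x_{U_2})(1 -
s w) ≥ 0` for a sign `s`, it bounds `s x_{U_2}` by eight times the violation indicator minus seven
characters (`mul_le_of_units`). Each character involves at most two coordinates of `x`, so its sum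
over the instance is half the value of a bilinear form at sign vectors, hence small whenever a
symmetric `n × n` matrix has small norm. What remains is the sum of `x` over third vertices. It is
close to `#I / n` times the sum of `x` when the degrees are nearly equal (`card_mul_abs_sum_le`). A
large bias therefore forces many violated clauses. The output combines the degree deviation with a
bound on the seven matrices; the latter comes from an even trace power with exponent about `2 log₂
n` (`dotProduct_mulVec_pow_le_trace`), so that integer arithmetic suffices.

Random instances. Reversing one suitable sign in a clause keeps its edge matrix and negates its
coefficient, and exchanging the membership of the two clauses preserves the law of the instance and
all degrees. This gives a matrix Khintchine inequality by exchangeable pairs: the trace moment of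
order `2(r+1)` is at most `(2r+1)` times a degree bound times the moment of order `2r`
(`sum_mul_trace_pow_le`). Degrees concentrate by a Bernstein bound (`bernoulliProb_degree_le`).
Markov's inequality for the trace sum then gives norms of order `√(Δ log n)`, and so an output of
order `√(log n / Δ)` (`biasBound_le_of_degreesNear`).

Running time. The trace is computed column by column through matrix-vector products. The program
multiplies only by bounded factors or to form remainders, so numbers grow by at most a constant
factor per step and a polynomial step count implies a polynomial logarithmic cost
(`Steps.exists_exec`). -/

theorem exists_pow_eq_conj_diagonal {A : Matrix ι ι ℝ} (hA : A.IsSymm) :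
    ∃ (U : Matrix ι ι ℝ) (d : ι → ℝ), U * Uᵀ = 1 ∧ Uᵀ * U = 1 ∧
      ∀ k : ℕ, A ^ k = U * diagonal (fun i => d i ^ k) * Uᵀ := by
  have hH : A.IsHermitian := by
    rw [Matrix.IsHermitian, conjTranspose_eq_transpose_of_trivial]; exact hA
  set U : Matrix ι ι ℝ := (hH.eigenvectorUnitary : Matrix ι ι ℝ) with hU
  have hstar : star U = Uᵀ := by
    rw [star_eq_conjTranspose, conjTranspose_eq_transpose_of_trivial]
  have h1 : U * Uᵀ = 1 := by
    rw [← hstar]; exact Unitary.coe_mul_star_self hH.eigenvectorUnitary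
  have h2 : Uᵀ * U = 1 := by
    rw [← hstar]; exact Unitary.coe_star_mul_self hH.eigenvectorUnitary
  have h3 : A = U * diagonal hH.eigenvalues * Uᵀ := by
    have := hH.spectral_theorem
    rw [Unitary.conjStarAlgAut_apply, ← hU, hstar] at this
    exact this
  refine ⟨U, hH.eigenvalues, h1, h2, fun k => ?_⟩
  induction k with
  | zero => simp [h1]
  | succ k ih =>
    have hd : diagonal (fun i => hH.eigenvalues i ^ (k + 1))
        = diagonal (fun i => hH.eigenvalues i ^ k) * diagonal hH.eigenvalues := by
      rw [diagonal_mul_diagonal]; simp [pow_succ]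
    calc A ^ (k + 1) = (U * diagonal (fun i => hH.eigenvalues i ^ k) * Uᵀ)
          * (U * diagonal hH.eigenvalues * Uᵀ) := by rw [pow_succ, ih, ← h3]
      _ = U * diagonal (fun i => hH.eigenvalues i ^ k) * (Uᵀ * U) * diagonal hH.eigenvalues * Uᵀ := by
          simp only [Matrix.mul_assoc]
      _ = _ := by rw [h2, hd]; simp only [Matrix.mul_assoc, Matrix.one_mul]

/-- In eigenbases of `A` and `Y` the weights are squared entries of `H`. They do not depend on the
exponents, so trace inequalities reduce to scalar inequalities for pairs of eigenvalues. -/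
theorem exists_trace_mul_pow_mul_pow {A Y H : Matrix ι ι ℝ} (hA : A.IsSymm) (hY : Y.IsSymm)
    (hH : H.IsSymm) :
    ∃ (w : ι → ι → ℝ) (a y : ι → ℝ), (∀ i j, 0 ≤ w i j) ∧
      ∀ q s : ℕ, (H * A ^ q * H * Y ^ s).trace = ∑ i, ∑ j, w i j * (a j ^ q * y i ^ s) := by
  obtain ⟨U, a, -, -, hU⟩ := exists_pow_eq_conj_diagonal hA
  obtain ⟨V, y, -, -, hV⟩ := exists_pow_eq_conj_diagonal hY
  refine ⟨fun i j => (Vᵀ * H * U) i j ^ 2, a, y, fun i j => sq_nonneg _, fun q s => ?_⟩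
  have ht : Uᵀ * H * V = (Vᵀ * H * U)ᵀ := by
    rw [transpose_mul, transpose_mul, transpose_transpose, hH.eq, Matrix.mul_assoc]
  calc (H * A ^ q * H * Y ^ s).trace
      = ((H * U * diagonal (fun i => a i ^ q) * Uᵀ * H * V * diagonal (fun i => y i ^ s)) * Vᵀ).trace := by
        rw [hU, hV]; simp only [Matrix.mul_assoc]
    _ = ((Vᵀ * H * U) * diagonal (fun i => a i ^ q) * ((Uᵀ * H * V) * diagonal (fun i => y i ^ s))).trace := by
        rw [trace_mul_comm]; simp only [Matrix.mul_assoc]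
    _ = _ := by
        rw [ht, trace]
        refine sum_congr rfl fun i _ => ?_
        rw [diag_apply, Matrix.mul_apply]
        refine sum_congr rfl fun j _ => ?_
        rw [mul_diagonal, mul_diagonal, transpose_apply]; ring

/-- For nonnegative numbers this is `(u ^ q - v ^ q) * (u ^ s - v ^ s) ≥ 0`. The even total degree
allows passing to absolute values. -/
theorem pow_mul_pow_add_pow_mul_pow_le (x y : ℝ) (q s r : ℕ) (h : q + s = 2 * r) :
    x ^ q * y ^ s + x ^ s * y ^ q ≤ x ^ (2 * r) + y ^ (2 * r) := by
  have key : ∀ u v : ℝ, 0 ≤ u → 0 ≤ v →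
      u ^ q * v ^ s + u ^ s * v ^ q ≤ u ^ (2 * r) + v ^ (2 * r) := by
    intro u v hu hv
    have : 0 ≤ (u ^ q - v ^ q) * (u ^ s - v ^ s) := by
      rcases le_total u v with huv | huv
      · exact mul_nonneg_of_nonpos_of_nonpos (sub_nonpos.2 (pow_le_pow_left₀ hu huv _))
          (sub_nonpos.2 (pow_le_pow_left₀ hu huv _))
      · exact mul_nonneg (sub_nonneg.2 (pow_le_pow_left₀ hv huv _))
          (sub_nonneg.2 (pow_le_pow_left₀ hv huv _))
    rw [← h, pow_add, pow_add]
    nlinarith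
  have h1 : ∀ z : ℝ, z ^ (2 * r) = |z| ^ (2 * r) := fun z => by
    rw [pow_mul, pow_mul, sq_abs]
  rw [h1 x, h1 y]
  refine le_trans (add_le_add ?_ ?_) (key |x| |y| (abs_nonneg _) (abs_nonneg _))
  · rw [← abs_pow, ← abs_pow, ← abs_mul]; exact le_abs_self _
  · rw [← abs_pow, ← abs_pow, ← abs_mul]; exact le_abs_self _

/-- Averaged over the exponents, the mixed traces are at most the pure ones. -/
theorem sum_trace_mul_pow_mul_pow_le {A Y H : Matrix ι ι ℝ} (hA : A.IsSymm) (hY : Y.IsSymm)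
    (hH : H.IsSymm) (r : ℕ) :
    2 * ∑ q ∈ range (2 * r + 1), (H * A ^ q * H * Y ^ (2 * r - q)).trace ≤
      (2 * r + 1) * ((H * H * A ^ (2 * r)).trace + (H * H * Y ^ (2 * r)).trace) := by
  obtain ⟨w, a, y, hw, h⟩ := exists_trace_mul_pow_mul_pow hA hY hH
  have hpair : ∀ q ∈ range (2 * r + 1),
      (H * A ^ q * H * Y ^ (2 * r - q)).trace
        + (H * A ^ (2 * r - q) * H * Y ^ q).trace
      ≤ (H * H * A ^ (2 * r)).trace + (H * H * Y ^ (2 * r)).trace := by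
    intro q hq
    -- The pure traces are the extreme cases `q = 2r` and `q = 0` of the mixed ones, so all four
    -- terms share the same weights.
    have e1 : (H * H * A ^ (2 * r)).trace = (H * A ^ (2 * r) * H * Y ^ 0).trace := by
      rw [pow_zero, Matrix.mul_one, trace_mul_cycle H (A ^ (2 * r)) H]
    have e2 : (H * H * Y ^ (2 * r)).trace = (H * A ^ 0 * H * Y ^ (2 * r)).trace := by
      rw [pow_zero, Matrix.mul_one]
    rw [e1, e2]
    simp only [h, ← sum_add_distrib, ← mul_add]
    refine sum_le_sum fun i _ => sum_le_sum fun j _ => mul_le_mul_of_nonneg_left ?_ (hw i j)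
    have hq' : q ≤ 2 * r := by simpa [Nat.lt_succ_iff] using hq
    have := pow_mul_pow_add_pow_mul_pow_le (a j) (y i) q (2 * r - q) r (by omega)
    simpa using this
  have hrefl := sum_range_reflect
    (fun q => (H * A ^ q * H * Y ^ (2 * r - q)).trace) (2 * r + 1)
  calc 2 * ∑ q ∈ range (2 * r + 1), (H * A ^ q * H * Y ^ (2 * r - q)).trace
      = ∑ q ∈ range (2 * r + 1), ((H * A ^ q * H * Y ^ (2 * r - q)).trace
        + (H * A ^ (2 * r - q) * H * Y ^ q).trace) := by
        rw [sum_add_distrib, two_mul]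
        congr 1
        rw [← hrefl]
        refine sum_congr rfl fun q hq => ?_
        have hq' : q ≤ 2 * r := by simpa [Nat.lt_succ_iff] using hq
        rw [show 2 * r + 1 - 1 - q = 2 * r - q by omega, show 2 * r - (2 * r - q) = q by omega]
    _ ≤ ∑ q ∈ range (2 * r + 1), ((H * H * A ^ (2 * r)).trace + (H * H * Y ^ (2 * r)).trace) :=
        sum_le_sum hpair
    _ = _ := by simp; ring

theorem pow_sub_pow_eq_sum {R : Type*} [Ring R] (x y : R) (k : ℕ) :
    x ^ k - y ^ k = ∑ q ∈ range k, x ^ q * (x - y) * y ^ (k - 1 - q) := by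
  have h : ∀ q ∈ range k, x ^ q * (x - y) * y ^ (k - 1 - q)
      = x ^ (q + 1) * y ^ (k - (q + 1)) - x ^ q * y ^ (k - q) := by
    intro q hq
    have hq' := mem_range.1 hq
    rw [show k - 1 - q = k - (q + 1) by omega, show k - q = k - (q + 1) + 1 by omega,
      pow_succ, pow_succ' y, mul_sub, sub_mul]
    simp only [mul_assoc]
  rw [sum_congr rfl h, sum_range_sub (fun q => x ^ q * y ^ (k - q))]
  simp

/-- The ratios `b (j + 1) / b j` are nondecreasing, hence at least `b 1 / b 0`. Everything is
cross-multiplied so that zeros do no harm. -/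
theorem pow_le_mul_pow_of_logConvex {b : ℕ → ℝ} (h0 : ∀ j, 0 ≤ b j)
    (h : ∀ j, b (j + 1) ^ 2 ≤ b j * b (j + 2)) (k : ℕ) :
    b 1 ^ (k + 1) ≤ b (k + 1) * b 0 ^ k := by
  have hr : ∀ j, b j * b 1 ≤ b (j + 1) * b 0 := by
    intro j
    induction j with
    | zero => exact (mul_comm _ _).le
    | succ j ih =>
      rcases (h0 (j + 1)).eq_or_lt with hz | hpos
      · rw [← hz, zero_mul]; exact mul_nonneg (h0 _) (h0 _)
      · refine le_of_mul_le_mul_left ?_ hpos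
        have h1 := mul_le_mul_of_nonneg_right (h j) (h0 1)
        have h2 := mul_le_mul_of_nonneg_left ih (h0 (j + 2))
        nlinarith
  induction k with
  | zero => simp
  | succ k ih =>
    calc b 1 ^ (k + 1 + 1) = b 1 ^ (k + 1) * b 1 := pow_succ _ _
      _ ≤ b (k + 1) * b 0 ^ k * b 1 := mul_le_mul_of_nonneg_right ih (h0 1)
      _ = (b (k + 1) * b 1) * b 0 ^ k := by ring
      _ ≤ (b (k + 1 + 1) * b 0) * b 0 ^ k :=
          mul_le_mul_of_nonneg_right (hr _) (pow_nonneg (h0 0) _)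
      _ = _ := by ring

theorem IsSymm.pow_matrix {A : Matrix ι ι ℝ} (hA : A.IsSymm) (k : ℕ) : (A ^ k).IsSymm := by
  rw [Matrix.IsSymm, transpose_pow, hA.eq]

theorem dotProduct_sq_le {ι : Type*} [Fintype ι] (u v : ι → ℝ) :
    (u ⬝ᵥ v) ^ 2 ≤ (u ⬝ᵥ u) * (v ⬝ᵥ v) := by
  have := sum_mul_sq_le_sq_mul_sq univ u v
  simpa [dotProduct, sq] using this

theorem dotProduct_self_pow_mulVec {A : Matrix ι ι ℝ} (hA : A.IsSymm) (x : ι → ℝ) (k l : ℕ) :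
    (A ^ k *ᵥ x) ⬝ᵥ (A ^ l *ᵥ x) = x ⬝ᵥ (A ^ (k + l) *ᵥ x) := by
  rw [pow_add, ← mulVec_mulVec, dotProduct_mulVec x, ← mulVec_transpose, (IsSymm.pow_matrix hA k).eq]

/-- The Frobenius norm dominates the operator norm, by Cauchy–Schwarz in each row. -/
theorem mulVec_dotProduct_self_le {ι : Type*} [Fintype ι] (P : Matrix ι ι ℝ) (x : ι → ℝ) :
    (P *ᵥ x) ⬝ᵥ (P *ᵥ x) ≤ (P * Pᵀ).trace * (x ⬝ᵥ x) := by
  have h : ∀ i, (P *ᵥ x) i * (P *ᵥ x) i ≤ (P i ⬝ᵥ P i) * (x ⬝ᵥ x) := fun i => by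
    rw [← sq]; exact dotProduct_sq_le (P i) x
  calc (P *ᵥ x) ⬝ᵥ (P *ᵥ x) ≤ ∑ i, (P i ⬝ᵥ P i) * (x ⬝ᵥ x) := sum_le_sum fun i _ => h i
    _ = _ := by rw [← sum_mul]; rfl

/-- A high even trace power bounds the bilinear form of a symmetric matrix. -/
theorem dotProduct_mulVec_pow_le_trace {S : Matrix ι ι ℝ} (hS : S.IsSymm) {x y : ι → ℝ} {N : ℝ}
    (hx : x ⬝ᵥ x = N) (hy : y ⬝ᵥ y = N) (k : ℕ) :
    (y ⬝ᵥ (S *ᵥ x)) ^ (2 * (k + 1)) ≤ N ^ (2 * (k + 1)) * (S ^ (2 * (k + 1))).trace := by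
  have hN : 0 ≤ N := hx ▸ sum_nonneg fun i _ => mul_self_nonneg _
  -- The squared norms of the iterates form a log-convex sequence, by symmetry of `S` and
  -- Cauchy–Schwarz. This bounds the first iterate by a high one, without eigenvalues.
  set b : ℕ → ℝ := fun j => (S ^ j *ᵥ x) ⬝ᵥ (S ^ j *ᵥ x) with hb
  have h0 : ∀ j, 0 ≤ b j := fun j => sum_nonneg fun i _ => mul_self_nonneg _
  have hlog : ∀ j, b (j + 1) ^ 2 ≤ b j * b (j + 2) := by
    intro j
    have : b (j + 1) = (S ^ j *ᵥ x) ⬝ᵥ (S ^ (j + 2) *ᵥ x) := by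
      simp only [hb]
      rw [dotProduct_self_pow_mulVec hS, dotProduct_self_pow_mulVec hS]
      rw [show j + 1 + (j + 1) = j + (j + 2) by ring]
    rw [this]; exact dotProduct_sq_le _ _
  have hb0 : b 0 = N := by simp [hb, hx]
  have hb1 : b 1 = (S *ᵥ x) ⬝ᵥ (S *ᵥ x) := by simp [hb]
  have hk : b (k + 1) ≤ (S ^ (2 * (k + 1))).trace * N := by
    refine (mulVec_dotProduct_self_le _ x).trans_eq ?_
    rw [(IsSymm.pow_matrix hS _).eq, ← pow_add, hx, two_mul]
  calc (y ⬝ᵥ (S *ᵥ x)) ^ (2 * (k + 1)) = ((y ⬝ᵥ (S *ᵥ x)) ^ 2) ^ (k + 1) := pow_mul _ _ _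
    _ ≤ (N * b 1) ^ (k + 1) := by
        refine pow_le_pow_left₀ (sq_nonneg _) ?_ _
        rw [hb1, ← hy]; exact dotProduct_sq_le _ _
    _ = N ^ (k + 1) * b 1 ^ (k + 1) := mul_pow _ _ _
    _ ≤ N ^ (k + 1) * (b (k + 1) * N ^ k) := by
        refine mul_le_mul_of_nonneg_left ?_ (pow_nonneg hN _)
        rw [← hb0]; exact pow_le_mul_pow_of_logConvex h0 hlog k
    _ ≤ N ^ (k + 1) * ((S ^ (2 * (k + 1))).trace * N * N ^ k) := by
        refine mul_le_mul_of_nonneg_left ?_ (pow_nonneg hN _)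
        exact mul_le_mul_of_nonneg_right hk (pow_nonneg hN _)
    _ = _ := by ring

theorem trace_pow_nonneg {S : Matrix ι ι ℝ} (hS : S.IsSymm) (k : ℕ) : 0 ≤ (S ^ (2 * k)).trace := by
  have : S ^ (2 * k) = S ^ k * (S ^ k)ᵀ := by rw [(IsSymm.pow_matrix hS k).eq, ← pow_add, two_mul]
  rw [this]
  exact sum_nonneg fun i _ => sum_nonneg fun j _ => mul_self_nonneg _

theorem pow_diag_nonneg {S : Matrix ι ι ℝ} (hS : S.IsSymm) (k : ℕ) (i : ι) :
    0 ≤ (S ^ (2 * k)) i i := by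
  have : S ^ (2 * k) = S ^ k * (S ^ k)ᵀ := by rw [(IsSymm.pow_matrix hS k).eq, ← pow_add, two_mul]
  rw [this]
  exact sum_nonneg fun j _ => mul_self_nonneg _

end LinearAlgebra

/-! ### Random subsets with independent membership. -/

section BernoulliSubset

open Finset

variable {α : Type*} [Fintype α]

/-- The weight of `I` when every element is included independently with probability `p`. -/
def bernoulliWeight (p : ℝ) (I : Finset α) : ℝ := p ^ #I * (1 - p) ^ (Fintype.card α - #I)

open scoped Classical in
/-- The probability of the event `E` for a random subset of density `p`. -/
noncomputable def bernoulliProb (p : ℝ) (E : Finset α → Prop) : ℝ :=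
  ∑ I : Finset α with E I, bernoulliWeight p I

theorem instanceProb_eq_bernoulliProb (k n : ℕ) (m : ℝ) (E : SignedHypergraph k n → Prop) :
    instanceProb k n m E = bernoulliProb (m / (2 ^ k * (n : ℝ) ^ k)) E := by
  have h : Fintype.card (Clause k n) = 2 ^ k * n ^ k := by
    simp [Clause, Fintype.card_prod, Fintype.card_units_int]
  simp only [instanceProb, bernoulliProb, bernoulliWeight, h]

theorem bernoulliWeight_nonneg {p : ℝ} (h0 : 0 ≤ p) (h1 : p ≤ 1) (I : Finset α) :
    0 ≤ bernoulliWeight p I :=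
  mul_nonneg (pow_nonneg h0 _) (pow_nonneg (sub_nonneg.2 h1) _)

/-- Independence in the form of a generating function: expanding the product on the right chooses,
for each element, membership or absence. -/
theorem sum_bernoulliWeight_mul_prod (p : ℝ) (g : α → ℝ) :
    ∑ I : Finset α, bernoulliWeight p I * ∏ e ∈ I, g e = ∏ e, (p * g e + (1 - p)) := by
  classical
  rw [prod_add, powerset_univ]
  refine sum_congr rfl fun I _ => ?_
  rw [prod_mul_distrib, prod_const, prod_const, ← compl_eq_univ_sdiff, card_compl, bernoulliWeight]
  ring

theorem sum_bernoulliWeight (p : ℝ) : ∑ I : Finset α, bernoulliWeight p I = 1 := by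
  simpa using sum_bernoulliWeight_mul_prod (α := α) p (fun _ => 1)

theorem bernoulliProb_nonneg {p : ℝ} (h0 : 0 ≤ p) (h1 : p ≤ 1) (E : Finset α → Prop) :
    0 ≤ bernoulliProb p E :=
  sum_nonneg fun I _ => bernoulliWeight_nonneg h0 h1 I

theorem bernoulliProb_mono {p : ℝ} (h0 : 0 ≤ p) (h1 : p ≤ 1) {E F : Finset α → Prop}
    (h : ∀ I, E I → F I) : bernoulliProb p E ≤ bernoulliProb p F := by
  classical
  refine sum_le_sum_of_subset_of_nonneg (fun I hI => ?_) fun I _ _ => bernoulliWeight_nonneg h0 h1 I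
  simp only [mem_filter, mem_univ, true_and] at hI ⊢
  exact h I hI

theorem bernoulliProb_add_compl (p : ℝ) (E : Finset α → Prop) :
    bernoulliProb p E + bernoulliProb p (fun I => ¬ E I) = 1 := by
  classical
  rw [← sum_bernoulliWeight (α := α) p, bernoulliProb, bernoulliProb,
    ← sum_filter_add_sum_filter_not univ E]
  congr!

theorem bernoulliProb_le_one {p : ℝ} (h0 : 0 ≤ p) (h1 : p ≤ 1) (E : Finset α → Prop) :
    bernoulliProb p E ≤ 1 := by
  have := bernoulliProb_add_compl p E
  have := bernoulliProb_nonneg h0 h1 (fun I => ¬ E I)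
  linarith

theorem bernoulliProb_or_le {p : ℝ} (h0 : 0 ≤ p) (h1 : p ≤ 1) (E F : Finset α → Prop) :
    bernoulliProb p (fun I => E I ∨ F I) ≤ bernoulliProb p E + bernoulliProb p F := by
  classical
  simp only [bernoulliProb, sum_filter]
  rw [← sum_add_distrib]
  refine sum_le_sum fun I _ => ?_
  have hw := bernoulliWeight_nonneg h0 h1 I
  split_ifs <;> first | linarith | tauto

theorem bernoulliProb_exists_le {κ : Type*} [Fintype κ] {p : ℝ} (h0 : 0 ≤ p) (h1 : p ≤ 1)
    (E : κ → Finset α → Prop) :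
    bernoulliProb p (fun I => ∃ k, E k I) ≤ ∑ k, bernoulliProb p (E k) := by
  classical
  simp only [bernoulliProb, sum_filter]
  rw [sum_comm]
  refine sum_le_sum fun I _ => ?_
  have hw := bernoulliWeight_nonneg h0 h1 I
  have hn : ∀ k ∈ (univ : Finset κ), 0 ≤ if E k I then bernoulliWeight p I else 0 :=
    fun k _ => by split_ifs <;> simp [hw]
  split_ifs with h
  · obtain ⟨k, hk⟩ := h
    refine le_trans ?_ (single_le_sum hn (mem_univ k))
    rw [if_pos hk]
  · exact sum_nonneg hn

theorem mul_bernoulliProb_le {p : ℝ} (h0 : 0 ≤ p) (h1 : p ≤ 1) {F : Finset α → ℝ}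
    (hF : ∀ I, 0 ≤ F I) (t : ℝ) :
    t * bernoulliProb p (fun I => t ≤ F I) ≤ ∑ I, bernoulliWeight p I * F I := by
  classical
  rw [bernoulliProb, mul_sum, sum_filter]
  refine sum_le_sum fun I _ => ?_
  have hw := bernoulliWeight_nonneg h0 h1 I
  split_ifs with h
  · rw [mul_comm]; exact mul_le_mul_of_nonneg_left h hw
  · exact mul_nonneg hw (hF I)

/-- A Bernstein type tail bound for linear statistics of a random subset. -/
theorem bernoulliProb_le_exp {p : ℝ} (h0 : 0 ≤ p) (h1 : p ≤ 1) (a : α → ℝ) (c t : ℝ)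
    (ha : ∀ e, |c * a e| ≤ 1) (hc : 0 ≤ c) :
    bernoulliProb p (fun I => t ≤ ∑ e ∈ I, a e) ≤
      Real.exp (p * ∑ e, (c * a e + (c * a e) ^ 2) - c * t) := by
  have hprod : ∏ e, (p * Real.exp (c * a e) + (1 - p)) ≤
      Real.exp (p * ∑ e, (c * a e + (c * a e) ^ 2)) := by
    rw [mul_sum, Real.exp_sum]
    refine prod_le_prod (fun e _ => ?_) fun e _ => ?_
    · exact add_nonneg (mul_nonneg h0 (Real.exp_pos _).le) (sub_nonneg.2 h1)
    -- Uses `exp v ≤ 1 + v + v ^ 2` for `|v| ≤ 1`, and then `1 + y ≤ exp y`.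
    · have h := (abs_le.1 (Real.abs_exp_sub_one_sub_id_le (ha e))).2
      have h2 := Real.add_one_le_exp (p * (c * a e + (c * a e) ^ 2))
      nlinarith
  have hM := mul_bernoulliProb_le h0 h1 (F := fun I : Finset α => Real.exp (c * ∑ e ∈ I, a e))
    (fun I => (Real.exp_pos _).le) (Real.exp (c * t))
  have hmono : bernoulliProb p (fun I : Finset α => t ≤ ∑ e ∈ I, a e) ≤
      bernoulliProb p (fun I : Finset α => Real.exp (c * t) ≤ Real.exp (c * ∑ e ∈ I, a e)) :=
    bernoulliProb_mono h0 h1 fun I hI => Real.exp_le_exp.2 (mul_le_mul_of_nonneg_left hI hc)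
  have hsum : ∑ I : Finset α, bernoulliWeight p I * Real.exp (c * ∑ e ∈ I, a e)
      = ∏ e, (p * Real.exp (c * a e) + (1 - p)) := by
    rw [← sum_bernoulliWeight_mul_prod]
    exact sum_congr rfl fun I _ => by rw [mul_sum, Real.exp_sum]
  rw [Real.exp_sub, le_div_iff₀ (Real.exp_pos _), mul_comm]
  refine (mul_le_mul_of_nonneg_left hmono (Real.exp_pos _).le).trans (hM.trans ?_)
  exact hsum.trans_le hprod

end BernoulliSubset

/-! ### Trace moments of signed random sums by exchangeable pairs. -/

section TraceMoment

open Finset Matrix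

/-- The signed sum over `I` of the matrices `H e`. -/
def signedSum {α ι : Type*} (χ : α → ℝ) (H : α → Matrix ι ι ℝ) (I : Finset α) : Matrix ι ι ℝ :=
  ∑ e ∈ I, χ e • H e

theorem signedSum_isSymm {α ι : Type*} {χ : α → ℝ} {H : α → Matrix ι ι ℝ}
    (hH : ∀ e, (H e).IsSymm) (I : Finset α) : (signedSum χ H I).IsSymm := by
  rw [Matrix.IsSymm, signedSum, transpose_sum]
  exact sum_congr rfl fun e _ => by rw [transpose_smul, (hH e).eq]

variable {α ι : Type*} [DecidableEq α]

/-- The image of a set under the transposition of `e` and `e'`. -/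
def swapImage (e e' : α) (I : Finset α) : Finset α := I.map (Equiv.swap e e').toEmbedding

theorem mem_swapImage {e e' f : α} {I : Finset α} :
    f ∈ swapImage e e' I ↔ Equiv.swap e e' f ∈ I := by
  simp [swapImage, Finset.mem_map_equiv]

theorem swapImage_swapImage (e e' : α) (I : Finset α) :
    swapImage e e' (swapImage e e' I) = I := by
  ext f; simp [mem_swapImage]

variable [Fintype α]

theorem sum_comp_swapImage (e e' : α) (F : Finset α → ℝ) :
    ∑ I, F (swapImage e e' I) = ∑ I, F I :=
  Equiv.sum_comp (Function.Involutive.toPerm _ (swapImage_swapImage e e')) F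

theorem bernoulliWeight_swapImage (p : ℝ) (e e' : α) (I : Finset α) :
    bernoulliWeight p (swapImage e e' I) = bernoulliWeight p I := by
  simp [bernoulliWeight, swapImage]

theorem signedSum_eq_sum_univ (χ : α → ℝ) (H : α → Matrix ι ι ℝ) (I : Finset α) :
    signedSum χ H I = ∑ e, ((if e ∈ I then 1 else 0) * χ e) • H e := by
  simp [signedSum, ite_mul, ite_smul, sum_ite_mem]

variable {χ : α → ℝ} {H : α → Matrix ι ι ℝ} {τ : α → α}

/-- Only the terms of `e` and `τ e` change. They carry the same matrix with opposite signs, so their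
two changes are equal, whence the factor `2`. -/
theorem signedSum_sub_swapImage (hχ : ∀ e, χ (τ e) = -χ e) (hχ1 : ∀ e, χ e ^ 2 = 1)
    (hτH : ∀ e, H (τ e) = H e) (e : α) (I : Finset α) :
    signedSum χ H I - signedSum χ H (swapImage e (τ e) I) =
      (2 * (((if e ∈ I then 1 else 0) - (if τ e ∈ I then 1 else 0)) * χ e)) • H e := by
  have hne : e ≠ τ e := fun h => by
    have h1 := hχ e
    rw [← h] at h1
    have h2 := hχ1 e
    have h3 : χ e = 0 := by linarith
    simp [h3] at h2
  rw [signedSum_eq_sum_univ, signedSum_eq_sum_univ, ← sum_sub_distrib,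
    sum_eq_add e (τ e) hne]
  · simp only [mem_swapImage, Equiv.swap_apply_left, Equiv.swap_apply_right, hτH, hχ, ← sub_smul,
      ← add_smul]
    congr 1; ring
  · intro f _ hf
    simp [mem_swapImage, Equiv.swap_apply_of_ne_of_ne hf.1 hf.2]
  · simp
  · simp

variable [Fintype ι] [DecidableEq ι]

/-- Telescoping the difference of powers puts a second copy of `H e` into each term. The resulting
mixed traces are bounded on average by `sum_trace_mul_pow_mul_pow_le`. -/
theorem trace_mul_signedSum_pow_sub (hχ : ∀ e, χ (τ e) = -χ e) (hχ1 : ∀ e, χ e ^ 2 = 1)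
    (hτH : ∀ e, H (τ e) = H e) (hH : ∀ e, (H e).IsSymm) (r : ℕ) (e : α) (I : Finset α) (ξ : ℝ)
    (hξ : ξ = ((if e ∈ I then 1 else 0) - (if τ e ∈ I then 1 else 0)) * χ e) :
    ξ * ((H e * signedSum χ H I ^ (2 * r + 1)).trace -
        (H e * signedSum χ H (swapImage e (τ e) I) ^ (2 * r + 1)).trace) ≤
      ξ ^ 2 * ((2 * r + 1) * ((H e * H e * signedSum χ H I ^ (2 * r)).trace +
        (H e * H e * signedSum χ H (swapImage e (τ e) I) ^ (2 * r)).trace)) := by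
  have h1 : ξ * ((H e * signedSum χ H I ^ (2 * r + 1)).trace -
        (H e * signedSum χ H (swapImage e (τ e) I) ^ (2 * r + 1)).trace) =
      ξ ^ 2 * (2 * ∑ q ∈ range (2 * r + 1), (H e * signedSum χ H I ^ q * H e *
        signedSum χ H (swapImage e (τ e) I) ^ (2 * r - q)).trace) := by
    rw [← trace_sub, ← Matrix.mul_sub, pow_sub_pow_eq_sum,
      signedSum_sub_swapImage hχ hχ1 hτH, ← hξ, Matrix.mul_sum, trace_sum, mul_sum, mul_sum, mul_sum]
    refine sum_congr rfl fun q _ => ?_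
    rw [Matrix.mul_smul, Matrix.smul_mul, Matrix.mul_smul, trace_smul, smul_eq_mul,
      Nat.add_sub_cancel]
    simp only [Matrix.mul_assoc]
    ring
  rw [h1]
  exact mul_le_mul_of_nonneg_left
    (sum_trace_mul_pow_mul_pow_le (signedSum_isSymm hH I) (signedSum_isSymm hH _) (hH e) r)
    (sq_nonneg _)

theorem trace_mul_mul_pow_nonneg {A B : Matrix ι ι ℝ} (hA : A.IsSymm) (hB : B.IsSymm) (r : ℕ) :
    0 ≤ (B * B * A ^ (2 * r)).trace := by
  have : (B * B * A ^ (2 * r)).trace = ((A ^ r * B) * (A ^ r * B)ᵀ).trace := by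
    rw [transpose_mul, hB.eq, (IsSymm.pow_matrix hA r).eq, trace_mul_comm, two_mul, pow_add]
    simp only [Matrix.mul_assoc]
    rw [trace_mul_comm]
    simp only [Matrix.mul_assoc]
  rw [this]
  exact sum_nonneg fun i _ => sum_nonneg fun j _ => mul_self_nonneg _

/-- The exchange argument: a recursion for the even trace moments of a signed random sum. -/
theorem sum_mul_trace_pow_le (hχ : ∀ e, χ (τ e) = -χ e) (hχ1 : ∀ e, χ e ^ 2 = 1)
    (hτH : ∀ e, H (τ e) = H e) (hH : ∀ e, (H e).IsSymm) (hτ : Function.Involutive τ)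
    {W : Finset α → ℝ} (hW0 : ∀ I, 0 ≤ W I) (hW : ∀ e I, W (swapImage e (τ e) I) = W I)
    {d : ℝ} (hd : ∀ I, W I ≠ 0 → ∀ Y : Matrix ι ι ℝ, (∀ i, 0 ≤ Y i i) →
      ∑ e ∈ I, (H e * H e * Y).trace ≤ d * Y.trace) (r : ℕ) :
    ∑ I, W I * (signedSum χ H I ^ (2 * (r + 1))).trace ≤
      (2 * r + 1) * d * ∑ I, W I * (signedSum χ H I ^ (2 * r)).trace := by
  set X : Finset α → Matrix ι ι ℝ := signedSum χ H with hX
  set δ : α → Finset α → ℝ := fun e I => if e ∈ I then 1 else 0 with hδ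
  -- The joint contribution of `e` and `τ e` to the signed coefficient of `H e`; it is odd under the
  -- swap.
  set ξ : α → Finset α → ℝ := fun e I => (δ e I - δ (τ e) I) * χ e with hξ
  set u : α → Finset α → ℝ := fun e I => (H e * X I ^ (2 * r + 1)).trace with hu
  set z : α → Finset α → ℝ := fun e I => (H e * H e * X I ^ (2 * r)).trace with hz
  have hz0 : ∀ e I, 0 ≤ z e I := fun e I =>
    trace_mul_mul_pow_nonneg (signedSum_isSymm hH I) (hH e) r
  have hξs : ∀ e I, ξ e (swapImage e (τ e) I) = -ξ e I := fun e I => by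
    simp only [hξ, hδ, mem_swapImage, Equiv.swap_apply_left, Equiv.swap_apply_right]; ring
  set Φ : α → ℝ := fun e => ∑ I, W I * (δ e I * χ e * u e I) with hΦ
  have hpair : ∀ e, Φ e + Φ (τ e) = ∑ I, W I * (ξ e I * u e I) := by
    intro e
    simp only [hΦ, ← sum_add_distrib, ← mul_add]
    refine sum_congr rfl fun I _ => ?_
    have : u (τ e) I = u e I := by simp only [hu, hτH]
    rw [this, hχ]; simp only [hξ]; ring
  have hneg : ∀ e, Φ e + Φ (τ e) = -∑ I, W I * (ξ e I * u e (swapImage e (τ e) I)) := by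
    intro e
    rw [hpair, ← sum_comp_swapImage e (τ e), ← sum_neg_distrib]
    refine sum_congr rfl fun I _ => ?_
    rw [hW, hξs]; ring
  have hbound : ∀ e, Φ e + Φ (τ e) ≤ (2 * r + 1) * ∑ I, W I * (ξ e I ^ 2 * z e I) := by
    intro e
    -- Averaging the expressions before and after the swap turns the expectation of `ξ * u` into one
    -- of `ξ` times a difference of `u`.
    have h1 : 2 * (Φ e + Φ (τ e)) =
        ∑ I, W I * (ξ e I * (u e I - u e (swapImage e (τ e) I))) := by
      rw [two_mul]
      nth_rewrite 1 [hpair]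
      rw [hneg, ← sub_eq_add_neg, ← sum_sub_distrib]
      exact sum_congr rfl fun I _ => by ring
    have h2 : ∑ I, W I * (ξ e I ^ 2 * z e (swapImage e (τ e) I)) =
        ∑ I, W I * (ξ e I ^ 2 * z e I) := by
      rw [← sum_comp_swapImage e (τ e)]
      refine sum_congr rfl fun I _ => ?_
      rw [hW, hξs, swapImage_swapImage, neg_sq]
    have h3 : ∑ I, W I * (ξ e I * (u e I - u e (swapImage e (τ e) I))) ≤
        ∑ I, W I * (ξ e I ^ 2 * ((2 * r + 1) * (z e I + z e (swapImage e (τ e) I)))) :=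
      sum_le_sum fun I _ => mul_le_mul_of_nonneg_left
        (trace_mul_signedSum_pow_sub hχ hχ1 hτH hH r e I _ rfl) (hW0 I)
    have h4 : ∑ I, W I * (ξ e I ^ 2 * ((2 * r + 1) * (z e I + z e (swapImage e (τ e) I)))) =
        (2 * r + 1) * (∑ I, W I * (ξ e I ^ 2 * z e I) +
          ∑ I, W I * (ξ e I ^ 2 * z e (swapImage e (τ e) I))) := by
      rw [← sum_add_distrib, mul_sum]
      exact sum_congr rfl fun I _ => by ring
    rw [h2] at h4
    linarith
  have hbound' : ∀ e, Φ e + Φ (τ e) ≤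
      (2 * r + 1) * ∑ I, W I * (δ e I * z e I + δ (τ e) I * z (τ e) I) := by
    intro e
    refine (hbound e).trans (mul_le_mul_of_nonneg_left ?_ (by positivity))
    refine sum_le_sum fun I _ => mul_le_mul_of_nonneg_left ?_ (hW0 I)
    have h1 : z (τ e) I = z e I := by simp only [hz, hτH]
    rw [h1, ← add_mul]
    refine mul_le_mul_of_nonneg_right ?_ (hz0 e I)
    -- Here `ξ ^ 2 ≤ δ e + δ (τ e)`, which restores a sum over the members of `I`.
    simp only [hξ, mul_pow, hχ1, hδ]
    split_ifs <;> norm_num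
  have hreindex : ∀ F : α → ℝ, ∑ e, F (τ e) = ∑ e, F e := fun F =>
    Equiv.sum_comp (hτ.toPerm τ) F
  have hmain : ∑ I, W I * (X I ^ (2 * (r + 1))).trace = ∑ e, Φ e := by
    simp only [hΦ]
    rw [sum_comm]
    refine sum_congr rfl fun I _ => ?_
    rw [← mul_sum]
    congr 1
    rw [show 2 * (r + 1) = (2 * r + 1) + 1 by ring, pow_succ']
    nth_rewrite 1 [hX]
    rw [signedSum_eq_sum_univ, Matrix.sum_mul, trace_sum]
    refine sum_congr rfl fun e _ => ?_
    rw [Matrix.smul_mul, trace_smul, smul_eq_mul]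
  have hsum : ∑ I, W I * ∑ e, δ e I * z e I ≤ d * ∑ I, W I * (X I ^ (2 * r)).trace := by
    rw [mul_sum]
    refine sum_le_sum fun I _ => ?_
    by_cases h0 : W I = 0
    · simp [h0]
    · have h1 := hd I h0 (X I ^ (2 * r)) (pow_diag_nonneg (signedSum_isSymm hH I) r)
      have h2 : ∑ e, δ e I * z e I = ∑ e ∈ I, (H e * H e * X I ^ (2 * r)).trace := by
        simp [hδ, hz, ite_mul, sum_ite_mem]
      rw [h2, mul_left_comm]
      exact mul_le_mul_of_nonneg_left h1 (hW0 I)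
  -- Summing over all `e` visits each pair twice, on both sides, so the factors `2` cancel.
  have htot : ∑ e, (Φ e + Φ (τ e)) ≤
      (2 * r + 1) * (2 * ∑ I, W I * ∑ e, δ e I * z e I) := by
    refine (sum_le_sum fun e _ => hbound' e).trans_eq ?_
    rw [← mul_sum, sum_comm]
    congr 1
    rw [mul_sum]
    refine sum_congr rfl fun I _ => ?_
    rw [← mul_sum, sum_add_distrib, hreindex fun e => δ e I * z e I]
    ring
  rw [sum_add_distrib, hreindex Φ, ← hmain] at htot
  have h5 := mul_le_mul_of_nonneg_left hsum (show (0 : ℝ) ≤ 2 * r + 1 by positivity)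
  linarith

theorem sum_mul_trace_pow_le_pow (hχ : ∀ e, χ (τ e) = -χ e) (hχ1 : ∀ e, χ e ^ 2 = 1)
    (hτH : ∀ e, H (τ e) = H e) (hH : ∀ e, (H e).IsSymm) (hτ : Function.Involutive τ)
    {W : Finset α → ℝ} (hW0 : ∀ I, 0 ≤ W I) (hW : ∀ e I, W (swapImage e (τ e) I) = W I)
    {d : ℝ} (hd0 : 0 ≤ d) (hd : ∀ I, W I ≠ 0 → ∀ Y : Matrix ι ι ℝ, (∀ i, 0 ≤ Y i i) →
      ∑ e ∈ I, (H e * H e * Y).trace ≤ d * Y.trace) (R r : ℕ) (hr : r ≤ R) :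
    ∑ I, W I * (signedSum χ H I ^ (2 * r)).trace ≤
      (2 * R * d) ^ r * ((∑ I, W I) * Fintype.card ι) := by
  induction r with
  | zero => simp [sum_mul]
  | succ r ih =>
    refine (sum_mul_trace_pow_le hχ hχ1 hτH hH hτ hW0 hW hd r).trans ?_
    have h1 : 0 ≤ ∑ I, W I * (signedSum χ H I ^ (2 * r)).trace :=
      sum_nonneg fun I _ => mul_nonneg (hW0 I) (trace_pow_nonneg (signedSum_isSymm hH I) r)
    have h2 : (2 * r + 1 : ℝ) * d ≤ 2 * R * d := by
      refine mul_le_mul_of_nonneg_right ?_ hd0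
      have : (r : ℝ) + 1 ≤ R := by exact_mod_cast hr
      linarith
    calc (2 * r + 1) * d * ∑ I, W I * (signedSum χ H I ^ (2 * r)).trace
        ≤ 2 * R * d * ((2 * R * d) ^ r * ((∑ I, W I) * Fintype.card ι)) :=
          mul_le_mul h2 (ih (by omega)) h1 (by positivity)
      _ = _ := by ring

end TraceMoment

/-! ### The certificate and its soundness. -/

section Certificate

open Finset Matrix

/-- A bilinear form attached to an instance: a clause contributes the product of its signs at the
positions `signs` to the entries given by its vertices at the positions `fst` and `snd`. -/
structure SignForm where
  signs : List (Fin 3)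
  fst : Fin 3
  snd : Fin 3

namespace SignForm

variable {n : ℕ}

def sign (f : SignForm) (e : Clause 3 n) : ℤ := (f.signs.map fun i => ((e.1 i : ℤˣ) : ℤ)).prod

/-- If the two vertices coincide, the diagonal entry is `2`. Linear characters then get the same
factor `2` in their bilinear forms as quadratic ones. -/
def edge (f : SignForm) (R : Type*) [Semiring R] (e : Clause 3 n) : Matrix (Fin n) (Fin n) R :=
  single (e.2 f.fst) (e.2 f.snd) 1 + single (e.2 f.snd) (e.2 f.fst) 1

def matrix (f : SignForm) (I : SignedHypergraph 3 n) : Matrix (Fin n) (Fin n) ℤ :=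
  ∑ e ∈ I, f.sign e • f.edge ℤ e

theorem edge_isSymm (f : SignForm) (R : Type*) [Semiring R] (e : Clause 3 n) :
    (f.edge R e).IsSymm := by
  rw [Matrix.IsSymm, edge, transpose_add, transpose_single, transpose_single, add_comm]

theorem map_matrix (f : SignForm) (I : SignedHypergraph 3 n) :
    (f.matrix I).map (Int.castRingHom ℝ) =
      signedSum (fun e => (f.sign e : ℝ)) (f.edge ℝ) I := by
  ext i j
  simp [matrix, signedSum, edge, Matrix.sum_apply, Matrix.single_apply]

/-- Links the integer trace that the machine computes with the real matrix of the moment estimates.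
-/
theorem trace_matrix_pow_cast (f : SignForm) (I : SignedHypergraph 3 n) (k : ℕ) :
    (((f.matrix I ^ k).trace : ℤ) : ℝ) =
      (signedSum (fun e => (f.sign e : ℝ)) (f.edge ℝ) I ^ k).trace := by
  rw [← map_matrix, ← RingHom.mapMatrix_apply, ← map_pow, RingHom.mapMatrix_apply]
  simp [trace]

theorem trace_matrix_pow_nonneg (f : SignForm) (I : SignedHypergraph 3 n) (k : ℕ) :
    0 ≤ (f.matrix I ^ (2 * k)).trace := by
  have : (0 : ℝ) ≤ ((f.matrix I ^ (2 * k)).trace : ℤ) := by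
    rw [trace_matrix_pow_cast]
    exact trace_pow_nonneg (signedSum_isSymm (f.edge_isSymm ℝ) I) k
  exact_mod_cast this

theorem edge_mulVec (f : SignForm) {R : Type*} [Semiring R] (e : Clause 3 n) (x : Fin n → R) :
    f.edge R e *ᵥ x =
      Pi.single (e.2 f.fst) (x (e.2 f.snd)) + Pi.single (e.2 f.snd) (x (e.2 f.fst)) := by
  rw [edge, add_mulVec, single_mulVec, single_mulVec, one_mul, one_mul]; rfl

theorem dotProduct_matrix_mulVec (f : SignForm) (I : SignedHypergraph 3 n) (x y : Fin n → ℤ) :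
    y ⬝ᵥ (f.matrix I *ᵥ x) = ∑ e ∈ I, f.sign e *
      (y (e.2 f.fst) * x (e.2 f.snd) + y (e.2 f.snd) * x (e.2 f.fst)) := by
  rw [matrix, sum_mulVec, dotProduct_sum]
  refine sum_congr rfl fun e _ => ?_
  rw [smul_mulVec, dotProduct_smul, edge_mulVec, dotProduct_add, dotProduct_single,
    dotProduct_single, smul_eq_mul]

end SignForm

/-- The forms in the certificate: the linear and quadratic characters of the clause predicate, and
the quadratic form which compares a clause with a parity constraint. -/
def signForms : List SignForm :=
  [⟨[0], 0, 0⟩, ⟨[1], 1, 1⟩, ⟨[2], 2, 2⟩, ⟨[0, 1], 0, 1⟩, ⟨[0, 2], 0, 2⟩, ⟨[1, 2], 1, 2⟩,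
    ⟨[0, 1, 2], 0, 1⟩]

variable {n : ℕ}

/-- Even, so that traces are nonnegative, and large enough that the root of this order of a power `n
^ 2` stays bounded. -/
def traceExponent (n : ℕ) : ℕ := 2 * (Nat.clog 2 n + 1)

def traceSum (I : SignedHypergraph 3 n) : ℤ :=
  (signForms.map fun f => (f.matrix I ^ traceExponent n).trace).sum

/-- Comparing with powers of `2 ^ traceExponent n` replaces the extraction of a root and loses at
most a factor of two in the nontrivial range. -/
def normLog (I : SignedHypergraph 3 n) : ℕ :=
  Nat.clog (2 ^ traceExponent n) (traceSum I).toNat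

/-- A power of two which bounds the spectral norms of all forms. -/
def normBound (I : SignedHypergraph 3 n) : ℕ := 2 ^ normLog I

def degree (I : SignedHypergraph 3 n) (a : Fin 3) (i : Fin n) : ℕ := #{e ∈ I | e.2 a = i}

/-- Scaled by `n` to compare the degrees with their mean inside the integers. -/
def degreeDeviation (I : SignedHypergraph 3 n) : ℤ :=
  ∑ i, |(n : ℤ) * degree I 2 i - #I|

/-- The certified bound on the bias. -/
def biasBound (a : Σ n : ℕ, SignedHypergraph 3 n) : ℚ :=
  -- A bias never exceeds `1`, so the value `2` makes soundness vacuous in the degenerate cases.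
  if a.2.card * a.1 = 0 then 2
  else ((2 * degreeDeviation a.2 + 7 * a.1 ^ 2 * normBound a.2 + 1 : ℤ) : ℚ) /
    ((a.2.card * a.1 : ℕ) : ℚ)

theorem trace_le_traceSum (I : SignedHypergraph 3 n) {f : SignForm} (hf : f ∈ signForms) :
    (f.matrix I ^ traceExponent n).trace ≤ traceSum I :=
  List.single_le_sum (by
    simp only [List.mem_map]
    rintro _ ⟨g, -, rfl⟩
    exact g.trace_matrix_pow_nonneg I _) _ (List.mem_map.2 ⟨f, hf, rfl⟩)

theorem traceSum_nonneg (I : SignedHypergraph 3 n) : 0 ≤ traceSum I :=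
  List.sum_nonneg (by
    simp only [List.mem_map]
    rintro _ ⟨g, -, rfl⟩
    exact g.trace_matrix_pow_nonneg I _)

theorem one_lt_two_pow_traceExponent (n : ℕ) : 1 < 2 ^ traceExponent n :=
  Nat.one_lt_two_pow (by simp [traceExponent])

theorem traceSum_le_normBound_pow (I : SignedHypergraph 3 n) :
    traceSum I ≤ (normBound I : ℤ) ^ traceExponent n := by
  have h := Nat.le_pow_clog (one_lt_two_pow_traceExponent n) (traceSum I).toNat
  rw [← pow_mul, mul_comm, pow_mul] at h
  have h2 : ((traceSum I).toNat : ℤ) ≤ (normBound I : ℤ) ^ traceExponent n := by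
    exact_mod_cast h
  rwa [Int.toNat_of_nonneg (traceSum_nonneg I)] at h2

theorem abs_dotProduct_matrix_mulVec_le (I : SignedHypergraph 3 n) {f : SignForm}
    (hf : f ∈ signForms) (x y : Fin n → ℤˣ) :
    |(fun i => (y i : ℤ)) ⬝ᵥ (f.matrix I *ᵥ fun i => (x i : ℤ))| ≤ n * normBound I := by
  set S := signedSum (fun e => (f.sign e : ℝ)) (f.edge ℝ) I
  have hone : ∀ u : Fin n → ℤˣ, (fun i => ((u i : ℤ) : ℝ)) ⬝ᵥ (fun i => ((u i : ℤ) : ℝ)) = n := by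
    intro u
    have : ∀ i, ((u i : ℤ) : ℝ) * ((u i : ℤ) : ℝ) = 1 := fun i => by
      rcases Int.units_eq_one_or (u i) with h | h <;> simp [h]
    simp [dotProduct, this]
  have hcast : (((fun i => (y i : ℤ)) ⬝ᵥ (f.matrix I *ᵥ fun i => (x i : ℤ)) : ℤ) : ℝ) =
      (fun i => ((y i : ℤ) : ℝ)) ⬝ᵥ (S *ᵥ fun i => ((x i : ℤ) : ℝ)) := by
    simp only [S, ← f.map_matrix, dotProduct, mulVec]
    push_cast
    simp
  have hle := dotProduct_mulVec_pow_le_trace (S := S) (signedSum_isSymm (f.edge_isSymm ℝ) I)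
    (hone x) (hone y) (Nat.clog 2 n)
  rw [← hcast, ← f.trace_matrix_pow_cast] at hle
  have hle' : ((fun i => (y i : ℤ)) ⬝ᵥ (f.matrix I *ᵥ fun i => (x i : ℤ))) ^ traceExponent n ≤
      (n : ℤ) ^ traceExponent n * (f.matrix I ^ traceExponent n).trace := by
    exact_mod_cast hle
  have h2 : |(fun i => (y i : ℤ)) ⬝ᵥ (f.matrix I *ᵥ fun i => (x i : ℤ))| ^ traceExponent n ≤
      ((n : ℤ) * normBound I) ^ traceExponent n := by
    rw [mul_pow, traceExponent, pow_mul |_|, sq_abs, ← pow_mul]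
    exact hle'.trans (mul_le_mul_of_nonneg_left
      ((trace_le_traceSum I hf).trans (traceSum_le_normBound_pow I)) (by positivity))
  exact (pow_le_pow_iff_left₀ (abs_nonneg _) (by positivity) (by simp [traceExponent])).1 h2

/-- With `w = c₀ c₁ c₂ x₀ x₁`, the Fourier expansion of the indicator reduces the claim to `(1 - s
x₂)(1 - s w) ≥ 0`. -/
theorem mul_le_of_units (s c₀ c₁ c₂ x₀ x₁ x₂ : ℤˣ) :
    (s * x₂ : ℤ) ≤ 8 * (if c₀ * x₀ = 1 ∧ c₁ * x₁ = 1 ∧ c₂ * x₂ = 1 then 1 else 0)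
      - c₀ * x₀ - c₁ * x₁ - c₂ * x₂ - c₀ * c₁ * x₀ * x₁ - c₀ * c₂ * x₀ * x₂ - c₁ * c₂ * x₁ * x₂
      - s * (c₀ * c₁ * c₂ * x₀ * x₁) := by
  revert s c₀ c₁ c₂ x₀ x₁ x₂
  decide

theorem kSAT_eq (e : Clause 3 n) (x : Fin n → ℤˣ) :
    (kSAT (fun i => e.1 i * x (e.2 i)) : ℤ) = 1 - if e.1 0 * x (e.2 0) = 1 ∧
      e.1 1 * x (e.2 1) = 1 ∧ e.1 2 * x (e.2 2) = 1 then 1 else 0 := by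
  have : ((fun i => e.1 i * x (e.2 i)) = 1) ↔ (e.1 0 * x (e.2 0) = 1 ∧
      e.1 1 * x (e.2 1) = 1 ∧ e.1 2 * x (e.2 2) = 1) := by
    rw [funext_iff, Fin.forall_fin_succ, Fin.forall_fin_succ, Fin.forall_fin_succ]
    simp
  simp only [kSAT, this]
  split_ifs <;> simp

/-- Sum `mul_le_of_units` over the clauses; the constant `7` counts the forms, each contributing at
most `n * normBound I` after doubling. -/
theorem two_mul_sum_third_le (I : SignedHypergraph 3 n) (x : Fin n → ℤˣ) (s : ℤˣ) :
    2 * ∑ e ∈ I, (s * x (e.2 2) : ℤ) ≤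
      16 * (#I - satisfiedCount I x) + 7 * (n * normBound I) := by
  have hpt : ∑ e ∈ I, (s * x (e.2 2) : ℤ) ≤ ∑ e ∈ I,
      (8 * (1 - (kSAT (fun i => e.1 i * x (e.2 i)) : ℤ))
      - e.1 0 * x (e.2 0) - e.1 1 * x (e.2 1) - e.1 2 * x (e.2 2)
      - e.1 0 * e.1 1 * x (e.2 0) * x (e.2 1) - e.1 0 * e.1 2 * x (e.2 0) * x (e.2 2)
      - e.1 1 * e.1 2 * x (e.2 1) * x (e.2 2)
      - s * (e.1 0 * e.1 1 * e.1 2 * x (e.2 0) * x (e.2 1))) := by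
    refine sum_le_sum fun e _ => ?_
    rw [kSAT_eq, sub_sub_cancel]
    exact mul_le_of_units _ _ _ _ _ _ _
  simp only [sum_sub_distrib, ← mul_sum] at hpt
  have hsat : ∑ e ∈ I, (kSAT (fun i => e.1 i * x (e.2 i)) : ℤ) = satisfiedCount I x := by
    simp [satisfiedCount]
  rw [hsat] at hpt
  have key := fun (f : SignForm) (hf : f ∈ signForms) (y : Fin n → ℤˣ) =>
    (abs_le.1 (abs_dotProduct_matrix_mulVec_le I hf x y))
  simp only [SignForm.dotProduct_matrix_mulVec, SignForm.sign] at key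
  -- The linear characters are tested against the all-ones vector, the quadratic ones against `x`
  -- twice, and the parity form against `s * x` and `x`.
  have k0 := (key ⟨[0], 0, 0⟩ (by simp [signForms]) 1).1
  have k1 := (key ⟨[1], 1, 1⟩ (by simp [signForms]) 1).1
  have k2 := (key ⟨[2], 2, 2⟩ (by simp [signForms]) 1).1
  have k3 := (key ⟨[0, 1], 0, 1⟩ (by simp [signForms]) x).1
  have k4 := (key ⟨[0, 2], 0, 2⟩ (by simp [signForms]) x).1
  have k5 := (key ⟨[1, 2], 1, 2⟩ (by simp [signForms]) x).1
  have k6 := (key ⟨[0, 1, 2], 0, 1⟩ (by simp [signForms]) (fun i => s * x i)).1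
  simp only [List.map_cons, List.map_nil, List.prod_cons, List.prod_nil, Pi.one_apply,
    Units.val_one, Units.val_mul, mul_one, one_mul] at k0 k1 k2 k3 k4 k5 k6
  have e1 : ∀ a : Fin 3, ∑ e ∈ I, ((e.1 a : ℤ) * (x (e.2 a) + x (e.2 a))) =
      2 * ∑ e ∈ I, (e.1 a * x (e.2 a) : ℤ) := fun a => by
    rw [mul_sum]; exact sum_congr rfl fun e _ => by ring
  have e2 : ∀ a b : Fin 3, ∑ e ∈ I, ((e.1 a : ℤ) * e.1 b * (x (e.2 a) * x (e.2 b) +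
      x (e.2 b) * x (e.2 a))) = 2 * ∑ e ∈ I, (e.1 a * e.1 b * x (e.2 a) * x (e.2 b) : ℤ) :=
    fun a b => by rw [mul_sum]; exact sum_congr rfl fun e _ => by ring
  have e3 : ∑ e ∈ I, ((e.1 0 : ℤ) * (e.1 1 * e.1 2) * (s * x (e.2 0) * x (e.2 1) +
      s * x (e.2 1) * x (e.2 0))) =
      2 * (s * ∑ e ∈ I, (e.1 0 * e.1 1 * e.1 2 * x (e.2 0) * x (e.2 1) : ℤ)) := by
    rw [mul_sum, mul_sum]; exact sum_congr rfl fun e _ => by ring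
  rw [e1] at k0 k1 k2
  rw [e2] at k3 k4 k5
  rw [e3] at k6
  rw [sum_const, nsmul_eq_mul, mul_one] at hpt
  rw [← mul_sum]
  linarith

theorem sum_comp_eq_sum_degree (I : SignedHypergraph 3 n) (a : Fin 3) (g : Fin n → ℤ) :
    ∑ e ∈ I, g (e.2 a) = ∑ i, degree I a i * g i := by
  rw [← sum_fiberwise_of_maps_to (t := univ) (g := fun e : Clause 3 n => e.2 a) (by simp)]
  refine sum_congr rfl fun i _ => ?_
  rw [sum_congr rfl (g := fun _ => g i) (fun e he => by rw [(mem_filter.1 he).2])]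
  simp [degree]

/-- Group the third vertices by value and replace each degree by its mean; the error is
`degreeDeviation I`. Taking `s` to be either sign yields the absolute value. -/
theorem card_mul_abs_sum_le (I : SignedHypergraph 3 n) (x : Fin n → ℤˣ) :
    2 * #I * |∑ i, (x i : ℤ)| ≤ 2 * degreeDeviation I +
      n * (16 * (#I - satisfiedCount I x) + 7 * (n * normBound I)) := by
  have main : ∀ s : ℤˣ, 2 * #I * ((s : ℤ) * ∑ i, (x i : ℤ)) ≤ 2 * degreeDeviation I +
      n * (16 * (#I - satisfiedCount I x) + 7 * (n * normBound I)) := by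
    intro s
    have h1 := mul_le_mul_of_nonneg_left (two_mul_sum_third_le I x s) (Int.natCast_nonneg n)
    rw [sum_comp_eq_sum_degree I 2 (fun i => (s * x i : ℤ))] at h1
    have h2 : #I * ((s : ℤ) * ∑ i, (x i : ℤ)) - n * ∑ i, (degree I 2 i : ℤ) * (s * x i) ≤
        degreeDeviation I := by
      rw [degreeDeviation, mul_sum, mul_sum, mul_sum, ← sum_sub_distrib]
      refine sum_le_sum fun i _ => ?_
      have : (s * x i : ℤ) = 1 ∨ (s * x i : ℤ) = -1 := by
        rcases Int.units_eq_one_or (s * x i) with h | h <;> rw [← Units.val_mul, h] <;> simp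
      rcases this with h | h
      · rw [h, mul_one, mul_one, abs_sub_comm]; exact le_abs_self _
      · rw [h]; refine le_trans (le_of_eq ?_) (le_abs_self _); ring
    linarith
  rcases abs_cases (∑ i, (x i : ℤ)) with h | h
  · rw [h.1]; simpa using main 1
  · rw [h.1]; simpa using main (-1)

theorem not_exists_isBiased_and_isSatisfying (I : SignedHypergraph 3 n) (ρ : ℝ)
    (hρ : (biasBound ⟨n, I⟩ : ℝ) ≤ ρ) :
    ¬ ∃ x : Fin n → ℤˣ, IsBiased ρ x ∧ IsSatisfying I (ρ / 32) x := by
  rintro ⟨x, hb, hs⟩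
  have hb' : ρ ≤ (1 / (n : ℝ)) * |((∑ i, (x i : ℤ) : ℤ) : ℝ)| := by
    simpa [IsBiased] using hb
  by_cases h0 : #I * n = 0
  · rw [biasBound, if_pos h0] at hρ
    have habs : |((∑ i, (x i : ℤ) : ℤ) : ℝ)| ≤ n := by
      have : |∑ i, (x i : ℤ)| ≤ n := by
        refine (abs_sum_le_sum_abs _ _).trans_eq ?_
        have : ∀ i, |(x i : ℤ)| = 1 := fun i => by
          rcases Int.units_eq_one_or (x i) with h | h <;> simp [h]
        simp [this]
      exact_mod_cast this
    have : (1 / (n : ℝ)) * |((∑ i, (x i : ℤ) : ℤ) : ℝ)| ≤ 1 := by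
      rw [one_div, inv_mul_eq_div]
      exact div_le_one_of_le₀ habs (Nat.cast_nonneg n)
    norm_num at hρ
    linarith
  · rw [biasBound, if_neg h0] at hρ
    have hpos : (0 : ℝ) < #I * n := by exact_mod_cast Nat.pos_of_ne_zero h0
    have hn : (0 : ℝ) < n := by
      rcases Nat.eq_zero_or_pos n with h | h
      · simp [h] at h0
      · exact_mod_cast h
    have h1 : (2 * degreeDeviation I + 7 * n ^ 2 * normBound I + 1 : ℝ) ≤ ρ * (#I * n) := by
      rw [← div_le_iff₀ hpos]
      refine le_trans (le_of_eq ?_) hρ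
      push_cast; rfl
    have h2 : (2 * #I * |((∑ i, (x i : ℤ) : ℤ) : ℝ)| : ℝ) ≤ 2 * degreeDeviation I +
      n * (16 * (#I - satisfiedCount I x) + 7 * (n * normBound I)) := by
      exact_mod_cast card_mul_abs_sum_le I x
    have h3 : ρ * n ≤ |((∑ i, (x i : ℤ) : ℤ) : ℝ)| := by
      rw [one_div, inv_mul_eq_div, le_div_iff₀ hn] at hb'
      exact hb'
    have h4 : (#I : ℝ) - satisfiedCount I x ≤ ρ / 32 * #I := by
      have : (1 - ρ / 32) * (#I : ℝ) ≤ satisfiedCount I x := hs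
      linarith
    have h5 := mul_le_mul_of_nonneg_left h3 (show (0 : ℝ) ≤ 2 * #I by positivity)
    have h6 := mul_le_mul_of_nonneg_left h4 hn.le
    have hD : (0 : ℝ) ≤ degreeDeviation I := by
      exact_mod_cast sum_nonneg fun i _ => abs_nonneg _
    have hB : (0 : ℝ) ≤ 7 * n ^ 2 * normBound I := by positivity
    -- With at most `ρ / 32 * #I` violated clauses, the term with factor `16` is at most half of `ρ
    -- * #I * n`. Then `3/2 * ρ * #I * n` is at most `2 * degreeDeviation I + 7 * n ^ 2 * normBound
    -- I`, contradicting `h1`; the `+ 1` there supplies positivity.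
    nlinarith

end Certificate

/-! ### Degrees and trace moments of the random instance. -/

section RandomInstance

open Finset Matrix

variable {n : ℕ}

/-- The clause with the sign at position `h` reversed. -/
def flipSign (h : Fin 3) (e : Clause 3 n) : Clause 3 n := (Function.update e.1 h (-e.1 h), e.2)

theorem flipSign_involutive (h : Fin 3) : Function.Involutive (flipSign (n := n) h) := fun e => by
  simp [flipSign]

/-- Any position occurring once in `f.signs` will do. This provides the sign-reversing involution
for the exchange argument. -/
theorem SignForm.exists_sign_flipSign {f : SignForm} (hf : f ∈ signForms) :
    ∃ h : Fin 3, ∀ e : Clause 3 n, f.sign (flipSign h e) = -f.sign e := by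
  simp only [signForms, List.mem_cons, List.not_mem_nil, or_false] at hf
  rcases hf with rfl | rfl | rfl | rfl | rfl | rfl | rfl
  · exact ⟨0, fun e => by simp [SignForm.sign, flipSign]⟩
  · exact ⟨1, fun e => by simp [SignForm.sign, flipSign]⟩
  · exact ⟨2, fun e => by simp [SignForm.sign, flipSign]⟩
  · exact ⟨0, fun e => by simp [SignForm.sign, flipSign]⟩
  · exact ⟨0, fun e => by simp [SignForm.sign, flipSign]⟩
  · exact ⟨1, fun e => by simp [SignForm.sign, flipSign]⟩
  · exact ⟨0, fun e => by simp [SignForm.sign, flipSign]⟩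

theorem SignForm.sign_sq (f : SignForm) (e : Clause 3 n) : f.sign e ^ 2 = 1 := by
  rw [SignForm.sign]
  induction f.signs with
  | nil => simp
  | cons i l ih =>
    rw [List.map_cons, List.prod_cons, mul_pow, ih, mul_one, ← Units.val_pow_eq_pow_val,
      Int.units_sq, Units.val_one]

/-- Degrees ignore signs, so restricting to an event about degrees keeps the exchange symmetry. -/
theorem degree_swapImage_flipSign (h a : Fin 3) (i : Fin n) (e : Clause 3 n)
    (I : SignedHypergraph 3 n) : degree (swapImage e (flipSign h e) I) a i = degree I a i := by
  rw [degree, degree, swapImage, filter_map, card_map]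
  congr 1
  refine filter_congr fun g _ => ?_
  have : (Equiv.swap e (flipSign h e) g).2 = g.2 := by
    rw [Equiv.swap_apply_def]
    split_ifs with h1 h2
    · rw [h1]; rfl
    · rw [h2]; rfl
    · rfl
  simp [this]

/-- The square of an edge matrix is diagonal: the sum of two diagonal units when the vertices
differ, four times one unit when they coincide. The factor `2` is attained in the second case. -/
theorem SignForm.trace_edge_mul_edge_mul_le (f : SignForm) (e : Clause 3 n)
    {Y : Matrix (Fin n) (Fin n) ℝ} (hY : ∀ i, 0 ≤ Y i i) :
    (f.edge ℝ e * f.edge ℝ e * Y).trace ≤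
      2 * (Y (e.2 f.fst) (e.2 f.fst) + Y (e.2 f.snd) (e.2 f.snd)) := by
  have h1 := hY (e.2 f.fst)
  have h2 := hY (e.2 f.snd)
  by_cases h : e.2 f.fst = e.2 f.snd
  · refine le_of_eq ?_
    simp only [SignForm.edge, h, add_mul, mul_add, single_mul_single_same, trace_add,
      trace_single_mul, smul_eq_mul]
    ring
  · have hne : ∀ {u v : Fin n}, v ≠ u → single u v (1 : ℝ) * single u v 1 = 0 :=
      fun {u v} huv => single_mul_single_of_ne _ u v u huv _
    have h12 := hne (Ne.symm h)
    have h21 := hne h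
    simp only [SignForm.edge, add_mul, mul_add, single_mul_single_same, trace_add,
      trace_single_mul, smul_eq_mul, h12, h21, Matrix.zero_mul, trace_zero]
    linarith

theorem sum_comp_eq_sum_degree_real (I : SignedHypergraph 3 n) (a : Fin 3) (g : Fin n → ℝ) :
    ∑ e ∈ I, g (e.2 a) = ∑ i, degree I a i * g i := by
  rw [← sum_fiberwise_of_maps_to (t := univ) (g := fun e : Clause 3 n => e.2 a) (by simp)]
  refine sum_congr rfl fun i _ => ?_
  rw [sum_congr rfl (g := fun _ => g i) (fun e he => by rw [(mem_filter.1 he).2])]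
  simp [degree]

theorem SignForm.sum_trace_edge_mul_edge_mul_le (f : SignForm) {I : SignedHypergraph 3 n} {d : ℝ}
    (hd : ∀ a i, (degree I a i : ℝ) ≤ d) {Y : Matrix (Fin n) (Fin n) ℝ} (hY : ∀ i, 0 ≤ Y i i) :
    ∑ e ∈ I, (f.edge ℝ e * f.edge ℝ e * Y).trace ≤ 4 * d * Y.trace := by
  have hdeg : ∀ a, ∑ e ∈ I, Y (e.2 a) (e.2 a) ≤ d * Y.trace := fun a => by
    rw [sum_comp_eq_sum_degree_real I a fun i => Y i i, trace, mul_sum]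
    exact sum_le_sum fun i _ => mul_le_mul_of_nonneg_right (hd a i) (hY i)
  refine (sum_le_sum fun e _ => f.trace_edge_mul_edge_mul_le e hY).trans ?_
  rw [← mul_sum, sum_add_distrib]
  linarith [hdeg f.fst, hdeg f.snd]

theorem card_filter_eq (a : Fin 3) (i : Fin n) :
    #{e : Clause 3 n | e.2 a = i} = 8 * n ^ 2 := by
  have h : ({e : Clause 3 n | e.2 a = i} : Finset (Clause 3 n)) =
      univ ×ˢ Fintype.piFinset (fun j => if j = a then {i} else univ) := by
    ext e
    simp only [mem_filter, mem_univ, true_and, mem_product, Fintype.mem_piFinset]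
    constructor
    · intro he j
      split_ifs with hj
      · subst hj; simpa using he
      · simp
    · intro he
      simpa using he a
  rw [h, card_product, Fintype.card_piFinset]
  have h2 : ∏ j : Fin 3, #(if j = a then ({i} : Finset (Fin n)) else univ) = n ^ 2 := by
    fin_cases a <;> simp [Fin.prod_univ_three, sq]
  rw [h2]
  simp [Fintype.card_units_int]

/-- All degrees are within three standard deviations (up to a logarithm) of `d`. -/
def DegreesNear (d : ℝ) (I : SignedHypergraph 3 n) : Prop :=
  ∀ a i, |(degree I a i : ℝ) - d| ≤ 3 * √(d * Real.log n)

theorem degreesNear_swapImage_flipSign (h : Fin 3) (d : ℝ) (e : Clause 3 n)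
    (I : SignedHypergraph 3 n) :
    DegreesNear d (swapImage e (flipSign h e) I) ↔ DegreesNear d I := by
  simp only [DegreesNear, degree_swapImage_flipSign]

theorem bernoulliProb_degree_le {p d : ℝ} (h0 : 0 ≤ p) (h1 : p ≤ 1) (hp : p * (8 * n ^ 2) = d)
    (hd0 : 0 < d) (hn : 1 ≤ n) (hd : Real.log n ≤ d) (a : Fin 3) (i : Fin n) (s : ℝ)
    (hs : |s| = 1) :
    bernoulliProb p (fun I : SignedHypergraph 3 n =>
      s * d + 3 * √(d * Real.log n) ≤ s * degree I a i) ≤ 1 / (n : ℝ) ^ 2 := by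
  have hlog : 0 ≤ Real.log n := Real.log_nonneg (by exact_mod_cast hn)
  -- With this parameter the second-order term `c ^ 2 * d` equals `log n` and the deviation
  -- contributes `-3 log n`, which leaves the exponent `-2 log n`.
  set c := √(Real.log n / d) with hc
  have hc0 : 0 ≤ c := Real.sqrt_nonneg _
  have hc1 : c ≤ 1 := Real.sqrt_le_one.2 (div_le_one_of_le₀ hd hd0.le)
  have hc2 : c ^ 2 * d = Real.log n := by
    rw [hc, Real.sq_sqrt (div_nonneg hlog hd0.le), div_mul_cancel₀ _ hd0.ne']
  have hcs : c * √(d * Real.log n) = Real.log n := by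
    rw [hc, ← Real.sqrt_mul (div_nonneg hlog hd0.le),
      show Real.log n / d * (d * Real.log n) = Real.log n * Real.log n by field_simp,
      Real.sqrt_mul_self hlog]
  have hs2 : s ^ 2 = 1 := by rw [← sq_abs, hs, one_pow]
  have hb := bernoulliProb_le_exp (α := Clause 3 n) h0 h1 (fun e => if e.2 a = i then s else 0) c
    (s * d + 3 * √(d * Real.log n)) (fun e => by
      split_ifs
      · rw [abs_mul, hs, mul_one, abs_of_nonneg hc0]; exact hc1
      · simp) hc0
  have hsum : ∀ I : SignedHypergraph 3 n, ∑ e ∈ I, (if e.2 a = i then s else 0) =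
      s * degree I a i := fun I => by
    rw [← sum_filter, sum_const, nsmul_eq_mul, degree, mul_comm]
  have hexp : p * ∑ e : Clause 3 n, (c * (if e.2 a = i then s else 0) +
      (c * (if e.2 a = i then s else 0)) ^ 2) = c * s * d + Real.log n := by
    have : ∀ e : Clause 3 n, c * (if e.2 a = i then s else 0) +
        (c * (if e.2 a = i then s else 0)) ^ 2 = if e.2 a = i then c * s + c ^ 2 else 0 := by
      intro e
      split_ifs
      · rw [mul_pow, hs2, mul_one]
      · simp
    rw [sum_congr rfl fun e _ => this e, ← sum_filter, sum_const, card_filter_eq, nsmul_eq_mul,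
      ← hc2, ← hp]
    push_cast; ring
  simp only [hsum] at hb
  rw [hexp] at hb
  refine hb.trans_eq ?_
  have : c * s * d + Real.log n - c * (s * d + 3 * √(d * Real.log n)) = -(Real.log n * 2) := by
    linear_combination -3 * hcs
  rw [this, Real.exp_neg, ← Real.rpow_def_of_pos (by exact_mod_cast hn), one_div]
  norm_cast

/-- Union bound over `3n` degrees and two directions, each failing with probability at most `n⁻²`.
-/
theorem bernoulliProb_not_degreesNear_le {p d : ℝ} (h0 : 0 ≤ p) (h1 : p ≤ 1)
    (hp : p * (8 * n ^ 2) = d) (hd0 : 0 < d) (hn : 1 ≤ n) (hd : Real.log n ≤ d) :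
    bernoulliProb p (fun I : SignedHypergraph 3 n => ¬ DegreesNear d I) ≤ 6 / n := by
  have hle : bernoulliProb p (fun I : SignedHypergraph 3 n => ¬ DegreesNear d I) ≤
      bernoulliProb p (fun I => ∃ k : Fin 3 × Fin n,
        (1 * d + 3 * √(d * Real.log n) ≤ 1 * (degree I k.1 k.2 : ℝ)) ∨
        (-1 * d + 3 * √(d * Real.log n) ≤ -1 * (degree I k.1 k.2 : ℝ))) := by
    refine bernoulliProb_mono h0 h1 fun I hI => ?_
    simp only [DegreesNear, not_forall, not_le] at hI
    obtain ⟨a, i, hI⟩ := hI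
    refine ⟨(a, i), ?_⟩
    rcases lt_abs.1 hI with h | h
    · left; simp only; linarith
    · right; simp only; linarith
  refine hle.trans ((bernoulliProb_exists_le h0 h1 _).trans ?_)
  have hk : ∀ k : Fin 3 × Fin n, bernoulliProb p (fun I : SignedHypergraph 3 n =>
      (1 * d + 3 * √(d * Real.log n) ≤ 1 * (degree I k.1 k.2 : ℝ)) ∨
        (-1 * d + 3 * √(d * Real.log n) ≤ -1 * (degree I k.1 k.2 : ℝ))) ≤ 2 / (n : ℝ) ^ 2 := by
    intro k
    refine (bernoulliProb_or_le h0 h1 _ _).trans ?_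
    have e1 := bernoulliProb_degree_le h0 h1 hp hd0 hn hd k.1 k.2 1 (by simp)
    have e2 := bernoulliProb_degree_le h0 h1 hp hd0 hn hd k.1 k.2 (-1) (by simp)
    have e3 : (2 : ℝ) / (n : ℝ) ^ 2 = 1 / (n : ℝ) ^ 2 + 1 / (n : ℝ) ^ 2 := by ring
    rw [e3]
    exact add_le_add e1 e2
  refine (sum_le_sum fun k _ => hk k).trans_eq ?_
  have hn' : (n : ℝ) ≠ 0 := by exact_mod_cast (by omega : n ≠ 0)
  rw [sum_const, card_univ, Fintype.card_prod, Fintype.card_fin, Fintype.card_fin, nsmul_eq_mul]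
  push_cast
  field_simp
  norm_num

open scoped Classical in
theorem SignForm.sum_trace_pow_le {f : SignForm} (hf : f ∈ signForms) {p : ℝ} (h0 : 0 ≤ p)
    (h1 : p ≤ 1) {d D : ℝ} (hD0 : 0 ≤ D)
    (hD : ∀ I : SignedHypergraph 3 n, DegreesNear d I → ∀ a i, (degree I a i : ℝ) ≤ D) (k : ℕ) :
    ∑ I : SignedHypergraph 3 n, bernoulliWeight p I *
      (if DegreesNear d I then ((f.matrix I ^ (2 * k)).trace : ℝ) else 0) ≤
      (8 * k * D) ^ k * n := by
  obtain ⟨h, hh⟩ := f.exists_sign_flipSign (n := n) hf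
  -- The law restricted to the good degree event, not normalized: it remains exchangeable, and all
  -- degrees are bounded on its support.
  set W : SignedHypergraph 3 n → ℝ := fun I =>
    bernoulliWeight p I * (if DegreesNear d I then 1 else 0) with hW
  have hle := sum_mul_trace_pow_le_pow (χ := fun e => (f.sign e : ℝ)) (H := f.edge ℝ)
    (τ := flipSign h) (W := W) (d := 4 * D)
    (fun e => by rw [hh]; push_cast; rfl)
    (fun e => by exact_mod_cast f.sign_sq e)
    (fun e => rfl) (f.edge_isSymm ℝ) (flipSign_involutive h)
    (fun I => mul_nonneg (bernoulliWeight_nonneg h0 h1 I) (by split_ifs <;> simp))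
    (fun e I => by
      rw [hW]
      simp only [bernoulliWeight_swapImage]
      exact congrArg _ (if_congr (degreesNear_swapImage_flipSign h d e I) rfl rfl))
    (by positivity)
    (fun I hI Y hY => f.sum_trace_edge_mul_edge_mul_le (hD I (by
      by_contra hnot
      exact hI (by simp [hW, hnot]))) hY) k k le_rfl
  have hW1 : ∑ I, W I ≤ 1 := by
    rw [← sum_bernoulliWeight (α := Clause 3 n) p]
    refine sum_le_sum fun I _ => ?_
    have := bernoulliWeight_nonneg h0 h1 I
    simp only [hW]
    split_ifs <;> simp [this]
  calc _ = ∑ I, W I * (signedSum (fun e => (f.sign e : ℝ)) (f.edge ℝ) I ^ (2 * k)).trace := by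
        refine sum_congr rfl fun I _ => ?_
        simp only [hW, ← f.trace_matrix_pow_cast]
        split_ifs <;> simp
    _ ≤ (2 * k * (4 * D)) ^ k * ((∑ I, W I) * Fintype.card (Fin n)) := hle
    _ ≤ (2 * k * (4 * D)) ^ k * (1 * Fintype.card (Fin n)) := by gcongr
    _ = _ := by rw [Fintype.card_fin, one_mul]; ring

open scoped Classical in
theorem sum_traceSum_le {p : ℝ} (h0 : 0 ≤ p)
    (h1 : p ≤ 1) {d D : ℝ} (hD0 : 0 ≤ D)
    (hD : ∀ I : SignedHypergraph 3 n, DegreesNear d I → ∀ a i, (degree I a i : ℝ) ≤ D) :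
    ∑ I : SignedHypergraph 3 n, bernoulliWeight p I *
      (if DegreesNear d I then (traceSum I : ℝ) else 0) ≤
      7 * ((8 * (Nat.clog 2 n + 1 : ℕ) * D) ^ (Nat.clog 2 n + 1) * n) := by
  have key := fun (f : SignForm) (hf : f ∈ signForms) =>
    f.sum_trace_pow_le hf h0 h1 hD0 hD (Nat.clog 2 n + 1)
  have e : ∀ I : SignedHypergraph 3 n, bernoulliWeight p I *
      (if DegreesNear d I then (traceSum I : ℝ) else 0) =
      (signForms.map fun f => bernoulliWeight p I * (if DegreesNear d I then
        ((f.matrix I ^ (2 * (Nat.clog 2 n + 1))).trace : ℝ) else 0)).sum := by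
    intro I
    rw [List.sum_map_mul_left]
    congr 1
    split_ifs
    · rw [traceSum, traceExponent]; push_cast; rw [List.map_map]; rfl
    · simp
  simp only [e]
  simp only [signForms, List.map_cons, List.map_nil, List.sum_cons, List.sum_nil, sum_add_distrib,
    sum_const_zero]
  have k0 := key ⟨[0], 0, 0⟩ (by simp [signForms])
  have k1 := key ⟨[1], 1, 1⟩ (by simp [signForms])
  have k2 := key ⟨[2], 2, 2⟩ (by simp [signForms])
  have k3 := key ⟨[0, 1], 0, 1⟩ (by simp [signForms])
  have k4 := key ⟨[0, 2], 0, 2⟩ (by simp [signForms])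
  have k5 := key ⟨[1, 2], 1, 2⟩ (by simp [signForms])
  have k6 := key ⟨[0, 1, 2], 0, 1⟩ (by simp [signForms])
  linarith

end RandomInstance

/-! ### High-probability upper bound on the output. -/

section TailBound

open Finset

variable {n : ℕ}

theorem normBound_le (I : SignedHypergraph 3 n) {Y : ℝ} (hY : 1 ≤ Y)
    (h : (traceSum I : ℝ) ≤ Y ^ traceExponent n) : (normBound I : ℝ) ≤ 2 * Y := by
  rcases Nat.eq_zero_or_pos (normLog I) with h0 | hpos
  · rw [normBound, h0]; norm_num; linarith
  · have hT : 1 < (traceSum I).toNat := by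
      by_contra hle
      rw [normLog, Nat.clog_of_right_le_one (not_lt.1 hle)] at hpos
      exact lt_irrefl _ hpos
    -- Minimality of the ceiling logarithm: the previous power is below the trace sum, so rounding
    -- up costs at most a factor `2`.
    have hlt := Nat.pow_pred_clog_lt_self (one_lt_two_pow_traceExponent n) hT
    have hTnat : (((traceSum I).toNat : ℕ) : ℝ) = (traceSum I : ℝ) := by
      exact_mod_cast Int.toNat_of_nonneg (traceSum_nonneg I)
    have h1 : ((2 : ℝ) ^ (normLog I - 1)) ^ traceExponent n ≤ Y ^ traceExponent n := by
      refine le_trans ?_ h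
      rw [← hTnat, ← pow_mul, mul_comm, pow_mul]
      exact_mod_cast hlt.le
    have h2 := (pow_le_pow_iff_left₀ (by positivity) (by linarith)
      (by simp [traceExponent])).1 h1
    have h3 : (normBound I : ℝ) = 2 * 2 ^ (normLog I - 1) := by
      rw [normBound, ← pow_succ', Nat.sub_add_cancel hpos]; push_cast; rfl
    rw [h3]; linarith

theorem card_eq_sum_degree (I : SignedHypergraph 3 n) (a : Fin 3) :
    (#I : ℝ) = ∑ i, (degree I a i : ℝ) := by
  simpa using sum_comp_eq_sum_degree_real I a (fun _ => 1)

theorem clog_add_one_le (hn : 1 ≤ Real.log n) : ((Nat.clog 2 n + 1 : ℕ) : ℝ) ≤ 4 * Real.log n := by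
  have h2 := Real.log_two_gt_d9
  rcases Nat.lt_or_ge 1 n with h | h
  · have hlt := Nat.pow_pred_clog_lt_self (b := 2) (by norm_num) h
    have hpos := Nat.clog_pos (b := 2) (by norm_num) h
    have h1 : ((2 : ℝ) ^ (Nat.clog 2 n - 1)) ≤ n := by exact_mod_cast hlt.le
    have h3 := Real.log_le_log (by positivity) h1
    rw [Real.log_pow, Nat.cast_sub (by omega)] at h3
    push_cast at h3 ⊢
    have h4 : (1 : ℝ) ≤ Nat.clog 2 n := by exact_mod_cast hpos
    nlinarith
  · interval_cases n <;> norm_num at hn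

theorem biasBound_le_of_degreesNear (I : SignedHypergraph 3 n) {d : ℝ} (hn : 1 ≤ Real.log n)
    (hd : 36 * Real.log n ≤ d) (hI : DegreesNear d I)
    (hT : (traceSum I : ℝ) ≤
      7 * (n : ℝ) ^ 2 * (16 * (Nat.clog 2 n + 1 : ℕ) * d) ^ (Nat.clog 2 n + 1)) :
    (biasBound ⟨n, I⟩ : ℝ) ≤ 1258 * √(Real.log n / d) := by
  have hn0 : n ≠ 0 := by rintro rfl; norm_num at hn
  have hn1 : (1 : ℝ) ≤ n := by exact_mod_cast Nat.one_le_iff_ne_zero.2 hn0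
  have hd0 : 0 < d := by linarith
  set L := √(d * Real.log n) with hL
  have hLsq : L ^ 2 = d * Real.log n := Real.sq_sqrt (by positivity)
  have hL1 : 1 ≤ L := by rw [hL]; exact Real.one_le_sqrt.2 (by nlinarith)
  have hLd : 6 * L ≤ d := by
    refine (pow_le_pow_iff_left₀ (by positivity) hd0.le two_ne_zero).1 ?_
    rw [mul_pow, hLsq]; nlinarith
  have hLr : √(Real.log n / d) = L / d := by
    rw [eq_div_iff hd0.ne']
    nth_rewrite 2 [← Real.sqrt_sq hd0.le]
    rw [← Real.sqrt_mul (by positivity), hL]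
    congr 1
    field_simp
  -- the number of clauses
  have hdeg : ∀ a i, |(degree I a i : ℝ) - d| ≤ 3 * L := hI
  have hcard : |(#I : ℝ) - n * d| ≤ n * (3 * L) := by
    have h1 : (#I : ℝ) - n * d = ∑ i, ((degree I 2 i : ℝ) - d) := by
      rw [card_eq_sum_degree I 2, sum_sub_distrib]; simp
    rw [h1]
    refine (abs_sum_le_sum_abs _ _).trans ((sum_le_sum fun i _ => hdeg 2 i).trans_eq ?_)
    simp
  have hcard' : n * d / 2 ≤ (#I : ℝ) := by
    have := (abs_le.1 hcard).1
    nlinarith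
  -- the degree deviation
  have hD : (degreeDeviation I : ℝ) ≤ 6 * n ^ 2 * L := by
    rw [degreeDeviation]
    push_cast
    have : ∀ i ∈ (univ : Finset (Fin n)), |(n : ℝ) * degree I 2 i - #I| ≤ 6 * n * L := by
      intro i _
      have e : (n : ℝ) * degree I 2 i - #I = n * (degree I 2 i - d) - (#I - n * d) := by ring
      rw [e]
      refine (abs_sub _ _).trans ?_
      rw [abs_mul, Nat.abs_cast]
      have := mul_le_mul_of_nonneg_left (hdeg 2 i) (Nat.cast_nonneg (α := ℝ) n)
      linarith
    refine (sum_le_sum this).trans_eq ?_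
    simp; ring
  -- the norm bound
  have hB : (normBound I : ℝ) ≤ 88 * L := by
    set k := Nat.clog 2 n + 1 with hk
    have hk4 : (k : ℝ) ≤ 4 * Real.log n := clog_add_one_le hn
    have hk1 : (1 : ℝ) ≤ k := by rw [hk]; push_cast; linarith [Nat.cast_nonneg (α := ℝ) (Nat.clog 2 n)]
    have hkd : 1 ≤ √((k : ℝ) * d) := Real.one_le_sqrt.2 (by nlinarith)
    have hn2 : (n : ℝ) ≤ 2 ^ k := by
      have h1 := Nat.le_pow_clog (b := 2) (by norm_num) n
      have h2 : n ≤ 2 ^ k := h1.trans (Nat.pow_le_pow_right (by norm_num) (by omega))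
      exact_mod_cast h2
    have h7 : (7 : ℝ) ≤ 7 ^ k := le_self_pow₀ (by norm_num) (by omega)
    -- With `7 ≤ 7 ^ k` and `n ≤ 2 ^ k`, all prefactors fit into the base: `7 * 4 * 16 = 448 ≤ 22 ^
    -- 2`.
    have hY : (traceSum I : ℝ) ≤ (22 * √((k : ℝ) * d)) ^ traceExponent n := by
      refine hT.trans ?_
      have e : (22 * √((k : ℝ) * d)) ^ traceExponent n = (484 * (k * d)) ^ k := by
        rw [traceExponent, ← hk, pow_mul, mul_pow, Real.sq_sqrt (by positivity)]; norm_num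
      rw [e]
      calc 7 * (n : ℝ) ^ 2 * (16 * (k : ℝ) * d) ^ k
          ≤ 7 ^ k * (2 ^ k) ^ 2 * (16 * (k : ℝ) * d) ^ k := by gcongr
        _ = (448 * (k * d)) ^ k := by
            rw [← pow_mul, mul_comm k 2, pow_mul, ← mul_pow, ← mul_pow]; congr 1; ring
        _ ≤ (484 * (k * d)) ^ k := by gcongr; norm_num
    refine (normBound_le I (by linarith) hY).trans ?_
    have hs : √((k : ℝ) * d) ≤ 2 * L := by
      refine Real.sqrt_le_iff.2 ⟨by positivity, ?_⟩
      rw [mul_pow, hLsq]; nlinarith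
    linarith
  have hpos : 0 < n * d / 2 := by positivity
  have hcn : #I * n ≠ 0 := by
    refine mul_ne_zero ?_ hn0
    intro h0
    rw [h0] at hcard'
    push_cast at hcard'
    linarith
  rw [biasBound, if_neg hcn, hLr]
  push_cast
  rw [div_le_iff₀ (by exact_mod_cast Nat.pos_of_ne_zero hcn)]
  -- The numerator is at most `(2 * 6 + 7 * 88 + 1) n ^ 2 L = 629 n ^ 2 L`; the bound `#I ≥ n d / 2`
  -- doubles the constant to `1258`.
  have h1 : 1258 * (L / d) * (n * d / 2 * n) ≤ 1258 * (L / d) * (#I * n) := by gcongr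
  refine le_trans ?_ h1
  have h2 : 1258 * (L / d) * (n * d / 2 * n) = 629 * n ^ 2 * L := by field_simp; norm_num
  rw [h2]
  have h3 : (n : ℝ) ^ 2 * normBound I ≤ n ^ 2 * (88 * L) := by gcongr
  have h4 : (1 : ℝ) ≤ n ^ 2 * L := one_le_mul_of_one_le_of_one_le (one_le_pow₀ hn1) hL1
  linarith

theorem le_bernoulliProb_biasBound_le {p d : ℝ} (h0 : 0 ≤ p) (h1 : p ≤ 1)
    (hp : p * (8 * n ^ 2) = d) (hn : 1 ≤ Real.log n) (hd : 36 * Real.log n ≤ d) :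
    1 - 7 / n ≤ bernoulliProb p (fun I : SignedHypergraph 3 n =>
      (biasBound ⟨n, I⟩ : ℝ) ≤ 1258 * √(Real.log n / d)) := by
  classical
  have hn0 : n ≠ 0 := by rintro rfl; norm_num at hn
  have hn1 : (0 : ℝ) < n := by exact_mod_cast Nat.pos_of_ne_zero hn0
  have hd0 : 0 < d := by linarith
  set k := Nat.clog 2 n + 1 with hk
  -- The threshold is `n` times the moment bound, so Markov's inequality fails with probability at
  -- most `1 / n`.
  set t : ℝ := 7 * (n : ℝ) ^ 2 * (16 * (k : ℕ) * d) ^ k with ht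
  have ht0 : 0 < t := by positivity
  have hdeg : ∀ I : SignedHypergraph 3 n, DegreesNear d I → ∀ a i,
      (degree I a i : ℝ) ≤ 2 * d := by
    intro I hI a i
    have e1 := (abs_le.1 (hI a i)).2
    have e2 : 3 * √(d * Real.log n) ≤ d := by
      have : √(d * Real.log n) ≤ d / 6 := by
        refine Real.sqrt_le_iff.2 ⟨by positivity, ?_⟩
        nlinarith
      linarith
    linarith
  have hM := sum_traceSum_le h0 h1 (D := 2 * d) (by positivity) hdeg
  set F : SignedHypergraph 3 n → ℝ := fun I =>
    if DegreesNear d I then (traceSum I : ℝ) else 0 with hF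
  have hF0 : ∀ I, 0 ≤ F I := fun I => by
    simp only [hF]; split_ifs
    · exact_mod_cast traceSum_nonneg I
    · exact le_rfl
  have hmark := (mul_bernoulliProb_le h0 h1 hF0 t).trans hM
  have hmark' : bernoulliProb p (fun I => t ≤ F I) ≤ 1 / n := by
    rw [← mul_le_mul_iff_right₀ ht0]
    refine hmark.trans_eq ?_
    rw [ht, ← hk]
    have : (8 * (k : ℝ) * (2 * d)) = 16 * k * d := by ring
    rw [this]
    field_simp
  have hnear := bernoulliProb_not_degreesNear_le h0 h1 hp hd0 (Nat.one_le_iff_ne_zero.2 hn0)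
    (by linarith : Real.log n ≤ d)
  have hbad : bernoulliProb p (fun I : SignedHypergraph 3 n =>
      ¬ (biasBound ⟨n, I⟩ : ℝ) ≤ 1258 * √(Real.log n / d)) ≤
      bernoulliProb p (fun I => ¬ DegreesNear d I ∨ t ≤ F I) := by
    refine bernoulliProb_mono h0 h1 fun I hI => ?_
    by_contra hcon
    push Not at hcon
    refine hI (biasBound_le_of_degreesNear I hn hd hcon.1 ?_)
    have := hcon.2
    simp only [hF, if_pos hcon.1] at this
    exact this.le
  have hor := bernoulliProb_or_le h0 h1 (fun I : SignedHypergraph 3 n => ¬ DegreesNear d I)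
    (fun I => t ≤ F I)
  have hc := bernoulliProb_add_compl p (fun I : SignedHypergraph 3 n =>
    (biasBound ⟨n, I⟩ : ℝ) ≤ 1258 * √(Real.log n / d))
  have : (7 : ℝ) / n = 6 / n + 1 / n := by ring
  linarith

theorem tendsto_instanceProb_biasBound_le {δ : ℝ} (hδ0 : 0 < δ) (hδ2 : δ ≤ 2) {ρ : ℕ → ℝ}
    (hρ : Tendsto (fun n : ℕ => ρ n / √(Real.log n / (n : ℝ) ^ δ)) atTop atTop) :
    Tendsto (fun n : ℕ => instanceProb 3 n ((n : ℝ) ^ (1 + δ))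
      (fun I => (biasBound ⟨n, I⟩ : ℝ) ≤ ρ n)) atTop (𝓝 1) := by
  have hp01 : ∀ᶠ n : ℕ in atTop, 0 ≤ (n : ℝ) ^ (1 + δ) / (2 ^ 3 * (n : ℝ) ^ 3) ∧
      (n : ℝ) ^ (1 + δ) / (2 ^ 3 * (n : ℝ) ^ 3) ≤ 1 := by
    filter_upwards [eventually_ge_atTop 1] with n hn
    have hn1 : (1 : ℝ) ≤ n := by exact_mod_cast hn
    refine ⟨by positivity, div_le_one_of_le₀ ?_ (by positivity)⟩
    -- The condition `δ ≤ 2` keeps the inclusion probability at most one.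
    have h1 : (n : ℝ) ^ (1 + δ) ≤ (n : ℝ) ^ (3 : ℝ) :=
      Real.rpow_le_rpow_of_exponent_le hn1 (by linarith)
    have h2 : (n : ℝ) ^ (3 : ℝ) = (n : ℝ) ^ 3 := by norm_cast
    have h3 : (0 : ℝ) ≤ (n : ℝ) ^ 3 := by positivity
    rw [h2] at h1
    linarith
  have hlog : ∀ᶠ n : ℕ in atTop, 36 * Real.log n ≤ (n : ℝ) ^ δ := by
    have h := ((isLittleO_log_rpow_atTop hδ0).comp_tendsto
      (tendsto_natCast_atTop_atTop (R := ℝ))).bound (show (0 : ℝ) < 1 / 36 by norm_num)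
    filter_upwards [h] with n hn
    simp only [Function.comp_apply, Real.norm_eq_abs] at hn
    rw [abs_of_nonneg (Real.rpow_nonneg (Nat.cast_nonneg n) δ)] at hn
    have := le_abs_self (Real.log n)
    linarith
  have hlog1 : ∀ᶠ n : ℕ in atTop, 1 ≤ Real.log n :=
    (Real.tendsto_log_atTop.comp (tendsto_natCast_atTop_atTop (R := ℝ))).eventually_ge_atTop 1
  have hlower : ∀ᶠ n : ℕ in atTop, 1 - 7 / (n : ℝ) ≤ instanceProb 3 n ((n : ℝ) ^ (1 + δ))
      (fun I => (biasBound ⟨n, I⟩ : ℝ) ≤ ρ n) := by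
    filter_upwards [hp01, hlog, hlog1, hρ.eventually_ge_atTop 1258, eventually_ge_atTop 1]
      with n hp h36 h1 hr hn
    have hn0 : (0 : ℝ) < n := by exact_mod_cast hn
    rw [instanceProb_eq_bernoulliProb]
    have hpd : (n : ℝ) ^ (1 + δ) / (2 ^ 3 * (n : ℝ) ^ 3) * (8 * (n : ℝ) ^ 2) = (n : ℝ) ^ δ := by
      rw [Real.rpow_add hn0, Real.rpow_one]; field_simp; norm_num
    refine (le_bernoulliProb_biasBound_le hp.1 hp.2 hpd h1 h36).trans
      (bernoulliProb_mono hp.1 hp.2 fun I hI => hI.trans ?_)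
    have hs : 0 < √(Real.log n / (n : ℝ) ^ δ) := Real.sqrt_pos.2 (by positivity)
    exact (le_div_iff₀ hs).1 hr
  have hlim : Tendsto (fun n : ℕ => 1 - 7 / (n : ℝ)) atTop (𝓝 1) := by
    simpa using (tendsto_const_div_atTop_nhds_zero_nat (7 : ℝ)).const_sub 1
  refine tendsto_of_tendsto_of_tendsto_of_le_of_le' hlim tendsto_const_nhds hlower ?_
  filter_upwards [hp01] with n hp
  rw [instanceProb_eq_bernoulliProb]
  exact bernoulliProb_le_one hp.1 hp.2 _

end TailBound

/-! ### Program logic: step counts, growth of numbers and logarithmic cost. -/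

namespace RAM

/-- `Steps c s k s'`: the program `c`, started in the memory `s`, halts in the memory `s'` after
`k` unit steps. -/
inductive Steps : Prog → State → ℕ → State → Prop
  | skip (s : State) : Steps .skip s 1 s
  | store (s : State) (a : ℕ) (i e : Expr) :
      Steps (.store a i e) s 1 (s.write a (i.val s) (e.val s))
  | seq {c₁ c₂ : Prog} {s s' s'' : State} {t t' : ℕ} :
      Steps c₁ s t s' → Steps c₂ s' t' s'' → Steps (.seq c₁ c₂) s (t + t' + 1) s''
  | branch_pos {e : Expr} {c₁ c₂ : Prog} {s s' : State} {t : ℕ} :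
      0 < e.val s → Steps c₁ s t s' → Steps (.branch e c₁ c₂) s (t + 1) s'
  | branch_neg {e : Expr} {c₁ c₂ : Prog} {s s' : State} {t : ℕ} :
      ¬ 0 < e.val s → Steps c₂ s t s' → Steps (.branch e c₁ c₂) s (t + 1) s'
  | loop_done {e : Expr} {c : Prog} {s : State} :
      ¬ 0 < e.val s → Steps (.loop e c) s 1 s
  | loop_step {e : Expr} {c : Prog} {s s' s'' : State} {t t' : ℕ} :
      0 < e.val s → Steps c s t s' → Steps (.loop e c) s' t' s'' →
        Steps (.loop e c) s (t + t' + 1) s''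

/-! ### Expressions of linear growth -/

def State.BoundedBy (s : State) (B : ℕ) : Prop := ∀ a i, (s a i).natAbs ≤ B

/-- The value of `e` is at most `C` times the largest number in the memory, and the cost of `e` is
at most `C` times the bit length of that number. -/
def Expr.TameWith (C : ℕ) (e : Expr) : Prop :=
  ∀ (s : State) (B : ℕ), 1 ≤ B → s.BoundedBy B →
    (e.val s).natAbs ≤ C * B ∧ e.cost s ≤ C * B.size

def Expr.Tame (e : Expr) : Prop := ∃ C, e.TameWith C

theorem Expr.TameWith.mono {C C' : ℕ} {e : Expr} (h : e.TameWith C) (hC : C ≤ C') :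
    e.TameWith C' := fun s B hB hs =>
  ⟨(h s B hB hs).1.trans (Nat.mul_le_mul_right _ hC),
    (h s B hB hs).2.trans (Nat.mul_le_mul_right _ hC)⟩

theorem size_mul_le (a b : ℕ) : (a * b).size ≤ a.size + b.size := by
  rw [Nat.size_le, pow_add]
  exact Nat.mul_lt_mul'' (Nat.lt_size_self a) (Nat.lt_size_self b)

theorem size_pow_mul_le (C k B : ℕ) : (C ^ k * B).size ≤ k * C.size + B.size := by
  induction k with
  | zero => simp
  | succ k ih =>
    rw [pow_succ', mul_assoc]
    refine (size_mul_le _ _).trans ?_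
    rw [Nat.succ_mul]; omega

theorem size_le_self (a : ℕ) : a.size ≤ a := Nat.size_le.2 Nat.lt_two_pow_self

theorem bitCost_le {z : ℤ} {C B : ℕ} (hB : 1 ≤ B) (h : z.natAbs ≤ C * B) :
    bitCost z ≤ (C.size + 2) * B.size := by
  have h1 : z.natAbs.size ≤ C.size + B.size := (Nat.size_le_size h).trans (size_mul_le _ _)
  have h2 : 1 ≤ B.size := Nat.size_pos.2 hB
  rw [bitCost]
  nlinarith

theorem Expr.tame_const (z : ℤ) : (Expr.const z).Tame := by
  refine ⟨z.natAbs + (z.natAbs.size + 2), fun s B hB _ => ?_⟩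
  have h : z.natAbs ≤ z.natAbs * B := Nat.le_mul_of_pos_right _ hB
  exact ⟨by simp only [Expr.val]; nlinarith,
    (bitCost_le hB h).trans (Nat.mul_le_mul_right _ (by omega))⟩

theorem Expr.Tame.get {i : Expr} (hi : i.Tame) (a : ℕ) : (Expr.get a i).Tame := by
  obtain ⟨C, hC⟩ := hi
  refine ⟨1 + (Nat.size 1 + 2) + C, fun s B hB hs => ?_⟩
  have h := hs a (i.val s)
  have h1 := bitCost_le (C := 1) hB (by simpa using h)
  have h2 := (hC s B hB hs).2
  constructor
  · simp only [Expr.val]; nlinarith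
  · simp only [Expr.cost]; nlinarith

/-- The common part of the closure properties of `Expr.Tame`. -/
theorem Expr.tame_of_bound {e e₁ e₂ : Expr} (h₁ : e₁.Tame) (h₂ : e₂.Tame)
    (hcost : ∀ s, e.cost s = bitCost (e.val s) + e₁.cost s + e₂.cost s)
    (hval : ∀ C₁ C₂ : ℕ, ∃ D : ℕ, ∀ (s : State) (B : ℕ), 1 ≤ B →
      (e₁.val s).natAbs ≤ C₁ * B → (e₂.val s).natAbs ≤ C₂ * B → (e.val s).natAbs ≤ D * B) :
    e.Tame := by
  obtain ⟨C₁, h₁⟩ := h₁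
  obtain ⟨C₂, h₂⟩ := h₂
  obtain ⟨D, hD⟩ := hval C₁ C₂
  refine ⟨D + (D.size + 2) + C₁ + C₂, fun s B hB hs => ?_⟩
  have g₁ := h₁ s B hB hs
  have g₂ := h₂ s B hB hs
  have h := hD s B hB g₁.1 g₂.1
  have hb := bitCost_le hB h
  constructor
  · nlinarith
  · rw [hcost]; nlinarith

theorem Expr.Tame.add {e₁ e₂ : Expr} (h₁ : e₁.Tame) (h₂ : e₂.Tame) : (Expr.add e₁ e₂).Tame :=
  tame_of_bound h₁ h₂ (fun _ => rfl) fun C₁ C₂ => ⟨C₁ + C₂, fun s B _ b₁ b₂ => by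
    rw [add_mul]; exact (Int.natAbs_add_le _ _).trans (add_le_add b₁ b₂)⟩

theorem Expr.Tame.sub {e₁ e₂ : Expr} (h₁ : e₁.Tame) (h₂ : e₂.Tame) : (Expr.sub e₁ e₂).Tame :=
  tame_of_bound h₁ h₂ (fun _ => rfl) fun C₁ C₂ => ⟨C₁ + C₂, fun s B _ b₁ b₂ => by
    rw [add_mul]; exact (Int.natAbs_sub_le _ _).trans (add_le_add b₁ b₂)⟩

theorem Expr.Tame.div {e₁ e₂ : Expr} (h₁ : e₁.Tame) (h₂ : e₂.Tame) : (Expr.div e₁ e₂).Tame :=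
  tame_of_bound h₁ h₂ (fun _ => rfl) fun C₁ _ => ⟨C₁, fun s B _ b₁ _ => by
    have := Int.abs_ediv_le_abs (e₁.val s) (e₂.val s)
    rw [Int.abs_eq_natAbs, Int.abs_eq_natAbs] at this
    simp only [Expr.val]; omega⟩

/-- This product of two unbounded values still grows linearly, since it differs from the dividend by
a remainder smaller than the divisor. It makes remainders available. -/
theorem Expr.Tame.div_mul {e₁ e₂ : Expr} (h₁ : e₁.Tame) (h₂ : e₂.Tame) :
    (Expr.mul (Expr.div e₁ e₂) e₂).Tame := by
  obtain ⟨C₁, g₁⟩ := h₁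
  obtain ⟨C₂, g₂⟩ := h₂
  obtain ⟨C₃, g₃⟩ := Expr.Tame.div ⟨C₁, g₁⟩ ⟨C₂, g₂⟩
  refine ⟨C₁ + C₂ + ((C₁ + C₂).size + 2) + C₃ + C₂, fun s B hB hs => ?_⟩
  have hv : ((e₁.val s / e₂.val s) * e₂.val s).natAbs ≤ (C₁ + C₂) * B := by
    have h1 := (g₁ s B hB hs).1
    have h2 := (g₂ s B hB hs).1
    rw [add_mul]
    by_cases h0 : e₂.val s = 0
    · simp [h0]
    · have h3 := Int.emod_add_mul_ediv (e₁.val s) (e₂.val s)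
      have h4 := Int.emod_nonneg (e₁.val s) h0
      have h5 := Int.emod_lt_abs (e₁.val s) h0
      rw [Int.abs_eq_natAbs] at h5
      rw [mul_comm]
      generalize e₂.val s * (e₁.val s / e₂.val s) = q at *
      omega
  have hb := bitCost_le hB hv
  have h3 := (g₃ s B hB hs).2
  have h2 := (g₂ s B hB hs).2
  constructor
  · simp only [Expr.val]; nlinarith
  · change bitCost (e₁.val s / e₂.val s * e₂.val s) + _ + _ ≤ _
    nlinarith

theorem Expr.Tame.mul_of_bound {e₁ e₂ : Expr} (h₁ : e₁.Tame) (h₂ : e₂.Tame) (D : ℕ)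
    (hD : ∀ s, (e₁.val s).natAbs ≤ D) : (Expr.mul e₁ e₂).Tame :=
  tame_of_bound h₁ h₂ (fun _ => rfl) fun C₁ C₂ => ⟨D * C₂, fun s B _ _ b₂ => by
    rw [mul_assoc, Expr.val, Int.natAbs_mul]
    exact Nat.mul_le_mul (hD s) b₂⟩

/-- The remainder of a division. -/
def Expr.mod (e₁ e₂ : Expr) : Expr := .sub e₁ (.mul (.div e₁ e₂) e₂)

theorem Expr.val_mod (s : State) (e₁ e₂ : Expr) : (e₁.mod e₂).val s = e₁.val s % e₂.val s := by
  simp only [Expr.mod, Expr.val]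
  rw [Int.emod_def, mul_comm]

theorem Expr.Tame.mod {e₁ e₂ : Expr} (h₁ : e₁.Tame) (h₂ : e₂.Tame) : (e₁.mod e₂).Tame :=
  h₁.sub (h₁.div_mul h₂)

/-- The scalar variable stored in cell `0` of array `a`. -/
def Expr.var (a : ℕ) : Expr := .get a (.const 0)

theorem Expr.tame_var (a : ℕ) : (Expr.var a).Tame := (tame_const 0).get a

/-! ### Programs of linear growth -/

def Prog.TameWith (C : ℕ) : Prog → Prop
  | .skip => True
  | .store _ i e => i.TameWith C ∧ e.TameWith C
  | .seq c₁ c₂ => c₁.TameWith C ∧ c₂.TameWith C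
  | .branch e c₁ c₂ => e.TameWith C ∧ c₁.TameWith C ∧ c₂.TameWith C
  | .loop e c => e.TameWith C ∧ c.TameWith C

def Prog.Tame : Prog → Prop
  | .skip => True
  | .store _ i e => i.Tame ∧ e.Tame
  | .seq c₁ c₂ => c₁.Tame ∧ c₂.Tame
  | .branch e c₁ c₂ => e.Tame ∧ c₁.Tame ∧ c₂.Tame
  | .loop e c => e.Tame ∧ c.Tame

theorem Prog.TameWith.mono {C C' : ℕ} (hC : C ≤ C') : ∀ {c : Prog}, c.TameWith C → c.TameWith C'
  | .skip, _ => trivial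
  | .store _ _ _, h => ⟨h.1.mono hC, h.2.mono hC⟩
  | .seq _ _, h => ⟨TameWith.mono hC h.1, TameWith.mono hC h.2⟩
  | .branch _ _ _, h => ⟨h.1.mono hC, TameWith.mono hC h.2.1, TameWith.mono hC h.2.2⟩
  | .loop _ _, h => ⟨h.1.mono hC, TameWith.mono hC h.2⟩

theorem Prog.Tame.exists_tameWith {c : Prog} (h : c.Tame) : ∃ C, 1 ≤ C ∧ c.TameWith C := by
  induction c with
  | skip => exact ⟨1, le_rfl, trivial⟩
  | store a i e =>
    obtain ⟨⟨C₁, h₁⟩, ⟨C₂, h₂⟩⟩ := h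
    exact ⟨C₁ + C₂ + 1, by omega, h₁.mono (by omega), h₂.mono (by omega)⟩
  | seq c₁ c₂ ih₁ ih₂ =>
    obtain ⟨C₁, p₁, h₁⟩ := ih₁ h.1
    obtain ⟨C₂, p₂, h₂⟩ := ih₂ h.2
    exact ⟨C₁ + C₂, by omega, h₁.mono (by omega), h₂.mono (by omega)⟩
  | branch e c₁ c₂ ih₁ ih₂ =>
    obtain ⟨C₀, h₀⟩ := h.1
    obtain ⟨C₁, p₁, h₁⟩ := ih₁ h.2.1
    obtain ⟨C₂, p₂, h₂⟩ := ih₂ h.2.2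
    exact ⟨C₀ + C₁ + C₂, by omega, h₀.mono (by omega), h₁.mono (by omega), h₂.mono (by omega)⟩
  | loop e c ih =>
    obtain ⟨C₀, h₀⟩ := h.1
    obtain ⟨C₁, p₁, h₁⟩ := ih h.2
    exact ⟨C₀ + C₁, by omega, h₀.mono (by omega), h₁.mono (by omega)⟩

theorem State.BoundedBy.mono {s : State} {B B' : ℕ} (h : s.BoundedBy B) (hB : B ≤ B') :
    s.BoundedBy B' := fun a i => (h a i).trans hB

theorem State.BoundedBy.write {s : State} {B : ℕ} (h : s.BoundedBy B) (a : ℕ) (i : ℤ) {z : ℤ}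
    (hz : z.natAbs ≤ B) : (s.write a i z).BoundedBy B := by
  intro b j
  rw [State.write]
  by_cases hb : b = a
  · subst hb
    rw [Function.update_self]
    by_cases hj : j = i
    · subst hj; rwa [Function.update_self]
    · rw [Function.update_of_ne hj]; exact h b j
  · rw [Function.update_of_ne hb]; exact h b j

/-- In a program of linear growth, bit lengths grow by a constant per step, so the logarithmic cost
is bounded in terms of the number of steps. -/
theorem Steps.exists_exec {C : ℕ} (hC : 1 ≤ C) {c : Prog} {s s' : State} {k : ℕ}
    (h : Steps c s k s') (hc : c.TameWith C) (B : ℕ) (hB : 1 ≤ B) (hs : s.BoundedBy B) :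
    s'.BoundedBy (C ^ k * B) ∧ ∃ t ≤ k * (3 * C * (C ^ k * B).size), Exec c s t s' := by
  have hpow : ∀ {k l B : ℕ}, k ≤ l → C ^ k * B ≤ C ^ l * B := fun h =>
    Nat.mul_le_mul_right _ (Nat.pow_le_pow_right hC h)
  have hself : ∀ {l B : ℕ}, B ≤ C ^ l * B := fun {l B} =>
    Nat.le_mul_of_pos_left _ (Nat.pow_pos hC)
  have hsz : ∀ {a b : ℕ}, a ≤ b → a.size ≤ b.size := fun h => Nat.size_le_size h
  induction h generalizing B with
  | skip s =>
    refine ⟨hs.mono hself, 1, ?_, .skip s⟩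
    have : 1 ≤ (C ^ 1 * B).size := Nat.size_pos.2 (hB.trans hself)
    nlinarith
  | store s a i e =>
    have g₁ := hc.1 s B hB hs
    have g₂ := hc.2 s B hB hs
    refine ⟨(hs.mono hself).write _ _ (by simpa using g₂.1), _, ?_, .store s a i e⟩
    have h1 : B.size ≤ (C ^ 1 * B).size := hsz hself
    have h2 : 1 ≤ (C ^ 1 * B).size := Nat.size_pos.2 (hB.trans hself)
    nlinarith [g₁.2, g₂.2, Nat.mul_le_mul_left C h1]
  | @seq c₁ c₂ s s₁ s₂ t t' _ _ ih₁ ih₂ =>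
    obtain ⟨b₁, u₁, hu₁, x₁⟩ := ih₁ hc.1 B hB hs
    obtain ⟨b₂, u₂, hu₂, x₂⟩ := ih₂ hc.2 _ (hB.trans hself) b₁
    rw [← mul_assoc (C ^ t'), ← pow_add] at b₂ hu₂
    refine ⟨b₂.mono (hpow (by omega)), _, ?_, .seq x₁ x₂⟩
    have h1 : (C ^ t * B).size ≤ (C ^ (t + t' + 1) * B).size := hsz (hpow (by omega))
    have h2 : (C ^ (t' + t) * B).size ≤ (C ^ (t + t' + 1) * B).size := hsz (hpow (by omega))
    have h3 : 1 ≤ (C ^ (t + t' + 1) * B).size := Nat.size_pos.2 (hB.trans hself)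
    have h4 : 1 ≤ 3 * C * (C ^ (t + t' + 1) * B).size := Nat.mul_pos (by omega) h3
    have h5 := hu₁.trans (Nat.mul_le_mul_left t (Nat.mul_le_mul_left (3 * C) h1))
    have h6 := hu₂.trans (Nat.mul_le_mul_left t' (Nat.mul_le_mul_left (3 * C) h2))
    rw [add_mul, add_mul, one_mul]
    omega
  | @branch_pos e c₁ c₂ s s₁ t he _ ih =>
    obtain ⟨b₁, u₁, hu₁, x₁⟩ := ih hc.2.1 B hB hs
    refine ⟨b₁.mono (hpow (by omega)), _, ?_, .branch_pos he x₁⟩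
    have h0 := (hc.1 s B hB hs).2
    have h1 : (C ^ t * B).size ≤ (C ^ (t + 1) * B).size := hsz (hpow (by omega))
    have h2 : B.size ≤ (C ^ (t + 1) * B).size := hsz hself
    have h3 : 1 ≤ (C ^ (t + 1) * B).size := Nat.size_pos.2 (hB.trans hself)
    have h4 := h0.trans (Nat.mul_le_mul_left C h2)
    have h5 := hu₁.trans (Nat.mul_le_mul_left t (Nat.mul_le_mul_left (3 * C) h1))
    have h6 : 1 ≤ C * (C ^ (t + 1) * B).size := Nat.mul_pos hC h3
    rw [add_mul, one_mul, mul_assoc 3]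
    rw [mul_assoc 3] at h5
    omega
  | @branch_neg e c₁ c₂ s s₁ t he _ ih =>
    obtain ⟨b₁, u₁, hu₁, x₁⟩ := ih hc.2.2 B hB hs
    refine ⟨b₁.mono (hpow (by omega)), _, ?_, .branch_neg he x₁⟩
    have h0 := (hc.1 s B hB hs).2
    have h1 : (C ^ t * B).size ≤ (C ^ (t + 1) * B).size := hsz (hpow (by omega))
    have h2 : B.size ≤ (C ^ (t + 1) * B).size := hsz hself
    have h3 : 1 ≤ (C ^ (t + 1) * B).size := Nat.size_pos.2 (hB.trans hself)
    have h4 := h0.trans (Nat.mul_le_mul_left C h2)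
    have h5 := hu₁.trans (Nat.mul_le_mul_left t (Nat.mul_le_mul_left (3 * C) h1))
    have h6 : 1 ≤ C * (C ^ (t + 1) * B).size := Nat.mul_pos hC h3
    rw [add_mul, one_mul, mul_assoc 3]
    rw [mul_assoc 3] at h5
    omega
  | @loop_done e c s he =>
    refine ⟨hs.mono hself, _, ?_, .loop_done he⟩
    have h0 := (hc.1 s B hB hs).2
    have h1 : B.size ≤ (C ^ 1 * B).size := hsz hself
    have h2 : 1 ≤ (C ^ 1 * B).size := Nat.size_pos.2 (hB.trans hself)
    nlinarith [Nat.mul_le_mul_left C h1]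
  | @loop_step e c s s₁ s₂ t t' he _ _ ih₁ ih₂ =>
    obtain ⟨b₁, u₁, hu₁, x₁⟩ := ih₁ hc.2 B hB hs
    obtain ⟨b₂, u₂, hu₂, x₂⟩ := ih₂ hc _ (hB.trans hself) b₁
    rw [← mul_assoc (C ^ t'), ← pow_add] at b₂ hu₂
    refine ⟨b₂.mono (hpow (by omega)), _, ?_, .loop_step he x₁ x₂⟩
    have h0 := (hc.1 s B hB hs).2
    have h1 : (C ^ t * B).size ≤ (C ^ (t + t' + 1) * B).size := hsz (hpow (by omega))
    have h2 : (C ^ (t' + t) * B).size ≤ (C ^ (t + t' + 1) * B).size := hsz (hpow (by omega))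
    have h3 : 1 ≤ (C ^ (t + t' + 1) * B).size := Nat.size_pos.2 (hB.trans hself)
    have h7 : B.size ≤ (C ^ (t + t' + 1) * B).size := hsz hself
    have h4 := h0.trans (Nat.mul_le_mul_left C h7)
    have h5 := hu₁.trans (Nat.mul_le_mul_left t (Nat.mul_le_mul_left (3 * C) h1))
    have h6 := hu₂.trans (Nat.mul_le_mul_left t' (Nat.mul_le_mul_left (3 * C) h2))
    have h8 : 1 ≤ C * (C ^ (t + t' + 1) * B).size := Nat.mul_pos hC h3
    rw [add_mul, add_mul, one_mul, mul_assoc 3]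
    rw [mul_assoc 3] at h5 h6
    omega

/-! ### Total correctness with step counts -/

/-- No store of `c` addresses the array `a`. -/
def Prog.Avoids (a : ℕ) : Prog → Prop
  | .skip => True
  | .store b _ _ => a ≠ b
  | .seq c₁ c₂ => c₁.Avoids a ∧ c₂.Avoids a
  | .branch _ c₁ c₂ => c₁.Avoids a ∧ c₂.Avoids a
  | .loop _ c => c.Avoids a

theorem State.write_of_ne {a b : ℕ} (h : b ≠ a) (s : State) (i z : ℤ) : s.write a i z b = s b :=
  Function.update_of_ne h _ _

theorem State.write_self (s : State) (a : ℕ) (i z : ℤ) :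
    s.write a i z a = Function.update (s a) i z :=
  Function.update_self _ _ _

theorem Steps.eq_of_avoids {c : Prog} {s s' : State} {k : ℕ} (h : Steps c s k s') {a : ℕ}
    (hc : c.Avoids a) : s' a = s a := by
  induction h with
  | skip s => rfl
  | store s b i e => exact State.write_of_ne hc _ _ _
  | seq _ _ ih₁ ih₂ => exact (ih₂ hc.2).trans (ih₁ hc.1)
  | branch_pos _ _ ih => exact ih hc.1
  | branch_neg _ _ ih => exact ih hc.2
  | loop_done _ => rfl
  | loop_step _ _ _ ih₁ ih₂ => exact (ih₂ hc).trans (ih₁ hc)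

/-- Started in `s`, the program `c` halts after at most `k` steps in a memory with property `Q`. -/
def Runs (c : Prog) (s : State) (k : ℕ) (Q : State → Prop) : Prop :=
  ∃ t ≤ k, ∃ s', Steps c s t s' ∧ Q s'

/-- Also serves as a frame rule: the new postcondition may use that the arrays avoided by `c` are
unchanged. -/
theorem Runs.mono {c : Prog} {s : State} {k k' : ℕ} {Q Q' : State → Prop} (h : Runs c s k Q)
    (hk : k ≤ k') (hQ : ∀ s', (∀ a, c.Avoids a → s' a = s a) → Q s' → Q' s') :
    Runs c s k' Q' := by
  obtain ⟨t, ht, s', hs, hq⟩ := h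
  exact ⟨t, ht.trans hk, s', hs, hQ s' (fun a ha => hs.eq_of_avoids ha) hq⟩

theorem Runs.skip {s : State} {Q : State → Prop} (h : Q s) : Runs .skip s 1 Q :=
  ⟨1, le_rfl, s, .skip s, h⟩

theorem Runs.store {s : State} {Q : State → Prop} {a : ℕ} {i e : Expr}
    (h : Q (s.write a (i.val s) (e.val s))) : Runs (.store a i e) s 1 Q :=
  ⟨1, le_rfl, _, .store s a i e, h⟩

theorem Runs.seq {s : State} {Q : State → Prop} {c₁ c₂ : Prog} {k₁ k₂ : ℕ}
    (h : Runs c₁ s k₁ (fun s' => Runs c₂ s' k₂ Q)) : Runs (.seq c₁ c₂) s (k₁ + k₂ + 1) Q := by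
  obtain ⟨t, ht, s', hs, t', ht', s'', hs', hq⟩ := h
  exact ⟨t + t' + 1, by omega, s'', .seq hs hs', hq⟩

theorem Runs.branch {s : State} {Q : State → Prop} {e : Expr} {c₁ c₂ : Prog} {k : ℕ}
    (h₁ : 0 < e.val s → Runs c₁ s k Q) (h₂ : ¬ 0 < e.val s → Runs c₂ s k Q) :
    Runs (.branch e c₁ c₂) s (k + 1) Q := by
  by_cases he : 0 < e.val s
  · obtain ⟨t, ht, s', hs, hq⟩ := h₁ he
    exact ⟨t + 1, by omega, s', .branch_pos he hs, hq⟩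
  · obtain ⟨t, ht, s', hs, hq⟩ := h₂ he
    exact ⟨t + 1, by omega, s', .branch_neg he hs, hq⟩

theorem Runs.loop {e : Expr} {c : Prog} {k : ℕ} (N : ℕ) (Inv : ℕ → State → Prop)
    (hstep : ∀ j < N, ∀ s, Inv j s → 0 < e.val s ∧ Runs c s k (Inv (j + 1)))
    (hend : ∀ s, Inv N s → ¬ 0 < e.val s) {s : State} (h0 : Inv 0 s) :
    Runs (.loop e c) s (N * (k + 1) + 1) (Inv N) := by
  have key : ∀ m j, j + m = N → ∀ s, Inv j s → Runs (.loop e c) s (m * (k + 1) + 1) (Inv N) := by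
    intro m
    induction m with
    | zero =>
      intro j hj s hs
      obtain rfl : j = N := by omega
      exact ⟨1, by omega, s, .loop_done (hend s hs), hs⟩
    | succ m ih =>
      intro j hj s hs
      obtain ⟨he, t, ht, s', hs', hi⟩ := hstep j (by omega) s hs
      obtain ⟨t', ht', s'', hs'', hi'⟩ := ih (j + 1) (by omega) s' hi
      refine ⟨t + t' + 1, ?_, s'', .loop_step he hs' hs'', hi'⟩
      rw [add_mul, one_mul]; omega
  exact key N 0 (by omega) s h0

/-- `for v = 0, …, N - 1 do c`, where `N` is the value of the scalar variable `b`. -/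
def Prog.for (v b : ℕ) (c : Prog) : Prog :=
  .seq (.store v (.const 0) (.const 0))
    (.loop (.sub (.var b) (.var v))
      (.seq c (.store v (.const 0) (.add (.var v) (.const 1)))))

/-- An iteration adds three steps to the body, for the sequencing, the increment and the test. The
invariant is required after the counter has been advanced. -/
theorem Runs.for {v b : ℕ} {c : Prog} {s : State} {N k : ℕ} (Inv : ℕ → State → Prop)
    (hN : s b 0 = N) (hvb : b ≠ v) (hb : c.Avoids b) (hv : c.Avoids v)
    (h0 : Inv 0 (s.write v 0 0))
    (hstep : ∀ j < N, ∀ s', (∀ a, a ≠ v → c.Avoids a → s' a = s a) → s' v 0 = (j : ℤ) → Inv j s' →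
      Runs c s' k (fun s'' => Inv (j + 1) (s''.write v 0 (j + 1)))) :
    Runs (.for v b c) s (N * (k + 3) + 3) (Inv N) := by
  have hloop := Runs.loop (e := .sub (.var b) (.var v))
    (c := .seq c (.store v (.const 0) (.add (.var v) (.const 1)))) (k := k + 1 + 1) N
    (fun j s' => (∀ a, a ≠ v → c.Avoids a → s' a = s a) ∧ s' v 0 = (j : ℤ) ∧ Inv j s') ?_ ?_
    (s := s.write v 0 0) ⟨fun a ha _ => State.write_of_ne ha _ _ _, ?_, h0⟩
  · refine Runs.mono (Runs.seq (Runs.store hloop)) ?_ fun s' _ h => h.2.2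
    rw [show k + 1 + 1 + 1 = k + 3 by ring]; omega
  · rintro j hj s' ⟨hfr, hj', hinv⟩
    refine ⟨?_, Runs.seq ((hstep j hj s' hfr hj' hinv).mono le_rfl ?_)⟩
    · simp only [Expr.val, Expr.var, hj', hfr b hvb hb, hN]; omega
    · intro s'' hfr' hinv'
      have e1 : s'' v 0 = j := by rw [hfr' v hv, hj']
      refine Runs.store ⟨fun a ha hca => ?_, ?_, ?_⟩
      · rw [State.write_of_ne ha, hfr' a hca, hfr a ha hca]
      · simp only [Expr.val, Expr.var, State.write_self, Function.update_self, e1]; push_cast; rfl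
      · simpa only [Expr.val, Expr.var, e1] using hinv'
  · rintro s' ⟨hfr, hj', -⟩
    simp only [Expr.val, Expr.var, hj', hfr b hvb hb, hN]; omega
  · rw [State.write_self, Function.update_self]; rfl

/-! ### Polynomial bounds -/

def PolyBounded (f : ℕ → ℕ) : Prop := ∃ P : Polynomial ℕ, ∀ n, f n ≤ P.eval n

theorem eval_monotone (P : Polynomial ℕ) : Monotone fun n => P.eval n := fun a b hab => by
  simp only [Polynomial.eval_eq_sum, Polynomial.sum]
  exact Finset.sum_le_sum fun i _ => Nat.mul_le_mul_left _ (Nat.pow_le_pow_left hab i)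

theorem PolyBounded.mono {f g : ℕ → ℕ} (hg : PolyBounded g) (h : ∀ n, f n ≤ g n) :
    PolyBounded f := hg.imp fun _ hP n => (h n).trans (hP n)

theorem polyBounded_const (c : ℕ) : PolyBounded fun _ => c := ⟨.C c, fun n => by simp⟩

theorem polyBounded_id : PolyBounded fun n => n := ⟨.X, fun n => by simp⟩

theorem PolyBounded.add {f g : ℕ → ℕ} (hf : PolyBounded f) (hg : PolyBounded g) :
    PolyBounded fun n => f n + g n := by
  obtain ⟨P, hP⟩ := hf
  obtain ⟨Q, hQ⟩ := hg
  exact ⟨P + Q, fun n => by rw [Polynomial.eval_add]; exact add_le_add (hP n) (hQ n)⟩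

theorem PolyBounded.mul {f g : ℕ → ℕ} (hf : PolyBounded f) (hg : PolyBounded g) :
    PolyBounded fun n => f n * g n := by
  obtain ⟨P, hP⟩ := hf
  obtain ⟨Q, hQ⟩ := hg
  exact ⟨P * Q, fun n => by rw [Polynomial.eval_mul]; exact Nat.mul_le_mul (hP n) (hQ n)⟩

theorem PolyBounded.pow {f : ℕ → ℕ} (hf : PolyBounded f) (k : ℕ) :
    PolyBounded fun n => f n ^ k := by
  obtain ⟨P, hP⟩ := hf
  exact ⟨P ^ k, fun n => by rw [Polynomial.eval_pow]; exact Nat.pow_le_pow_left (hP n) k⟩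

end RAM

/-! ### Encoding of instances in memory and iteration over clauses. -/

namespace RAM

open Finset Matrix

/-! ### Vectors in the memory and the clause table -/

section Vector

variable {n : ℕ}

/-- The array with the entries of `x` in the cells `0, …, n - 1`. -/
def vecArray (x : Fin n → ℤ) : ℤ → ℤ := fun z =>
  if h : 0 ≤ z ∧ z < n then x ⟨z.toNat, by omega⟩ else 0

theorem vecArray_apply (x : Fin n → ℤ) (i : Fin n) : vecArray x (i : ℕ) = x i := by
  rw [vecArray, dif_pos ⟨by omega, by omega⟩]
  congr 1

theorem vecArray_zero : vecArray (0 : Fin n → ℤ) = 0 := by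
  funext z
  simp [vecArray]

theorem update_vecArray (x : Fin n → ℤ) (i : Fin n) (y : ℤ) :
    Function.update (vecArray x) (i : ℕ) y = vecArray (Function.update x i y) := by
  funext z
  by_cases hz : z = (i : ℕ)
  · subst hz; rw [Function.update_self, vecArray_apply, Function.update_self]
  · rw [Function.update_of_ne hz]
    simp only [vecArray]
    split_ifs with h
    · rw [Function.update_of_ne]
      intro hi
      apply hz
      have := congrArg Fin.val hi
      simp only at this
      omega
    · rfl

theorem update_vecArray_add (x : Fin n → ℤ) (i : Fin n) (y : ℤ) :
    Function.update (vecArray x) (i : ℕ) (vecArray x (i : ℕ) + y) = vecArray (x + Pi.single i y) := by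
  rw [vecArray_apply, update_vecArray]
  congr 1
  funext j
  by_cases hj : j = i
  · subst hj; simp
  · simp [hj]

end Vector

theorem clauseAt_injective (n : ℕ) : Function.Injective (clauseAt n) := by
  intro j j' h
  have h1 := congrArg Prod.fst h
  have h2 := congrArg Prod.snd h
  simp only [clauseAt] at h1 h2
  have hm : j.modNat = j'.modNat := finFunctionFinEquiv.symm.injective h2
  have hd : j.divNat = j'.divNat := by
    refine finFunctionFinEquiv.symm.injective (funext fun i => ?_)
    have := congrFun h1 i
    revert this
    generalize finFunctionFinEquiv.symm j.divNat i = a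
    generalize finFunctionFinEquiv.symm j'.divNat i = b
    revert a b
    decide
  exact finProdFinEquiv.symm.injective (Prod.ext hd hm)

noncomputable def clauseEquiv (n : ℕ) : Fin (2 ^ 3 * n ^ 3) ≃ Clause 3 n :=
  Equiv.ofBijective (clauseAt n) ((Fintype.bijective_iff_injective_and_card _).2
    ⟨clauseAt_injective n, by simp [Clause, Fintype.card_prod, Fintype.card_units_int]⟩)

/-- The position of a clause in the table. -/
noncomputable def clauseIndex {n : ℕ} (e : Clause 3 n) : ℕ := ((clauseEquiv n).symm e : ℕ)

theorem clauseIndex_lt {n : ℕ} (e : Clause 3 n) : clauseIndex e < 8 * n ^ 3 :=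
  ((clauseEquiv n).symm e).isLt

theorem clauseAt_clauseIndex {n : ℕ} (e : Clause 3 n) :
    clauseAt n ((clauseEquiv n).symm e) = e := (clauseEquiv n).apply_symm_apply e

theorem exists_clauseIndex_eq {n j : ℕ} (hj : j < 8 * n ^ 3) :
    ∃ e : Clause 3 n, clauseIndex e = j :=
  ⟨clauseEquiv n ⟨j, hj⟩, by simp [clauseIndex]⟩

theorem clauseIndex_injective {n : ℕ} : Function.Injective (clauseIndex (n := n)) := fun _ _ h =>
  (clauseEquiv n).symm.injective (Fin.ext h)

theorem snd_eq_clauseIndex {n : ℕ} (e : Clause 3 n) (a : Fin 3) :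
    ((e.2 a : ℕ) : ℤ) = (clauseIndex e : ℤ) % (n : ℤ) ^ 3 / (n : ℤ) ^ (a : ℕ) % n := by
  have h : (clauseAt n ((clauseEquiv n).symm e)).2 a = e.2 a := by rw [clauseAt_clauseIndex]
  rw [← h, clauseAt, finFunctionFinEquiv_symm_apply_val]
  push_cast
  rfl

theorem fst_eq_clauseIndex {n : ℕ} (e : Clause 3 n) (a : Fin 3) :
    ((e.1 a : ℤˣ) : ℤ) = 1 - 2 * ((clauseIndex e : ℤ) / (n : ℤ) ^ 3 / 2 ^ (a : ℕ) % 2) := by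
  have h : (clauseAt n ((clauseEquiv n).symm e)).1 a = e.1 a := by rw [clauseAt_clauseIndex]
  have hd : ((finFunctionFinEquiv.symm ((clauseEquiv n).symm e).divNat a : Fin 2) : ℕ) =
      clauseIndex e / n ^ 3 / 2 ^ (a : ℕ) % 2 := by
    rw [finFunctionFinEquiv_symm_apply_val]; rfl
  have hd' : (clauseIndex e : ℤ) / (n : ℤ) ^ 3 / 2 ^ (a : ℕ) % 2 =
      (((finFunctionFinEquiv.symm ((clauseEquiv n).symm e).divNat a : Fin 2) : ℕ) : ℤ) := by
    rw [hd]; push_cast; rfl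
  rw [← h, hd', clauseAt]
  simp only
  generalize (finFunctionFinEquiv.symm ((clauseEquiv n).symm e).divNat a : Fin 2) = b
  revert b
  decide

/-! ### The program

The arrays are: `0` the input, `1` its length, `2` the number `n` of variables, `3` the number
`8 n ^ 3` of clauses, `4` and `5` the powers `n ^ 3` and `n ^ 2`, `6` a power of two, `7` the
exponent of the traces, `8` to `11` loop counters, `12` and `13` the current vector and its image,
`14` the sum of traces, `15` to `17` the degrees times `n`, the number of clauses and its product
with `n`, `18` the degree deviation, `19` and `20` the norm bound times `7 n ^ 2` and its power. -/

def Prog.set (a : ℕ) (e : Expr) : Prog := .store a (.const 0) e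

theorem Runs.set {s : State} {Q : State → Prop} {a : ℕ} {e : Expr}
    (h : Q (s.write a 0 (e.val s))) : Runs (.set a e) s 1 Q :=
  Runs.store h

theorem Expr.val_var (s : State) (a : ℕ) : (Expr.var a).val s = s a 0 := rfl

/-- The `a`-th vertex of the clause at the position stored in variable `11`. -/
def vertexExpr (a : Fin 3) : Expr :=
  (Expr.div ((Expr.var 11).mod (.var 4)) (![.const 1, .var 2, .var 5] a)).mod (.var 2)

/-- The `a`-th sign of the clause at the position stored in variable `11`. -/
def signExpr (a : Fin 3) : Expr :=
  .sub (.const 1) (.mul (.const 2)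
    ((Expr.div (.div (.var 11) (.var 4)) (.const (2 ^ (a : ℕ)))).mod (.const 2)))

def signProdExpr (l : List (Fin 3)) : Expr :=
  l.foldr (fun a e => .mul (signExpr a) e) (.const 1)

theorem tame_vertexExpr (a : Fin 3) : (vertexExpr a).Tame := by
  refine Expr.Tame.mod (.div (.mod (Expr.tame_var _) (Expr.tame_var _)) ?_) (Expr.tame_var _)
  fin_cases a
  exacts [Expr.tame_const _, Expr.tame_var _, Expr.tame_var _]

theorem tame_signExpr (a : Fin 3) : (signExpr a).Tame :=
  .sub (Expr.tame_const _) (Expr.Tame.mul_of_bound (Expr.tame_const _)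
    (.mod (.div (.div (Expr.tame_var _) (Expr.tame_var _)) (Expr.tame_const _))
      (Expr.tame_const _)) 2 fun _ => le_rfl)

theorem natAbs_signExpr_le (s : State) (a : Fin 3) : ((signExpr a).val s).natAbs ≤ 1 := by
  simp only [signExpr, Expr.val, Expr.val_mod]
  omega

theorem tame_signProdExpr (l : List (Fin 3)) : (signProdExpr l).Tame := by
  induction l with
  | nil => exact Expr.tame_const 1
  | cons a l ih => exact Expr.Tame.mul_of_bound (tame_signExpr a) ih 1 fun s => natAbs_signExpr_le s a

theorem natAbs_signProdExpr_le (l : List (Fin 3)) (s : State) :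
    ((signProdExpr l).val s).natAbs ≤ 1 := by
  induction l with
  | nil => simp [signProdExpr, Expr.val]
  | cons a l ih =>
    change ((signExpr a).val s * (signProdExpr l).val s).natAbs ≤ 1
    rw [Int.natAbs_mul]
    exact Nat.mul_le_mul (natAbs_signExpr_le s a) ih

/-- The scalars computed from the size of the instance are in place. -/
structure Ready (n : ℕ) (I : SignedHypergraph 3 n) (s : State) : Prop where
  table : ∀ e : Clause 3 n, s 0 (clauseIndex e + 1) = if e ∈ I then 1 else 0
  var_two : s 2 0 = n
  var_three : s 3 0 = (8 * n ^ 3 : ℕ)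
  var_four : s 4 0 = (n : ℤ) ^ 3
  var_five : s 5 0 = (n : ℤ) ^ 2

theorem Ready.congr {n : ℕ} {I : SignedHypergraph 3 n} {s s' : State} (h : Ready n I s)
    (h' : ∀ a ∈ [0, 2, 3, 4, 5], s' a = s a) : Ready n I s' := by
  constructor
  · intro e; rw [h' 0 (by simp)]; exact h.table e
  · rw [h' 2 (by simp)]; exact h.var_two
  · rw [h' 3 (by simp)]; exact h.var_three
  · rw [h' 4 (by simp)]; exact h.var_four
  · rw [h' 5 (by simp)]; exact h.var_five

variable {n : ℕ} {I : SignedHypergraph 3 n} {s : State}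

theorem Ready.val_vertexExpr (h : Ready n I s) {e : Clause 3 n} (he : s 11 0 = clauseIndex e)
    (a : Fin 3) : (vertexExpr a).val s = (e.2 a : ℕ) := by
  rw [snd_eq_clauseIndex]
  fin_cases a <;>
    simp [vertexExpr, Expr.val, Expr.val_mod, Expr.val_var, he, h.var_two, h.var_four, h.var_five]

theorem Ready.val_signExpr (h : Ready n I s) {e : Clause 3 n} (he : s 11 0 = clauseIndex e)
    (a : Fin 3) : (signExpr a).val s = ((e.1 a : ℤˣ) : ℤ) := by
  rw [fst_eq_clauseIndex]
  simp [signExpr, Expr.val, Expr.val_mod, Expr.val_var, he, h.var_four]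

theorem Ready.val_signProdExpr (h : Ready n I s) {e : Clause 3 n} (he : s 11 0 = clauseIndex e)
    (f : SignForm) : (signProdExpr f.signs).val s = f.sign e := by
  rw [SignForm.sign]
  induction f.signs with
  | nil => rfl
  | cons a l ih =>
    change (signExpr a).val s * (signProdExpr l).val s = _
    rw [ih, h.val_signExpr he, List.map_cons, List.prod_cons]

/-- Run `c` for every clause of the instance. -/
def Prog.forClauses (c : Prog) : Prog :=
  .for 11 3 (.branch (.get 0 (.add (.var 11) (.const 1))) c .skip)

/-- The invariant is indexed by the set of members already visited, so clients argue by inserting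
one clause and never see table positions outside `I`. -/
theorem Runs.forClauses {c : Prog} {k : ℕ} (hs : Ready n I s)
    (P : SignedHypergraph 3 n → State → Prop) (hc : ∀ a ∈ [0, 2, 3, 4, 5, 11], c.Avoids a)
    (h0 : P ∅ (s.write 11 0 0))
    (hP : ∀ J s' z, P J s' → P J (s'.write 11 0 z))
    (hstep : ∀ J e s', e ∉ J → (∀ a, a ≠ 11 → c.Avoids a → s' a = s a) → Ready n I s' →
      s' 11 0 = clauseIndex e → P J s' →
      Runs c s' (k + 1) (fun s'' => P (insert e J) (s''.write 11 0 (clauseIndex e + 1)))) :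
    Runs c.forClauses s (8 * n ^ 3 * (k + 5) + 3) (P I) := by
  have h := Runs.for (v := 11) (b := 3) (c := .branch (.get 0 (.add (.var 11) (.const 1))) c .skip)
    (s := s) (N := 8 * n ^ 3) (k := k + 1 + 1) (fun j s' => P {e ∈ I | clauseIndex e < j} s')
    hs.var_three (by norm_num) ⟨hc 3 (by simp), trivial⟩ ⟨hc 11 (by simp), trivial⟩
    (by simpa using h0) ?_
  · refine h.mono (by rw [show k + 1 + 1 + 3 = k + 5 by ring]) fun s' _ hP' => ?_
    rwa [filter_true_of_mem fun e _ => clauseIndex_lt e] at hP'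
  · intro j hj s' hfr hj' hPj
    obtain ⟨e, rfl⟩ := exists_clauseIndex_eq hj
    have hfr' : ∀ a, a ≠ 11 → c.Avoids a → s' a = s a := fun a ha hca => hfr a ha ⟨hca, trivial⟩
    have hready : Ready n I s' := hs.congr fun a ha => hfr' a (by
      rintro rfl; simp at ha) (hc a (by simp at ha ⊢; tauto))
    have hsucc : ({e' ∈ I | clauseIndex e' < clauseIndex e + 1} : SignedHypergraph 3 n) =
        if e ∈ I then insert e {e' ∈ I | clauseIndex e' < clauseIndex e}
        else {e' ∈ I | clauseIndex e' < clauseIndex e} := by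
      ext e'
      have hee : clauseIndex e' = clauseIndex e ↔ e' = e := clauseIndex_injective.eq_iff
      split_ifs with he <;> simp only [mem_filter, mem_insert, Nat.lt_succ_iff_lt_or_eq, hee]
      · constructor
        · rintro ⟨h1, h2 | h2⟩ <;> tauto
        · rintro (rfl | h2) <;> tauto
      · constructor
        · rintro ⟨h1, h2 | rfl⟩ <;> tauto
        · tauto
    have hval : (Expr.get 0 (.add (.var 11) (.const 1))).val s' = if e ∈ I then 1 else 0 := by
      rw [← hready.table e]
      simp only [Expr.val, Expr.val_var, hj']
    refine Runs.branch (fun hpos => ?_) fun hneg => ?_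
    · have he : e ∈ I := by
        by_contra hne
        rw [hval, if_neg hne] at hpos
        exact lt_irrefl _ hpos
      rw [hsucc, if_pos he]
      exact hstep _ e s' (by simp) hfr' hready hj' hPj
    · have he : e ∉ I := fun he => by
        rw [hval, if_pos he] at hneg
        exact hneg one_pos
      rw [hsucc, if_neg he]
      exact (Runs.skip (Q := fun s'' => P _ (s''.write 11 0 (clauseIndex e + 1)))
        (hP _ s' _ hPj)).mono (Nat.le_add_left 1 k) fun _ _ h => h

end RAM

/-! ### Computation of the trace sum. -/

namespace RAM

open Finset Matrix

variable {n : ℕ} {I : SignedHypergraph 3 n} {s : State}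

/-! ### Multiplication by the matrix of a form -/

/-- Add the contribution of the current clause to the image of the vector. -/
def formStep (f : SignForm) : Prog :=
  .seq
    (.store 13 (vertexExpr f.fst) (.add (.get 13 (vertexExpr f.fst))
      (.mul (signProdExpr f.signs) (.get 12 (vertexExpr f.snd)))))
    (.store 13 (vertexExpr f.snd) (.add (.get 13 (vertexExpr f.snd))
      (.mul (signProdExpr f.signs) (.get 12 (vertexExpr f.fst)))))

/-- Array `12` is only read and array `13` accumulates, so the two increments add up correctly even
when the vertices coincide. -/
theorem runs_formStep (f : SignForm) (hs : Ready n I s) {e : Clause 3 n}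
    (he : s 11 0 = clauseIndex e) {x y : Fin n → ℤ} (hx : s 12 = vecArray x)
    (hy : s 13 = vecArray y) :
    Runs (formStep f) s 3 (fun s' => s' 12 = vecArray x ∧
      s' 13 = vecArray (y + f.sign e • (f.edge ℤ e *ᵥ x))) := by
  refine Runs.seq (Runs.store (Runs.store ?_))
  have hs' : ∀ i z, Ready n I (s.write 13 i z) := fun i z => hs.congr fun a ha =>
    State.write_of_ne (by rintro rfl; simp at ha) _ _ _
  have he' : ∀ i z, (s.write 13 i z) 11 0 = clauseIndex e := fun i z => by
    rw [State.write_of_ne (by norm_num), he]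
  have hx' : ∀ i z, (s.write 13 i z) 12 = vecArray x := fun i z => by
    rw [State.write_of_ne (by norm_num), hx]
  refine ⟨by rw [State.write_of_ne (by norm_num), hx'], ?_⟩
  simp only [Expr.val, (hs' _ _).val_vertexExpr (he' _ _), hs.val_vertexExpr he,
    (hs' _ _).val_signProdExpr (he' _ _), hs.val_signProdExpr he, State.write_self, hx', hx, hy,
    update_vecArray_add]
  rw [vecArray_apply, vecArray_apply, f.edge_mulVec, smul_add, add_assoc]
  simp only [← Pi.single_smul, smul_eq_mul]

/-- Replace the vector by its image under the matrix of the form. -/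
def mulVecProg (f : SignForm) : Prog :=
  .seq (formStep f).forClauses
    (.for 9 2 (.seq (.store 12 (.var 9) (.get 13 (.var 9))) (.store 13 (.var 9) (.const 0))))

theorem runs_mulVecProg (f : SignForm) (hs : Ready n I s) {x : Fin n → ℤ}
    (hx : s 12 = vecArray x) (hy : s 13 = vecArray (0 : Fin n → ℤ)) :
    Runs (mulVecProg f) s (56 * n ^ 3 + 6 * n + 7) (fun s' =>
      s' 12 = vecArray (f.matrix I *ᵥ x) ∧ s' 13 = vecArray (0 : Fin n → ℤ)) := by
  have h1 := Runs.forClauses (c := formStep f) (k := 2) hs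
    (fun J s' => s' 12 = vecArray x ∧ s' 13 = vecArray (f.matrix J *ᵥ x))
    (by simp [formStep, Prog.Avoids])
    (by
      simp only [State.write_of_ne (show 12 ≠ 11 by norm_num),
        State.write_of_ne (show 13 ≠ 11 by norm_num)]
      refine ⟨hx, ?_⟩
      rw [hy, SignForm.matrix, sum_empty, zero_mulVec])
    (fun J s' z h => by
      simpa only [State.write_of_ne (show 12 ≠ 11 by norm_num),
        State.write_of_ne (show 13 ≠ 11 by norm_num)] using h)
    (fun J e s' heJ _ hs' he h => (runs_formStep f hs' he h.1 h.2).mono le_rfl fun s'' _ h' => by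
      simp only [State.write_of_ne (show 12 ≠ 11 by norm_num),
        State.write_of_ne (show 13 ≠ 11 by norm_num)]
      refine ⟨h'.1, ?_⟩
      rw [h'.2, SignForm.matrix, SignForm.matrix, sum_insert heJ, add_mulVec, smul_mulVec,
        add_comm])
  refine (Runs.seq (k₂ := n * (3 + 3) + 3) (h1.mono le_rfl fun s₁ hfr h => ?_)).mono
    (by omega) fun _ _ h => h
  set y := f.matrix I *ᵥ x
  have hs₁ : s₁ 2 0 = n := by
    rw [hfr 2 (by simp [Prog.forClauses, Prog.for, Prog.Avoids, formStep]), hs.var_two]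
  -- While the image is copied back and cleared, both arrays are hybrids: new contents below `j`,
  -- old contents from `j` on.
  refine (Runs.for (k := 3) (fun j s' => s' 12 = vecArray (fun i => if i < j then y i else x i) ∧
    s' 13 = vecArray (fun i => if i < j then 0 else y i)) hs₁ (by norm_num)
    (by simp [Prog.Avoids]) (by simp [Prog.Avoids]) ?_ ?_).mono le_rfl fun s' _ h' => ?_
  · simpa [State.write_of_ne] using h
  · intro j hj s' _ hj' h'
    refine Runs.seq (Runs.store (Runs.store ?_))
    have e1 := update_vecArray (fun i : Fin n => if (i : ℕ) < j then y i else x i) ⟨j, hj⟩ (y ⟨j, hj⟩)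
    have e2 := update_vecArray (fun i : Fin n => if (i : ℕ) < j then 0 else y i) ⟨j, hj⟩ 0
    have e3 := vecArray_apply (fun i : Fin n => if (i : ℕ) < j then 0 else y i) ⟨j, hj⟩
    simp only [lt_irrefl, if_false] at e1 e2 e3
    have hup : ∀ (u v : Fin n → ℤ), Function.update (fun i : Fin n => if (i : ℕ) < j then u i else v i)
        ⟨j, hj⟩ (u ⟨j, hj⟩) = fun i : Fin n => if (i : ℕ) < j + 1 then u i else v i := by
      intro u v
      funext i
      rcases lt_trichotomy (i : ℕ) j with h | h | h
      · rw [Function.update_of_ne (by rintro rfl; simp at h), if_pos h, if_pos (by omega)]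
      · obtain rfl : i = ⟨j, hj⟩ := Fin.ext h
        simp
      · rw [Function.update_of_ne (by rintro rfl; simp at h), if_neg (by omega), if_neg (by omega)]
    rw [hup y x] at e1
    rw [hup (fun _ => 0) y] at e2
    simp [State.write_of_ne, State.write_self, Expr.val, Expr.val_var, hj', h'.1, h'.2, e1, e2, e3]
  · constructor
    · rw [h'.1]; congr 1; funext i; simp
    · rw [h'.2]; congr 1; funext i; simp

/-! ### Traces of powers -/

/-- Add the `i`-th diagonal entry of the power of the matrix, for the value `i` of variable `8`. -/
def diagProg (f : SignForm) : Prog :=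
  .seq (.for 9 2 (.store 12 (.var 9) (.const 0)))
    (.seq (.store 12 (.var 8) (.const 1))
      (.seq (.for 10 7 (mulVecProg f))
        (.set 14 (.add (.var 14) (.get 12 (.var 8))))))

/-- Step count of `diagProg`, for vectors of length `n` and exponent `E`. -/
def diagSteps (n E : ℕ) : ℕ := n * 4 + E * (56 * n ^ 3 + 6 * n + 10) + 12

theorem runs_diagProg (f : SignForm) (hs : Ready n I s) {E : ℕ} (hE : s 7 0 = E) {x : Fin n → ℤ}
    (hx : s 12 = vecArray x) (hy : s 13 = vecArray (0 : Fin n → ℤ)) (i : Fin n)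
    (hi : s 8 0 = (i : ℕ)) :
    Runs (diagProg f) s (diagSteps n E) (fun s' => (∃ x : Fin n → ℤ, s' 12 = vecArray x) ∧
      s' 13 = vecArray (0 : Fin n → ℤ) ∧ s' 14 0 = s 14 0 + (f.matrix I ^ E) i i) := by
  have h1 := Runs.for (v := 9) (b := 2) (c := .store 12 (.var 9) (.const 0)) (k := 1)
    (fun j s' => s' 12 = vecArray (fun i => if i < j then 0 else x i)) hs.var_two (by norm_num)
    (by simp [Prog.Avoids]) (by simp [Prog.Avoids])
    (by simpa [State.write_of_ne] using hx)
    (fun j hj s' _ hj' h' => Runs.store (by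
      have e2 := update_vecArray (fun i : Fin n => if (i : ℕ) < j then 0 else x i) ⟨j, hj⟩ 0
      have e3 : Function.update (fun i : Fin n => if (i : ℕ) < j then 0 else x i) ⟨j, hj⟩ 0 =
          fun i : Fin n => if (i : ℕ) < j + 1 then 0 else x i := by
        funext i
        rcases lt_trichotomy (i : ℕ) j with h | h | h
        · rw [Function.update_of_ne (by rintro rfl; simp at h), if_pos h, if_pos (by omega)]
        · obtain rfl : i = ⟨j, hj⟩ := Fin.ext h
          simp
        · rw [Function.update_of_ne (by rintro rfl; simp at h), if_neg (by omega),
            if_neg (by omega)]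
      rw [e3] at e2
      simp [State.write_of_ne, State.write_self, Expr.val, Expr.val_var, hj', h', e2]))
  refine (Runs.seq (k₂ := 1 + (E * (56 * n ^ 3 + 6 * n + 7 + 3) + 3 + 1 + 1) + 1)
    (h1.mono le_rfl fun s₁ hfr₁ hz => ?_)).mono (by rw [diagSteps]; ring_nf; omega) fun _ _ h => h
  have hz' : s₁ 12 = vecArray (0 : Fin n → ℤ) := by
    rw [hz]; congr 1; funext i; simp
  refine Runs.seq (Runs.store ?_)
  have hfr : ∀ a, a ≠ 9 → a ≠ 12 → (s₁.write 12 ((Expr.var 8).val s₁) ((Expr.const 1).val s₁)) a = s a := by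
    intro a ha ha'
    rw [State.write_of_ne ha', hfr₁ a (by simp [Prog.for, Prog.Avoids, ha, ha'])]
  have h12 : (s₁.write 12 ((Expr.var 8).val s₁) ((Expr.const 1).val s₁)) 12 =
      vecArray (Pi.single i 1) := by
    rw [State.write_self, hz', Expr.val_var, hfr₁ 8 (by simp [Prog.for, Prog.Avoids]), hi,
      update_vecArray]
    rfl
  generalize s₁.write 12 ((Expr.var 8).val s₁) ((Expr.const 1).val s₁) = s₂ at hfr h12
  refine Runs.seq (k₁ := E * (56 * n ^ 3 + 6 * n + 7 + 3) + 3) (k₂ := 1) ((Runs.for (k := 56 * n ^ 3 + 6 * n + 7) (N := E) (fun r s' =>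
    s' 12 = vecArray (f.matrix I ^ r *ᵥ Pi.single i 1) ∧ s' 13 = vecArray (0 : Fin n → ℤ))
    (by rw [hfr 7 (by norm_num) (by norm_num), hE]) (by norm_num)
    (by simp [mulVecProg, Prog.forClauses, Prog.for, formStep, Prog.Avoids])
    (by simp [mulVecProg, Prog.forClauses, Prog.for, formStep, Prog.Avoids]) ?_ ?_).mono
    le_rfl fun s₃ hfr₃ h₃ => ?_)
  · exact ⟨by rw [State.write_of_ne (by norm_num), pow_zero, one_mulVec, h12],
      by rw [State.write_of_ne (by norm_num), hfr 13 (by norm_num) (by norm_num), hy]⟩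
  · intro r hr s' hfr' _ h'
    have hs' : Ready n I s' := hs.congr fun a ha => by
      rw [hfr' a (by rintro rfl; simp at ha)
        (by simp [mulVecProg, Prog.forClauses, Prog.for, formStep, Prog.Avoids] at ha ⊢; omega)]
      exact hfr a (by rintro rfl; simp at ha) (by rintro rfl; simp at ha)
    refine (runs_mulVecProg f hs' h'.1 h'.2).mono le_rfl fun s'' _ h'' => ?_
    rw [State.write_of_ne (by norm_num), State.write_of_ne (by norm_num), pow_succ', ← mulVec_mulVec]
    exact h''
  · have hfr₃' : ∀ a ∈ [8, 14], s₃ a = s a := fun a ha => by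
      rw [hfr₃ a (by
        simp [mulVecProg, Prog.forClauses, Prog.for, formStep, Prog.Avoids] at ha ⊢; omega)]
      exact hfr a (by rintro rfl; simp at ha) (by rintro rfl; simp at ha)
    refine Runs.set ⟨⟨f.matrix I ^ E *ᵥ Pi.single i 1, ?_⟩, ?_, ?_⟩
    · rw [State.write_of_ne (by norm_num), h₃.1]
    · rw [State.write_of_ne (by norm_num), h₃.2]
    · simp only [State.write_self, Function.update_self, Expr.val, Expr.var, h₃.1,
        hfr₃' 8 (by simp), hfr₃' 14 (by simp), hi, vecArray_apply, mulVec_single_one]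
      rfl

theorem sum_filter_lt_succ {M : Type*} [AddCommMonoid M] (g : Fin n → M) {j : ℕ} (hj : j < n) :
    ∑ i ∈ univ.filter (fun i : Fin n => (i : ℕ) < j + 1), g i = (∑ i ∈ univ.filter (fun i : Fin n => (i : ℕ) < j), g i) + g ⟨j, hj⟩ := by
  have : (univ.filter fun i : Fin n => (i : ℕ) < j + 1) =
      insert ⟨j, hj⟩ (univ.filter fun i : Fin n => (i : ℕ) < j) := by
    ext i
    simp only [mem_filter, mem_univ, true_and, mem_insert, Fin.ext_iff]
    omega
  rw [this, sum_insert (by simp), add_comm]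

/-- Add the trace of the power of the matrix of the form. -/
def traceProg (f : SignForm) : Prog := .for 8 2 (diagProg f)

theorem runs_traceProg (f : SignForm) (hs : Ready n I s) {E : ℕ} (hE : s 7 0 = E)
    (hx : ∃ x : Fin n → ℤ, s 12 = vecArray x) (hy : s 13 = vecArray (0 : Fin n → ℤ)) :
    Runs (traceProg f) s (n * (diagSteps n E + 3) + 3) (fun s' =>
      (∃ x : Fin n → ℤ, s' 12 = vecArray x) ∧ s' 13 = vecArray (0 : Fin n → ℤ) ∧
      s' 14 0 = s 14 0 + (f.matrix I ^ E).trace) := by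
  refine (Runs.for (k := diagSteps n E) (fun j s' => (∃ x : Fin n → ℤ, s' 12 = vecArray x) ∧
    s' 13 = vecArray (0 : Fin n → ℤ) ∧
    s' 14 0 = s 14 0 + ∑ i ∈ univ.filter (fun i : Fin n => (i : ℕ) < j), (f.matrix I ^ E) i i) hs.var_two (by norm_num)
    (by simp [diagProg, Prog.set, mulVecProg, Prog.forClauses, Prog.for, formStep, Prog.Avoids])
    (by simp [diagProg, Prog.set, mulVecProg, Prog.forClauses, Prog.for, formStep, Prog.Avoids])
    ?_ ?_).mono le_rfl fun s' _ h' => ?_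
  · simpa [State.write_of_ne, hy] using hx
  · rintro j hj s' hfr hj' ⟨⟨x, hx'⟩, hy', hT⟩
    have hfr' : ∀ a ∈ [0, 2, 3, 4, 5, 7], s' a = s a := fun a ha =>
      hfr a (by rintro rfl; simp at ha) (by
        simp [diagProg, Prog.set, mulVecProg, Prog.forClauses, Prog.for, formStep,
          Prog.Avoids] at ha ⊢; omega)
    have hs' : Ready n I s' := hs.congr fun a ha => hfr' a (by simp at ha ⊢; tauto)
    refine (runs_diagProg f hs' (by rw [hfr' 7 (by simp), hE]) hx' hy' ⟨j, hj⟩ hj').mono le_rfl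
      fun s'' _ h'' => ?_
    simp only [State.write_of_ne (show 12 ≠ 8 by norm_num),
      State.write_of_ne (show 13 ≠ 8 by norm_num), State.write_of_ne (show 14 ≠ 8 by norm_num)]
    refine ⟨h''.1, h''.2.1, ?_⟩
    rw [h''.2.2, hT, sum_filter_lt_succ _ hj, add_assoc]
  · simpa [trace] using h'

/-- Add the traces for all forms in the list. -/
def traceSumProg (l : List SignForm) : Prog :=
  l.foldr (fun f c => .seq (traceProg f) c) .skip

theorem avoids_traceSumProg (l : List SignForm) {a : ℕ} (ha : a ∉ [8, 9, 10, 11, 12, 13, 14]) :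
    (traceSumProg l).Avoids a := by
  induction l with
  | nil => trivial
  | cons f l ih =>
    refine ⟨?_, ih⟩
    simp [traceProg, diagProg, Prog.set, mulVecProg, Prog.forClauses, Prog.for, formStep,
      Prog.Avoids] at ha ⊢
    omega

theorem runs_traceSumProg (l : List SignForm) (hs : Ready n I s) {E : ℕ} (hE : s 7 0 = E)
    (hx : ∃ x : Fin n → ℤ, s 12 = vecArray x) (hy : s 13 = vecArray (0 : Fin n → ℤ)) :
    Runs (traceSumProg l) s (l.length * (n * (diagSteps n E + 3) + 4) + 1) (fun s' =>
      s' 14 0 = s 14 0 + (l.map fun f => (f.matrix I ^ E).trace).sum) := by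
  induction l generalizing s with
  | nil => exact (Runs.skip (by simp)).mono (by omega) fun _ _ h => h
  | cons f l ih =>
    refine (Runs.seq ((runs_traceProg f hs hE hx hy).mono le_rfl fun s' hfr h' => ?_)).mono
      (k := n * (diagSteps n E + 3) + 3 + (l.length * (n * (diagSteps n E + 3) + 4) + 1) + 1)
      (by rw [List.length_cons]; ring_nf; omega) fun _ _ h => h
    have hfr' : ∀ a ∈ [0, 2, 3, 4, 5, 7], s' a = s a := fun a ha =>
      hfr a ((avoids_traceSumProg [f] (by simp at ha ⊢; omega)).1)
    refine (ih (hs.congr fun a ha => hfr' a (by simp at ha ⊢; tauto))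
      (by rw [hfr' 7 (by simp), hE]) h'.1 h'.2.1).mono le_rfl fun s'' _ h'' => ?_
    rw [h'', h'.2.2, List.map_cons, List.sum_cons, add_assoc]

end RAM

/-! ### Setup, degree statistics, norm bound and output. -/

namespace RAM

open Finset Matrix

variable {n : ℕ} {I : SignedHypergraph 3 n} {s : State}

/-! ### Initialization -/

/-- The table length encodes `8 * n ^ 3`, so the powers of `n` come from divisions and growth stays
linear. -/
def setupProg : Prog :=
  .seq (.set 2 (.get 0 (.const 0))) (.seq (.set 3 (.sub (.var 1) (.const 1)))
    (.seq (.set 4 (.div (.var 3) (.const 8))) (.set 5 (.div (.var 4) (.var 2)))))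

theorem length_encodeInstance (n : ℕ) (I : SignedHypergraph 3 n) :
    (encodeInstance ⟨n, I⟩).length = 8 * n ^ 3 + 1 := by
  simp [encodeInstance]

theorem initial_of_two_le (l : List ℤ) {a : ℕ} (ha : 2 ≤ a) : initial l a = 0 := by
  funext i
  rw [initial, if_neg (by omega), if_neg (by omega)]
  rfl

theorem initial_table (e : Clause 3 n) :
    initial (encodeInstance ⟨n, I⟩) 0 (clauseIndex e + 1) = if e ∈ I then 1 else 0 := by
  have h1 : ((clauseIndex e : ℤ) + 1).toNat = clauseIndex e + 1 := by omega
  rw [initial, if_pos rfl, if_pos (by omega), h1, encodeInstance, List.getD_cons_succ,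
    List.getD_eq_getElem _ _ (by simpa using clauseIndex_lt e), List.getElem_ofFn]
  have h2 : (⟨clauseIndex e, clauseIndex_lt e⟩ : Fin (2 ^ 3 * n ^ 3)) = (clauseEquiv n).symm e := rfl
  simp only [h2, clauseAt_clauseIndex]

theorem runs_setupProg (n : ℕ) (I : SignedHypergraph 3 n) :
    Runs setupProg (initial (encodeInstance ⟨n, I⟩)) 7 (fun s' => Ready n I s') := by
  set s := initial (encodeInstance ⟨n, I⟩)
  have h0 : s 0 0 = n := by
    simp only [s, initial, encodeInstance]; simp
  have h1 : s 1 0 = (8 * n ^ 3 + 1 : ℕ) := by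
    rw [← length_encodeInstance n I]; simp [s, initial]
  have hdiv : (n : ℤ) ^ 3 / n = n ^ 2 := by
    rcases Nat.eq_zero_or_pos n with rfl | h
    · simp
    · rw [pow_succ, Int.mul_ediv_cancel _ (by omega)]
  refine Runs.seq (k₂ := 5) (Runs.set (Runs.seq (k₂ := 3) (Runs.set (Runs.seq (Runs.set
    (Runs.set ⟨fun e => ?_, ?_, ?_, ?_, ?_⟩))))))
  · simp only [State.write_of_ne (show 0 ≠ 5 by norm_num), State.write_of_ne (show 0 ≠ 4 by norm_num),
      State.write_of_ne (show 0 ≠ 3 by norm_num), State.write_of_ne (show 0 ≠ 2 by norm_num)]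
    exact initial_table e
  all_goals
    simp [State.write_of_ne, State.write_self, Expr.val, Expr.val_var, h0, h1, hdiv]

def exponentProg : Prog :=
  .seq (.set 6 (.const 1)) (.seq (.set 7 (.const 2))
    (.loop (.sub (.var 2) (.var 6))
      (.seq (.set 6 (.add (.var 6) (.var 6))) (.set 7 (.add (.var 7) (.const 2))))))

theorem runs_exponentProg (hn : s 2 0 = n) :
    Runs exponentProg s (n * 4 + 5) (fun s' => s' 7 0 = traceExponent n) := by
  have hN : Nat.clog 2 n ≤ n := Nat.clog_le_of_le_pow Nat.lt_two_pow_self.le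
  refine (Runs.seq (k₂ := 1 + (Nat.clog 2 n * 4 + 1) + 1) (Runs.set (Runs.seq (Runs.set
    ((Runs.loop (k := 3) (Nat.clog 2 n) (fun k s' => s' 2 0 = n ∧ s' 6 0 = 2 ^ k ∧
      s' 7 0 = 2 * (k + 1)) ?_ ?_ ?_).mono le_rfl ?_))))).mono (by omega) fun _ _ h => h
  · rintro k hk s' ⟨h2, h6, h7⟩
    have hlt : (2 : ℤ) ^ k < n := by
      exact_mod_cast (Nat.lt_clog_iff_pow_lt (by norm_num)).1 hk
    refine ⟨by simp only [Expr.val, Expr.val_var, h2, h6]; omega, Runs.seq (Runs.set (Runs.set ?_))⟩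
    simp [State.write_of_ne, State.write_self, Expr.val, Expr.val_var, h2, h6, h7]
    constructor <;> ring
  · rintro s' ⟨h2, h6, h7⟩
    have hle : (n : ℤ) ≤ 2 ^ Nat.clog 2 n := by
      exact_mod_cast Nat.le_pow_clog (by norm_num) n
    simp only [Expr.val, Expr.val_var, h2, h6]; omega
  · simp [State.write_of_ne, State.write_self, Expr.val, hn]
  · rintro s' - ⟨-, -, h7⟩
    rw [h7, traceExponent]; push_cast; ring

/-! ### Degrees -/

/-- Adding `n` once per clause yields the products with `n` without multiplying two variables. -/
def degreeProg : Prog :=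
  Prog.forClauses (.seq (.store 15 (vertexExpr 2) (.add (.get 15 (vertexExpr 2)) (.var 2)))
    (.seq (.set 16 (.add (.var 16) (.const 1))) (.set 17 (.add (.var 17) (.var 2)))))

theorem degree_insert {J : SignedHypergraph 3 n} {e : Clause 3 n} (he : e ∉ J) (a : Fin 3) :
    (fun i => (n : ℤ) * degree (insert e J) a i) =
      (fun i => (n : ℤ) * degree J a i) + Pi.single (e.2 a) (n : ℤ) := by
  funext i
  rw [Pi.add_apply, degree, degree, filter_insert]
  by_cases h : e.2 a = i
  · subst h
    rw [if_pos rfl, card_insert_of_notMem (by simp [he]), Pi.single_eq_same]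
    push_cast; ring
  · rw [if_neg h, Pi.single_eq_of_ne (Ne.symm h), add_zero]

theorem runs_degreeProg (hs : Ready n I s) (h15 : s 15 = 0) (h16 : s 16 0 = 0) (h17 : s 17 0 = 0) :
    Runs degreeProg s (72 * n ^ 3 + 3) (fun s' =>
      s' 15 = vecArray (fun i : Fin n => (n : ℤ) * degree I 2 i) ∧ s' 16 0 = #I ∧
      s' 17 0 = (#I * n : ℕ)) := by
  refine (Runs.forClauses (k := 4) hs (fun J s' =>
      s' 15 = vecArray (fun i : Fin n => (n : ℤ) * degree J 2 i) ∧ s' 16 0 = #J ∧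
      s' 17 0 = (#J * n : ℕ)) (by simp [Prog.Avoids, Prog.set]) ?_ ?_ ?_).mono (by omega)
      fun _ _ h => h
  · have : (fun i : Fin n => (n : ℤ) * degree (∅ : SignedHypergraph 3 n) 2 i) = 0 := by
      funext i; simp [degree]
    simp [State.write_of_ne, h15, h16, h17, this, vecArray_zero]
  · intro J s' z h
    simpa [State.write_of_ne] using h
  · rintro J e s' he - hs' hj ⟨g15, g16, g17⟩
    refine Runs.seq (k₁ := 1) (k₂ := 3) (Runs.store (Runs.seq (Runs.set (Runs.set ?_))))
    have hv := hs'.val_vertexExpr hj 2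
    refine ⟨?_, ?_, ?_⟩
    · simp only [State.write_of_ne (show 15 ≠ 11 by norm_num),
        State.write_of_ne (show 15 ≠ 16 by norm_num), State.write_of_ne (show 15 ≠ 17 by norm_num),
        State.write_self, Expr.val, hv, g15, Expr.val_var, hs'.var_two]
      rw [update_vecArray_add, degree_insert he]
    · simp [State.write_of_ne, State.write_self, Expr.val, Expr.val_var, g16, he]
    · simp [State.write_of_ne, State.write_self, Expr.val, Expr.val_var, g17, he, hs'.var_two]
      ring

def deviationProg : Prog :=
  .for 8 2 (.branch (.sub (.get 15 (.var 8)) (.var 16))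
    (.set 18 (.add (.var 18) (.sub (.get 15 (.var 8)) (.var 16))))
    (.set 18 (.sub (.var 18) (.sub (.get 15 (.var 8)) (.var 16)))))

theorem runs_deviationProg (hn : s 2 0 = n)
    (h15 : s 15 = vecArray (fun i : Fin n => (n : ℤ) * degree I 2 i)) (h16 : s 16 0 = #I)
    (h18 : s 18 0 = 0) :
    Runs deviationProg s (n * 5 + 3) (fun s' => s' 18 0 = degreeDeviation I) := by
  refine (Runs.for (k := 2) (fun j s' => s' 18 0 =
    ∑ i ∈ univ.filter (fun i : Fin n => (i : ℕ) < j), |(n : ℤ) * degree I 2 i - #I|) hn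
    (by norm_num) (by simp [Prog.Avoids, Prog.set]) (by simp [Prog.Avoids, Prog.set]) ?_ ?_).mono
    le_rfl fun s' _ h => ?_
  · simp [State.write_of_ne, h18]
  · intro j hj s' hfr hj' h
    have e15 : s' 15 j = (n : ℤ) * degree I 2 ⟨j, hj⟩ := by
      rw [hfr 15 (by norm_num) (by simp [Prog.Avoids, Prog.set]), h15]
      exact vecArray_apply _ (⟨j, hj⟩ : Fin n)
    have e16 : s' 16 0 = #I := by
      rw [hfr 16 (by norm_num) (by simp [Prog.Avoids, Prog.set]), h16]
    have hval : (Expr.sub (.get 15 (.var 8)) (.var 16)).val s' =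
        (n : ℤ) * degree I 2 ⟨j, hj⟩ - #I := by
      simp only [Expr.val, Expr.val_var, hj', e15, e16]
    refine Runs.branch (fun hpos => Runs.set ?_) fun hneg => Runs.set ?_
    · rw [hval] at hpos
      rw [State.write_of_ne (by norm_num), State.write_self, Function.update_self,
        sum_filter_lt_succ _ hj, ← h, abs_of_pos hpos, ← hval]
      rfl
    · rw [hval] at hneg
      rw [State.write_of_ne (by norm_num), State.write_self, Function.update_self,
        sum_filter_lt_succ _ hj, ← h, abs_of_nonpos (not_lt.1 hneg), ← hval, ← sub_eq_add_neg]
      rfl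
  · rw [h, degreeDeviation]
    congr 1
    exact filter_true_of_mem fun i _ => i.isLt

/-! ### The norm bound and the output -/

/-- Each round doubles variable `19` once and variable `20` as often as the trace exponent, so that
`20` holds the corresponding power of the candidate `2 ^ k`. -/
def normProg : Prog :=
  .seq (.set 19 (.mul (.const 7) (.var 5))) (.seq (.set 20 (.const 1))
    (.loop (.sub (.var 14) (.var 20))
      (.seq (.set 19 (.add (.var 19) (.var 19)))
        (.for 10 7 (.set 20 (.add (.var 20) (.var 20)))))))

theorem runs_normProg (hs : Ready n I s) (h7 : s 7 0 = traceExponent n) (h14 : s 14 0 = traceSum I) :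
    Runs normProg s (normLog I * (traceExponent n * 4 + 6) + 5)
      (fun s' => s' 19 0 = 7 * n ^ 2 * normBound I) := by
  refine (Runs.seq (k₂ := 1 + (normLog I * (traceExponent n * 4 + 6) + 1) + 1) (Runs.set (Runs.seq
    (Runs.set ((Runs.loop (k := traceExponent n * 4 + 5) (normLog I) (fun k s' =>
      s' 7 0 = traceExponent n ∧ s' 14 0 = traceSum I ∧ s' 19 0 = 7 * n ^ 2 * 2 ^ k ∧
      s' 20 0 = (2 ^ traceExponent n) ^ k) ?_ ?_ ?_).mono le_rfl ?_))))).mono (by omega)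
      fun _ _ h => h
  · rintro k hk s' ⟨g7, g14, g19, g20⟩
    have hlt : (2 ^ traceExponent n) ^ k < (traceSum I).toNat :=
      (Nat.lt_clog_iff_pow_lt (one_lt_two_pow_traceExponent n)).1 hk
    have hlt' : ((2 : ℤ) ^ traceExponent n) ^ k < traceSum I := by
      rw [← Int.toNat_of_nonneg (traceSum_nonneg I)]; exact_mod_cast hlt
    refine ⟨by simp only [Expr.val, Expr.val_var, g14, g20]; omega, (Runs.seq (k₁ := 1)
      (k₂ := traceExponent n * 4 + 3) (Runs.set ?_)).mono (by omega) fun _ _ h => h⟩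
    refine (Runs.for (k := 1) (N := traceExponent n) (fun r s' =>
      s' 20 0 = (2 ^ traceExponent n) ^ k * 2 ^ r) ?_ (by norm_num) (by simp [Prog.Avoids, Prog.set])
      (by simp [Prog.Avoids, Prog.set]) ?_ ?_).mono le_rfl fun s'' hfr h => ⟨?_, ?_, ?_, ?_⟩
    · rw [State.write_of_ne (by norm_num), g7]
    · rw [State.write_of_ne (by norm_num), State.write_of_ne (by norm_num), g20, pow_zero, mul_one]
    · intro r _ s'' _ _ h
      refine Runs.set ?_
      rw [State.write_of_ne (by norm_num), State.write_self, Function.update_self, Expr.val,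
        Expr.val_var, h]
      ring
    · rw [hfr 7 (by simp [Prog.for, Prog.Avoids, Prog.set]), State.write_of_ne (by norm_num), g7]
    · rw [hfr 14 (by simp [Prog.for, Prog.Avoids, Prog.set]), State.write_of_ne (by norm_num), g14]
    · rw [hfr 19 (by simp [Prog.for, Prog.Avoids, Prog.set]), State.write_self,
        Function.update_self, Expr.val, Expr.val_var, g19]
      ring
    · rw [h, pow_succ]
  · rintro s' ⟨g7, g14, g19, g20⟩
    have hle : (traceSum I).toNat ≤ (2 ^ traceExponent n) ^ normLog I :=
      Nat.le_pow_clog (one_lt_two_pow_traceExponent n) _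
    have hle' : traceSum I ≤ ((2 : ℤ) ^ traceExponent n) ^ normLog I := by
      rw [← Int.toNat_of_nonneg (traceSum_nonneg I)]; exact_mod_cast hle
    simp only [Expr.val, Expr.val_var, g14, g20]; omega
  · simp [State.write_of_ne, State.write_self, Expr.val, Expr.val_var, h7, h14, hs.var_five]
  · rintro s' - ⟨-, -, g19, -⟩
    rw [g19, normBound]; push_cast; rfl

def outputProg : Prog :=
  .branch (.var 17)
    (.seq (.set 0 (.add (.add (.mul (.const 2) (.var 18)) (.var 19)) (.const 1)))
      (.store 0 (.const 1) (.var 17)))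
    (.seq (.set 0 (.const 2)) (.store 0 (.const 1) (.const 1)))

theorem runs_outputProg (h17 : s 17 0 = (#I * n : ℕ)) (h18 : s 18 0 = degreeDeviation I)
    (h19 : s 19 0 = 7 * n ^ 2 * normBound I) :
    Runs outputProg s 4 (fun s' => biasBound ⟨n, I⟩ = (s' 0 0 : ℚ) / (s' 0 1 : ℚ)) := by
  refine Runs.branch (fun hpos => Runs.seq (Runs.set (Runs.store ?_)))
    fun hneg => Runs.seq (Runs.set (Runs.store ?_))
  · rw [Expr.val_var, h17] at hpos
    have h0 : #I * n ≠ 0 := by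
      intro h; rw [h] at hpos; exact lt_irrefl _ hpos
    rw [biasBound, if_neg h0]
    simp [State.write_of_ne, State.write_self, Expr.val, Expr.val_var, h17, h18, h19]
  · rw [Expr.val_var, h17] at hneg
    have h0 : #I * n = 0 := by
      by_contra h
      exact hneg (by exact_mod_cast Nat.pos_of_ne_zero h)
    rw [biasBound, if_pos h0]
    simp [State.write_self, Expr.val]

end RAM

/-! ### Polynomial running time of the whole algorithm. -/

namespace RAM

open Finset Matrix

variable {n : ℕ} {I : SignedHypergraph 3 n}

/-! ### The whole algorithm -/

def statisticsProg : Prog :=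
  .seq setupProg (.seq exponentProg (.seq (traceSumProg signForms) (.seq degreeProg deviationProg)))

def biasProg : Prog := .seq statisticsProg (.seq normProg outputProg)

def statisticsSteps (n : ℕ) : ℕ :=
  7 * (n * (diagSteps n (2 * n + 2) + 3) + 4) + 72 * n ^ 3 + 9 * n + 23

theorem traceExponent_le (n : ℕ) : traceExponent n ≤ 2 * n + 2 := by
  have : Nat.clog 2 n ≤ n := Nat.clog_le_of_le_pow Nat.lt_two_pow_self.le
  rw [traceExponent]; omega

theorem runs_statisticsProg (n : ℕ) (I : SignedHypergraph 3 n) :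
    Runs statisticsProg (initial (encodeInstance ⟨n, I⟩)) (statisticsSteps n) (fun s =>
      Ready n I s ∧ s 7 0 = traceExponent n ∧ s 14 0 = traceSum I ∧ s 17 0 = (#I * n : ℕ) ∧
      s 18 0 = degreeDeviation I) := by
  have hsteps : 7 + (n * 4 + 5 + (7 * (n * (diagSteps n (traceExponent n) + 3) + 4) + 1 +
      (72 * n ^ 3 + 3 + (n * 5 + 3) + 1) + 1) + 1) + 1 ≤ statisticsSteps n := by
    have h1 : diagSteps n (traceExponent n) ≤ diagSteps n (2 * n + 2) := by
      simp only [diagSteps]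
      have := Nat.mul_le_mul_right (56 * n ^ 3 + 6 * n + 10) (traceExponent_le n)
      omega
    have h2 := Nat.mul_le_mul_left n (Nat.add_le_add_right h1 3)
    rw [statisticsSteps]; omega
  set s₀ := initial (encodeInstance ⟨n, I⟩)
  refine (Runs.seq ((runs_setupProg n I).mono le_rfl fun s₁ hfr₁ h₁ => Runs.seq
    ((runs_exponentProg h₁.var_two).mono le_rfl fun s₂ hfr₂ h₂ => ?_))).mono hsteps fun _ _ h => h
  have hready₂ : Ready n I s₂ := h₁.congr fun a ha => hfr₂ a (by
    simp [exponentProg, Prog.set, Prog.Avoids] at ha ⊢; omega)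
  have hzero₂ : ∀ a, 12 ≤ a → s₂ a = 0 := fun a ha => by
    rw [hfr₂ a (by simp [exponentProg, Prog.set, Prog.Avoids]; omega),
      hfr₁ a (by simp [setupProg, Prog.set, Prog.Avoids]; omega)]
    exact initial_of_two_le _ (by omega)
  refine Runs.seq ((runs_traceSumProg signForms hready₂ h₂ ⟨0, by rw [hzero₂ 12 le_rfl, vecArray_zero]⟩
    (by rw [hzero₂ 13 (by norm_num), vecArray_zero])).mono le_rfl fun s₃ hfr₃ h₃ => ?_)
  have hfr₃' : ∀ a, a ∉ [8, 9, 10, 11, 12, 13, 14] → s₃ a = s₂ a := fun a ha =>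
    hfr₃ a (avoids_traceSumProg signForms ha)
  have hready₃ : Ready n I s₃ := hready₂.congr fun a ha => hfr₃' a (by simp at ha ⊢; omega)
  have hzero₃ : ∀ a, 15 ≤ a → s₃ a = 0 := fun a ha => by
    rw [hfr₃' a (by simp; omega), hzero₂ a (by omega)]
  refine Runs.seq ((runs_degreeProg hready₃ (hzero₃ 15 le_rfl)
    (by rw [hzero₃ 16 (by norm_num)]; rfl) (by rw [hzero₃ 17 (by norm_num)]; rfl)).mono le_rfl
    fun s₄ hfr₄ h₄ => ?_)
  have hfr₄' : ∀ a, a ∉ [11, 15, 16, 17] → s₄ a = s₃ a := fun a ha => hfr₄ a (by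
    simp [degreeProg, Prog.forClauses, Prog.for, Prog.set, Prog.Avoids] at ha ⊢; omega)
  have hready₄ : Ready n I s₄ := hready₃.congr fun a ha => hfr₄' a (by simp at ha ⊢; omega)
  refine (runs_deviationProg hready₄.var_two h₄.1 h₄.2.1
    (by rw [hfr₄' 18 (by simp), hzero₃ 18 (by norm_num)]; rfl)).mono le_rfl fun s₅ hfr₅ h₅ => ?_
  have hfr₅' : ∀ a, a ∉ [8, 18] → s₅ a = s₄ a := fun a ha => hfr₅ a (by
    simp [deviationProg, Prog.for, Prog.set, Prog.Avoids] at ha ⊢; omega)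
  refine ⟨hready₄.congr fun a ha => hfr₅' a (by simp at ha ⊢; omega), ?_, ?_, ?_, h₅⟩
  · rw [hfr₅' 7 (by simp), hfr₄' 7 (by simp), hfr₃' 7 (by simp), h₂]
  · rw [hfr₅' 14 (by simp), hfr₄' 14 (by simp), h₃, hzero₂ 14 (by norm_num)]
    exact zero_add _
  · rw [hfr₅' 17 (by simp), h₄.2.2]

theorem boundedBy_initial (n : ℕ) (I : SignedHypergraph 3 n) :
    (initial (encodeInstance ⟨n, I⟩)).BoundedBy (8 * n ^ 3 + 1) := by
  have hn : n ≤ 8 * n ^ 3 + 1 := by nlinarith [Nat.le_self_pow (n := 3) (by norm_num) n]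
  have hmem : ∀ z ∈ encodeInstance ⟨n, I⟩, z.natAbs ≤ 8 * n ^ 3 + 1 := by
    intro z hz
    simp only [encodeInstance, List.mem_cons, List.mem_ofFn] at hz
    rcases hz with rfl | ⟨j, rfl⟩
    · simpa using hn
    · split_ifs <;> simp
  intro a i
  rw [initial, length_encodeInstance]
  split_ifs with h1 h2 h3
  · by_cases hlt : i.toNat < (encodeInstance ⟨n, I⟩).length
    · rw [List.getD_eq_getElem _ _ hlt]; exact hmem _ (List.getElem_mem hlt)
    · rw [List.getD_eq_default _ _ (not_lt.1 hlt)]; simp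
  · simp
  · exact (Int.natAbs_natCast _).le
  · simp

theorem tame_traceSumProg (l : List SignForm) : (traceSumProg l).Tame := by
  induction l with
  | nil => trivial
  | cons f l ih =>
    refine ⟨?_, ih⟩
    simp only [traceProg, diagProg, Prog.set, mulVecProg, Prog.forClauses, Prog.for, formStep,
      Prog.Tame]
    repeat' first
      | exact trivial
      | apply And.intro
      | apply tame_vertexExpr
      | apply Expr.tame_var
      | apply Expr.tame_const
      | apply Expr.Tame.get
      | apply Expr.Tame.add
      | apply Expr.Tame.sub
      | exact Expr.Tame.mul_of_bound (tame_signProdExpr _) (.get (tame_vertexExpr _) _) 1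
          (natAbs_signProdExpr_le _)

theorem tame_biasProg : biasProg.Tame := by
  refine ⟨⟨?_, ?_, tame_traceSumProg _, ?_⟩, ?_⟩
  all_goals
    simp only [setupProg, exponentProg, degreeProg, deviationProg, normProg, outputProg, Prog.set,
      Prog.forClauses, Prog.for, Prog.Tame]
    repeat' first
      | exact trivial
      | apply And.intro
      | apply tame_vertexExpr
      | apply Expr.tame_var
      | apply Expr.tame_const
      | apply Expr.Tame.get
      | apply Expr.Tame.add
      | apply Expr.Tame.sub
      | apply Expr.Tame.div
      | exact Expr.Tame.mul_of_bound (Expr.tame_const _) (Expr.tame_var _) _ fun _ => le_rfl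

/-- A bound on the number of steps, in terms of the growth rate of the program. -/
def biasSteps (C n : ℕ) : ℕ :=
  statisticsSteps n +
    (((statisticsSteps n * C.size + (8 * n ^ 3 + 1)) * ((2 * n + 2) * 4 + 6) + 5) + 4 + 1) + 1

theorem normLog_le (I : SignedHypergraph 3 n) {m : ℕ} (h : (traceSum I).toNat ≤ m) :
    normLog I ≤ m.size := by
  refine Nat.clog_le_of_le_pow ?_
  rw [← pow_mul]
  refine (h.trans (Nat.lt_size_self m).le).trans (Nat.pow_le_pow_right (by norm_num) ?_)
  exact Nat.le_mul_of_pos_left _ (by simp [traceExponent])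

theorem runs_biasProg {C : ℕ} (hC : 1 ≤ C) (hbias : biasProg.TameWith C) (n : ℕ)
    (I : SignedHypergraph 3 n) :
    Runs biasProg (initial (encodeInstance ⟨n, I⟩)) (biasSteps C n) (fun s =>
      biasBound ⟨n, I⟩ = (s 0 0 : ℚ) / (s 0 1 : ℚ)) := by
  obtain ⟨t, ht, s, hs, hready, h7, h14, h17, h18⟩ := runs_statisticsProg n I
  -- The trace sum is already in memory after `t` steps, so the growth bound for the program limits
  -- its bit length, and with it the number of rounds in `normProg`.
  have hbd := (hs.exists_exec hC hbias.1 _ (by omega) (boundedBy_initial n I)).1 14 0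
  have hlog : normLog I ≤ statisticsSteps n * C.size + (8 * n ^ 3 + 1) := by
    refine (normLog_le I (m := C ^ t * (8 * n ^ 3 + 1)) ?_).trans ((size_pow_mul_le _ _ _).trans
      (add_le_add (Nat.mul_le_mul_right _ ht) (size_le_self _)))
    rw [h14] at hbd
    omega
  have hnorm : Runs normProg s _ _ := runs_normProg hready h7 h14
  obtain ⟨t', ht', s', hs', hq⟩ := Runs.seq (c₂ := outputProg) (hnorm.mono le_rfl
    fun s' hfr h19 => runs_outputProg
      (by rw [hfr 17 (by simp [normProg, Prog.for, Prog.set, Prog.Avoids]), h17])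
      (by rw [hfr 18 (by simp [normProg, Prog.for, Prog.set, Prog.Avoids]), h18]) h19)
  refine ⟨t + t' + 1, ?_, s', .seq hs hs', hq⟩
  have hE := traceExponent_le n
  have : normLog I * (traceExponent n * 4 + 6) ≤
      (statisticsSteps n * C.size + (8 * n ^ 3 + 1)) * ((2 * n + 2) * 4 + 6) :=
    Nat.mul_le_mul hlog (by omega)
  rw [biasSteps]; omega

theorem polyBounded_statisticsSteps : PolyBounded statisticsSteps := by
  unfold statisticsSteps diagSteps
  repeat' first
    | with_reducible apply polyBounded_const
    | with_reducible apply polyBounded_id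
    | with_reducible apply PolyBounded.pow
    | with_reducible apply PolyBounded.add
    | with_reducible apply PolyBounded.mul

theorem polyBounded_biasSteps (C : ℕ) : PolyBounded (biasSteps C) := by
  unfold biasSteps
  repeat' first
    | with_reducible apply polyBounded_const
    | with_reducible apply polyBounded_id
    | with_reducible exact polyBounded_statisticsSteps
    | with_reducible apply PolyBounded.pow
    | with_reducible apply PolyBounded.add
    | with_reducible apply PolyBounded.mul

theorem length_le_inputSize (l : List ℤ) : l.length ≤ inputSize l := by
  induction l with
  | nil => simp [inputSize]
  | cons z l ih =>
    rw [List.length_cons, inputSize, List.map_cons, List.sum_cons, bitCost]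
    rw [inputSize] at ih
    omega

/-- The number of steps is polynomial in `n`, the bit lengths are at most linear in it up to a
polynomial in `n`, and `n` is at most the input size because the whole table is part of the input.
-/
theorem polyTimeComputable_biasBound : PolyTimeComputable encodeInstance biasBound := by
  obtain ⟨C, hC, hbias⟩ := tame_biasProg.exists_tameWith
  have hpoly : PolyBounded fun n =>
      biasSteps C n * (3 * C * (biasSteps C n * C.size + (8 * n ^ 3 + 1))) := by
    repeat' first
      | with_reducible apply polyBounded_const
      | with_reducible apply polyBounded_id
      | with_reducible exact polyBounded_biasSteps C
      | with_reducible apply PolyBounded.pow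
      | with_reducible apply PolyBounded.add
      | with_reducible apply PolyBounded.mul
  obtain ⟨P, hP⟩ := hpoly
  refine ⟨biasProg, P, fun ⟨n, I⟩ => ?_⟩
  obtain ⟨k, hk, s, hs, hq⟩ := runs_biasProg hC hbias n I
  obtain ⟨-, t, ht, hexec⟩ := hs.exists_exec hC hbias _ (by omega) (boundedBy_initial n I)
  refine ⟨t, s, hexec, ?_, hq⟩
  have hn : n ≤ inputSize (encodeInstance ⟨n, I⟩) := by
    refine le_trans ?_ (length_le_inputSize _)
    rw [length_encodeInstance]
    nlinarith [Nat.le_self_pow (n := 3) (by norm_num) n]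
  refine (ht.trans ?_).trans ((hP n).trans (eval_monotone P hn))
  have h1 := (size_pow_mul_le C k (8 * n ^ 3 + 1)).trans
    (add_le_add (Nat.mul_le_mul_right _ hk) (size_le_self _))
  exact Nat.mul_le_mul hk (Nat.mul_le_mul_left _ h1)

end RAM

theorem mainTheorem6 :
    ∃ A : (Σ n : ℕ, SignedHypergraph 3 n) → ℚ,
      RAM.PolyTimeComputable encodeInstance A ∧
      (∀ (n : ℕ) (I : SignedHypergraph 3 n) (ρ : ℝ), (A ⟨n, I⟩ : ℝ) ≤ ρ →
        ¬ ∃ x : Fin n → ℤˣ, IsBiased ρ x ∧ IsSatisfying I (ρ / 32) x) ∧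
      (∀ (δ : ℝ), 0 < δ → δ ≤ 2 → ∀ ρ : ℕ → ℝ,
        Tendsto (fun n : ℕ => ρ n / √(Real.log n / (n : ℝ) ^ δ)) atTop atTop →
        Tendsto (fun n : ℕ => instanceProb 3 n ((n : ℝ) ^ (1 + δ))
          (fun I => (A ⟨n, I⟩ : ℝ) ≤ ρ n)) atTop (𝓝 1)) :=
  ⟨biasBound, RAM.polyTimeComputable_biasBound,
    fun _ I ρ hρ => not_exists_isBiased_and_isSatisfying I ρ hρ,
    fun _ hδ0 hδ2 _ hρ => tendsto_instanceProb_biasBound_le hδ0 hδ2 hρ⟩
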